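/- Let $n\in\{1,2\}$, $T>0$, and let $(\Omega,\mathcal F,\mathbb P)$ be a probability space. Let $\Gamma(t)\subset\mathbb R^{n+1}$, $t\in[0,T]$, be compact connected oriented $C^3$ hypersurfaces without boundary, transported from $\Gamma(0)$ by the flow of a $C^2$ velocity field $\mathrm v$, with signed distance function $d(\cdot,t)$ on a neighbourhood $\mathcal N(t)$ ($d,d_t,d_{x_i},d_{x_ix_j}$ of class $C^1$), normal $\nu=\nabla d$, and such that each $x\in\mathcal N(t)$ has a unique $p(x,t)\in\Gamma(t)$ with $x=p(x,t)+d(x,t)\,\nu(p(x,t),t)$. Put $\mathcal G_T=\bigcup_{t}\Gamma(t)\times\{t\}$. Let $\mathcal T_h(t)$ be a conforming triangulation with nondegenerate $n$-simplices whose vertices $X_1(t),\dots,X_J(t)$ satisfy $X_j(0)\in\Gamma(0)$ and $X_j'(t)=\mathrm v(X_j(t),t)$. Let $\Gamma_h(t)$ be its union; assume $\Gamma_h(t)\subset\mathcal N(t)$ and that each $p\in\Gamma(t)$ equals $p(x,t)$ for exactly one $x\in\Gamma_h(t)$. Let $V_h$ be the piecewise linear interpolation of $\mathrm v$ on $\Gamma_h(t)$,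 $\partial_h^\bullet$ the elementwise derivative along the motion generated by $V_h$, and $\nabla_{\Gamma_h}$ the elementwise tangential gradient. Let $S_h(t)$ be the space of continuous functions on $\Gamma_h(t)$ that are affine on each simplex, and $V_h(t):=L^2(\Omega,S_h(t))$ with the norm of $L^2(\Omega,H^1(\Gamma_h(t)))$. Let $\mathcal C^1_{S_h}$ be the space of families $u(t)\in S_h(t)$ whose pull-back to $\Gamma_h(0)$ by the motion generated by $V_h$ lies in $C^1([0,T],S_h(0))$, with $$\|u\|_{\mathcal C^1_{S_h}}^2=\int_0^T\|u(t)\|_{H^1(\Gamma_h(t))}^2+\|\partial_h^\bullet u(t)\|_{L^2(\Gamma_h(t))}^2\,dt .$$ Let $W_h=L^2(\Omega,\mathcal C^1_{S_h})$ be the space of Borel measurable square integrable maps $\Omega\to\mathcal C^1_{S_h}$, with $$\|U\|_{W_h}^2=\int_0^T\!\!\int_\Omega\|U\|_{H^1(\Gamma_h(t))}^2+\int_0^T\!\!\int_\Omega\|\partial_h^\bullet U\|_{L^2(\Gamma_h(t))}^2 .$$ Let $\alpha:\Omega\times\mathcal G_T\to\mathbb R$ be measurable with $0<\alpha_{\min}\le\alpha(\omega,\cdot)\le\alpha_{\max}$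 and $\alpha(\omega,\cdot)\in C^1(\mathcal G_T)$ for almost every $\omega$, with material derivative bounded uniformly in $\omega$. Put $\alpha^{-l}(\omega,x,t)=\alpha(\omega,p(x,t),t)$ and $$m_h(u,\varphi)=\int_\Omega\int_{\Gamma_h(t)}u\varphi,\quad a_h(u,\varphi)=\int_\Omega\int_{\Gamma_h(t)}\alpha^{-l}\nabla_{\Gamma_h}u\cdot\nabla_{\Gamma_h}\varphi,\quad g_h(u,\varphi)=\int_\Omega\int_{\Gamma_h(t)}u\varphi\,\nabla_{\Gamma_h}\!\cdot V_h ,$$ $$B_h=(\partial_h^\bullet\alpha^{-l}+\alpha^{-l}\nabla_{\Gamma_h}\!\cdot V_h)\,\mathrm{Id}-2\alpha^{-l}D_h(V_h),\qquad (D_h(V_h))_{ij}=(\nabla_{\Gamma_h}V_h^i)_j .$$ Then for every $U_{h,0}\in V_h(0)$ there is a $U_h\in W_h$ (so that $\omega\mapsto U_h(\omega)\in\mathcal C^1_{S_h}$ is measurable), unique up to null sets of $\Omega$, with $U_h(0)=U_{h,0}$ almost surely and $$\frac{d}{dt}m_h(U_h,\varphi)+a_h(U_h,\varphi)=m_h(U_h,\partial_h^\bullet\varphi)\qquad\text{for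 all }\varphi\in W_h\text{ and a.e. }t\in[0,T].$$ It is also the unique element of $W_h$ with $U_h(0)=U_{h,0}$ and $m_h(\partial_h^\bullet U_h,\varphi)+a_h(U_h,\varphi)+g_h(U_h,\varphi)=0$ for a.e. $t\in[0,T]$ and all $\varphi\in L^2(\Omega,S_h(t))$. Moreover, if $|\nabla_{\Gamma_h}\!\cdot V_h|\le D$ on all simplices and all $t\in[0,T]$, then $$\Big(\int_0^T\!\!\int_\Omega\|U_h\|_{H^1(\Gamma_h(t))}^2\Big)^{1/2}\le C_1\|U_{h,0}\|_{V_h(0)}$$ with $C_1$ depending only on $T,\alpha_{\min},D$; and if in addition $|B_h|\le B$ on all simplices, for all $t\in[0,T]$ and almost every $\omega$, then $$\|U_h\|_{W_h}\le C_2\|U_{h,0}\|_{V_h(0)}$$ with $C_2$ depending only on $T,\alpha_{\min},\alpha_{\max},D,B$. In particular both constants are independent of the mesh. -/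

import Mathlib

open MeasureTheory Set

noncomputable section

namespace ESFEM

/-- The ambient Euclidean space `ℝ^{n+1}`. -/
abbrev Amb (n : ℕ) : Type := EuclideanSpace ℝ (Fin (n + 1))

/-- `S` is an embedded hypersurface of class `C^3` without boundary: locally it is the zero set of a
`C^3` function with nonvanishing derivative. -/
def IsC3Hypersurface {n : ℕ} (S : Set (Amb n)) : Prop :=
  ∀ x ∈ S, ∃ (O : Set (Amb n)) (f : Amb n → ℝ), IsOpen O ∧ x ∈ O ∧ ContDiffOn ℝ 3 f O ∧
    (∀ y ∈ O, fderiv ℝ f y ≠ 0) ∧ S ∩ O = {y ∈ O | f y = 0}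

/-- An evolving closed hypersurface `Γ(t) ⊆ ℝ^{n+1}`, `t ∈ [0,T]`, transported by a velocity
field `v`, together with its signed distance function `d` on a tubular neighbourhood. Only times
`t ∈ [0,T]` matter. Orientability of `Γ(t)` is witnessed by the unit normal `∇ d`. -/
structure EvolvingSurface (n : ℕ) (T : ℝ) where
  /-- the surface `Γ(t)` -/
  Γ : ℝ → Set (Amb n)
  /-- the velocity field -/
  v : ℝ → Amb n → Amb n
  /-- the flow, `Φ t : Γ(0) → Γ(t)` -/
  Φ : ℝ → Amb n → Amb n
  /-- the signed distance function -/
  d : ℝ → Amb n → ℝ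
  /-- open set of space-time whose slice at time `t` is the neighbourhood `N(t)` of `Γ(t)` -/
  nbhd : Set (ℝ × Amb n)
  hypersurface : ∀ t ∈ Icc 0 T, IsC3Hypersurface (Γ t)
  compact : ∀ t ∈ Icc 0 T, IsCompact (Γ t)
  connected : ∀ t ∈ Icc 0 T, IsConnected (Γ t)
  v_smooth : ContDiffOn ℝ 2 (fun q : ℝ × Amb n => v q.1 q.2) (Icc 0 T ×ˢ univ)
  flow_zero : ∀ x ∈ Γ 0, Φ 0 x = x
  flow_bij : ∀ t ∈ Icc 0 T, BijOn (Φ t) (Γ 0) (Γ t)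
  flow_ode : ∀ x ∈ Γ 0, ∀ t ∈ Icc 0 T,
    HasDerivWithinAt (fun s => Φ s x) (v t (Φ t x)) (Icc 0 T) t
  /- `Φ ∈ C([0,T], C^3(Γ(0)))`. With the differential equation and `v ∈ C^2` this contains
  `Φ ∈ C^1([0,T], C^1(Γ(0)))` and the regularity of the inverse of `Φ t`. -/
  flow_smooth : ∃ O : Set (Amb n), IsOpen O ∧ Γ 0 ⊆ O ∧
    (∀ t ∈ Icc 0 T, ContDiffOn ℝ 3 (Φ t) O) ∧
    ∀ k ≤ 3, ContinuousOn (fun q : ℝ × Amb n => iteratedFDeriv ℝ k (Φ q.1) q.2) (Icc 0 T ×ˢ O)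
  nbhd_open : IsOpen nbhd
  nbhd_covers : ∀ t ∈ Icc 0 T, ∀ x ∈ Γ t, (t, x) ∈ nbhd
  signed_distance : ∀ t ∈ Icc 0 T, ∃ D : Set (Amb n),
    IsOpen D ∧ Bornology.IsBounded D ∧ frontier D = Γ t ∧
    ∀ x, (t, x) ∈ nbhd →
      (x ∈ D → d t x = -Metric.infDist x (Γ t)) ∧ (x ∉ D → d t x = Metric.infDist x (Γ t))
  d_smooth : ContDiffOn ℝ 1 (fun q : ℝ × Amb n => d q.1 q.2) (nbhd ∩ Icc 0 T ×ˢ univ)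
  d_time_smooth : ContDiffOn ℝ 1
    (fun q : ℝ × Amb n => derivWithin (fun s => d s q.2) (Icc 0 T) q.1) (nbhd ∩ Icc 0 T ×ˢ univ)
  d_grad_smooth : ContDiffOn ℝ 1
    (fun q : ℝ × Amb n => gradient (d q.1) q.2) (nbhd ∩ Icc 0 T ×ˢ univ)
  d_hess_smooth : ContDiffOn ℝ 1
    (fun q : ℝ × Amb n => fderiv ℝ (gradient (d q.1)) q.2) (nbhd ∩ Icc 0 T ×ˢ univ)
  d_grad_ne : ∀ t ∈ Icc 0 T, ∀ x, (t, x) ∈ nbhd → gradient (d t) x ≠ 0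
  /- unique normal projection onto `Γ(t)` -/
  proj_unique : ∀ t ∈ Icc 0 T, ∀ x, (t, x) ∈ nbhd →
    ∃! q, q ∈ Γ t ∧ x = q + d t x • gradient (d t) q
  /- bounded tangential divergence `∇_Γ · v = tr (Dv) - (Dv ν) · ν` -/
  div_bounded : ∃ c : ℝ, ∀ t ∈ Icc 0 T, ∀ x ∈ Γ t,
    |LinearMap.trace ℝ (Amb n) (fderiv ℝ (v t) x).toLinearMap -
      inner ℝ (fderiv ℝ (v t) x (gradient (d t) x)) (gradient (d t) x)| ≤ c

namespace EvolvingSurface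

variable {n : ℕ} {T : ℝ} (S : EvolvingSurface n T)

/-- The normal projection `p(x,t)`: the unique `p ∈ Γ(t)` with `x = p + d(x,t) ν(p,t)`. -/
def proj (t : ℝ) (x : Amb n) : Amb n :=
  Classical.epsilon fun q => q ∈ S.Γ t ∧ x = q + S.d t x • gradient (S.d t) q

/-- The space-time surface `G_T`. -/
def GT : Set (ℝ × Amb n) := {q | q.1 ∈ Icc 0 T ∧ q.2 ∈ S.Γ q.1}

/-- The assumptions on the random diffusion coefficient `α` (only its values on `G_T` matter):
joint measurability, paths in `C^1(G_T)` with a material derivative bounded uniformly in `ω`, and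
the uniform bounds `αmin ≤ α ≤ αmax`. -/
structure DiffusionCoeff {Ω : Type*} [MeasurableSpace Ω] (P : Measure Ω)
    (αmin αmax : ℝ) (α : Ω → ℝ → Amb n → ℝ) : Prop where
  measurable : Measurable fun q : Ω × S.GT => α q.1 q.2.1.1 q.2.1.2
  smooth : ∀ᵐ ω ∂P, ∃ (O : Set (ℝ × Amb n)) (F : ℝ × Amb n → ℝ), IsOpen O ∧ S.GT ⊆ O ∧
    ContDiffOn ℝ 1 F O ∧ ∀ q ∈ S.GT, F q = α ω q.1 q.2
  matDeriv_bounded : ∃ c : ℝ, ∀ᵐ ω ∂P, ∀ x ∈ S.Γ 0, ∀ t ∈ Icc 0 T,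
    |derivWithin (fun s => α ω s (S.Φ s x)) (Icc 0 T) t| ≤ c
  bounds : ∀ᵐ ω ∂P, ∀ t ∈ Icc 0 T, ∀ x ∈ S.Γ t, αmin ≤ α ω t x ∧ α ω t x ≤ αmax

/-- The inverse lift `α^{-l}(ω,x,t) = α(ω,p(x,t),t)`. -/
def invLift {Ω : Type*} (α : Ω → ℝ → Amb n → ℝ) (ω : Ω) (t : ℝ) (x : Amb n) : ℝ :=
  α ω t (S.proj t x)

end EvolvingSurface

/-- An evolving triangulation `𝒯_h(t)` interpolating `Γ(t)`: finitely many nondegenerate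
`n`-simplices whose vertices start on `Γ(0)` and move with the velocity `v`. Since the time interval
is compact and the simplices stay nondegenerate, shape regularity and quasi-uniformity in time hold
for each such triangulation with constants of its own. -/
structure EvolvingMesh {n : ℕ} {T : ℝ} (S : EvolvingSurface n T) where
  /-- number of vertices -/
  J : ℕ
  /-- number of elements -/
  M : ℕ
  /-- the vertices of each element -/
  elem : Fin M → Fin (n + 1) → Fin J
  /-- the vertex trajectories -/
  X : Fin J → ℝ → Amb n
  vertex_mem : ∀ j, X j 0 ∈ S.Γ 0
  vertex_ode : ∀ j, ∀ t ∈ Icc 0 T, HasDerivWithinAt (X j) (S.v t (X j t)) (Icc 0 T) t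
  vertex_used : ∀ j, ∃ σ i, elem σ i = j
  nondegenerate : ∀ t ∈ Icc 0 T, ∀ σ, AffineIndependent ℝ fun i => X (elem σ i) t
  elem_distinct : Function.Injective fun σ => range (elem σ)
  /- two different elements meet in the common simplex spanned by their common vertices -/
  conforming : ∀ t ∈ Icc 0 T, ∀ σ τ,
    convexHull ℝ (range fun i => X (elem σ i) t) ∩ convexHull ℝ (range fun i => X (elem τ i) t)
      = convexHull ℝ ((fun j => X j t) '' (range (elem σ) ∩ range (elem τ)))
  /- `Γ_h(t) ⊆ N(t)` -/
  subset_nbhd : ∀ t ∈ Icc 0 T, ∀ σ, ∀ x ∈ convexHull ℝ (range fun i => X (elem σ i) t),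
    (t, x) ∈ S.nbhd
  /- every `p ∈ Γ(t)` is the normal projection of exactly one point of `Γ_h(t)` -/
  lift_unique : ∀ t ∈ Icc 0 T, ∀ p ∈ S.Γ t, ∃! x,
    (∃ σ, x ∈ convexHull ℝ (range fun i => X (elem σ i) t)) ∧
      x = p + S.d t x • gradient (S.d t) p

/-- The tangential derivative `w ↦ Df(x) (P w)` of a function on a flat set `K`, with `P` the
orthogonal projection onto the direction of `K`. It depends only on the
values of `f` on `K` when `K` is a nondegenerate simplex. -/
def tangDeriv {n : ℕ} {F : Type*} [NormedAddCommGroup F] [NormedSpace ℝ F]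
    (K : Set (Amb n)) (f : Amb n → F) (x : Amb n) : Amb n →L[ℝ] F :=
  (fderivWithin ℝ f K x).comp (vectorSpan ℝ K).starProjection

/-- The tangential gradient `∇f - (∇f · ν) ν` on a flat set `K`. -/
def tangGrad {n : ℕ} (K : Set (Amb n)) (f : Amb n → ℝ) (x : Amb n) : Amb n :=
  (InnerProductSpace.toDual ℝ (Amb n)).symm (tangDeriv K f x)

namespace EvolvingMesh

variable {n : ℕ} {T : ℝ} {S : EvolvingSurface n T} (𝒯 : EvolvingMesh S)

/-- The element `E_σ(t)`. -/
def E (σ : Fin 𝒯.M) (t : ℝ) : Set (Amb n) :=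
  convexHull ℝ (range fun i => 𝒯.X (𝒯.elem σ i) t)

/-- The discrete surface `Γ_h(t)`. -/
def Γh (t : ℝ) : Set (Amb n) := ⋃ σ, 𝒯.E σ t

instance (t : ℝ) : CompactSpace (𝒯.Γh t) :=
  isCompact_iff_compactSpace.mp
    (isCompact_iUnion fun _ => (finite_range _).isCompact_convexHull (𝕜 := ℝ))

open Classical in
/-- Piecewise linear interpolation at time `t` of nodal values `c`, as a function on `Γ_h(t)`
(extended by zero). -/
def interp {F : Type*} [AddCommGroup F] [Module ℝ F] (t : ℝ) (c : Fin 𝒯.J → F) (x : Amb n) : F :=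
  if h : ∃ q : Fin 𝒯.M × (Fin (n + 1) → ℝ), q.2 ∈ stdSimplex ℝ (Fin (n + 1)) ∧
      x = ∑ i, q.2 i • 𝒯.X (𝒯.elem q.1 i) t
  then ∑ i, h.choose.2 i • c (𝒯.elem h.choose.1 i) else 0

/-- The discrete velocity `V_h(·,t)`, the interpolation of `v(·,t)`. -/
def Vh (t : ℝ) : Amb n → Amb n := 𝒯.interp t fun j => S.v t (𝒯.X j t)

/-- The discrete flow `Γ_h(t) → Γ_h(s)`: it is affine on the elements and maps `X_j(t)` to `X_j(s)`,
so that its trajectories are the integral curves of `V_h`. -/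
def flow (t s : ℝ) : Amb n → Amb n := 𝒯.interp t fun j => 𝒯.X j s

/-- The discrete material derivative `∂_h^• f = f_t + V_h · ∇ f`: the derivative of `f` along the
trajectories of `V_h`. -/
def matDeriv (f : ℝ → Amb n → ℝ) (t : ℝ) (x : Amb n) : ℝ :=
  derivWithin (fun s => f s (𝒯.flow t s x)) (Icc 0 T) t

/-- The discrete tangential divergence of `V_h` on the element `σ`. -/
def divVh (σ : Fin 𝒯.M) (t : ℝ) (x : Amb n) : ℝ :=
  LinearMap.trace ℝ (Amb n) (tangDeriv (𝒯.E σ t) (𝒯.Vh t) x).toLinearMap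

/-- The tensor `B_h = (∂_h^• α^{-l} + α^{-l} ∇_{Γ_h} · V_h) Id - 2 α^{-l} D_h(V_h)` on the
element `σ`, for one realization `a` of `α^{-l}`. -/
def Bh (a : ℝ → Amb n → ℝ) (σ : Fin 𝒯.M) (t : ℝ) (x : Amb n) : Amb n →L[ℝ] Amb n :=
  (𝒯.matDeriv a t x + a t x * 𝒯.divVh σ t x) • ContinuousLinearMap.id ℝ (Amb n)
    - (2 * a t x) • tangDeriv (𝒯.E σ t) (𝒯.Vh t) x

/-- The finite element space `S_h(t)`: continuous functions on `Γ_h(t)`, affine on each element.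
It is finite-dimensional; its topology is that of uniform convergence (or of any other norm). -/
def Sh (t : ℝ) : Submodule ℝ C(𝒯.Γh t, ℝ) where
  carrier := {η | ∀ σ, ∃ A : Amb n →ᵃ[ℝ] ℝ, ∀ x : 𝒯.Γh t, (x : Amb n) ∈ 𝒯.E σ t → η x = A x}
  zero_mem' := fun _ => ⟨0, fun _ _ => rfl⟩
  add_mem' := by
    intro a b ha hb σ
    obtain ⟨A, hA⟩ := ha σ
    obtain ⟨B, hB⟩ := hb σ
    exact ⟨A + B, fun x hx => by simp [hA x hx, hB x hx]⟩
  smul_mem' := by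
    intro c a ha σ
    obtain ⟨A, hA⟩ := ha σ
    exact ⟨c • A, fun x hx => by simp [hA x hx]⟩

variable {𝒯}

open Classical in
/-- A finite element function, extended by zero off `Γ_h(t)`. -/
def ext {t : ℝ} (η : 𝒯.Sh t) (x : Amb n) : ℝ :=
  if h : x ∈ 𝒯.Γh t then (η : C(𝒯.Γh t, ℝ)) ⟨x, h⟩ else 0

/-- The space-time function of a family `u(t) ∈ S_h(t)`. -/
def path (u : ∀ t : ℝ, 𝒯.Sh t) (t : ℝ) (x : Amb n) : ℝ := ext (u t) x

variable (𝒯)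

/-- The space `C^1_{S_h}`: families `u(t) ∈ S_h(t)` whose pull-back `t ↦ u(t) ∘ Φ_h(t)` is in
`C^1([0,T], S_h(0))`. The values for `t ∉ [0,T]` are irrelevant. -/
def C1 : Type :=
  {u : ∀ t : ℝ, 𝒯.Sh t // ∃ c : ℝ → 𝒯.Sh 0, ContDiffOn ℝ 1 c (Icc 0 T) ∧
    ∀ t ∈ Icc 0 T, ∀ x : 𝒯.Γh 0, (c t : C(𝒯.Γh 0, ℝ)) x = ext (u t) (𝒯.flow 0 t x)}

/-- `∫_{Γ_h(t)} f`, computed elementwise with respect to surface measure. -/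
def surfInt (t : ℝ) (f : Fin 𝒯.M → Amb n → ℝ) : ℝ :=
  ∑ σ, ∫ x in 𝒯.E σ t, f σ x ∂μHE[n]

/-- `‖f‖²_{L²(Γ_h(t))}`. -/
def l2sq (t : ℝ) (f : Amb n → ℝ) : ℝ := 𝒯.surfInt t fun _ x => f x ^ 2

/-- `‖f‖²_{H¹(Γ_h(t))}`. -/
def h1sq (t : ℝ) (f : Amb n → ℝ) : ℝ :=
  𝒯.l2sq t f + 𝒯.surfInt t fun σ x => ‖tangGrad (𝒯.E σ t) f x‖ ^ 2

/-- `∫_0^T ‖f(t)‖²_{H¹} + ‖∂_h^• f(t)‖²_{L²} dt`. -/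
def c1sq (f : ℝ → Amb n → ℝ) : ℝ :=
  ∫ t in (0 : ℝ)..T, (𝒯.h1sq t (f t) + 𝒯.l2sq t (𝒯.matDeriv f t))

/-- The topology of `C^1_{S_h}` induced by the norm `c1sq ^ (1/2)`. -/
@[reducible] def c1Topology : TopologicalSpace 𝒯.C1 where
  IsOpen O := ∀ u ∈ O, ∃ ε > 0, ∀ w : 𝒯.C1,
    √(𝒯.c1sq fun t x => path w.1 t x - path u.1 t x) < ε → w ∈ O
  isOpen_univ := fun _ _ => ⟨1, one_pos, fun _ _ => trivial⟩
  isOpen_inter := by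
    rintro A B hA hB u ⟨hu, hu'⟩
    obtain ⟨ε, hε, h⟩ := hA u hu
    obtain ⟨δ, hδ, h'⟩ := hB u hu'
    exact ⟨min ε δ, lt_min hε hδ, fun w hw =>
      ⟨h w (hw.trans_le (min_le_left _ _)), h' w (hw.trans_le (min_le_right _ _))⟩⟩
  isOpen_sUnion := by
    rintro 𝒜 h u ⟨A, hA, hu⟩
    obtain ⟨ε, hε, h'⟩ := h A hA u hu
    exact ⟨ε, hε, fun w hw => ⟨A, hA, h' w hw⟩⟩

section Random

variable {Ω : Type*} [MeasurableSpace Ω] (P : Measure Ω)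

/-- `φ ∈ V_h(t) = L²(Ω, S_h(t))`. -/
def MemVh (t : ℝ) (φ : Ω → 𝒯.Sh t) : Prop :=
  AEStronglyMeasurable φ P ∧ Integrable (fun ω => 𝒯.h1sq t (ext (φ ω))) P

/-- `‖φ‖_{V_h(t)}`. -/
def normVh (t : ℝ) (φ : Ω → 𝒯.Sh t) : ℝ := √(∫ ω, 𝒯.h1sq t (ext (φ ω)) ∂P)

/-- `U ∈ W_h(V_h,H_h) = L²(Ω, C^1_{S_h})`: `U` is measurable for the Borel σ-algebra of `C^1_{S_h}`
and square integrable. -/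
def MemWh (U : Ω → 𝒯.C1) : Prop :=
  (Measurable[_, @borel 𝒯.C1 𝒯.c1Topology] U) ∧ Integrable (fun ω => 𝒯.c1sq (path (U ω).1)) P

/-- The norm of `L²_{V_h}`. -/
def normL2Vh (U : Ω → 𝒯.C1) : ℝ :=
  √(∫ t in (0 : ℝ)..T, ∫ ω, 𝒯.h1sq t (path (U ω).1 t) ∂P)

/-- The norm of `W_h(V_h,H_h)`. -/
def normWh (U : Ω → 𝒯.C1) : ℝ :=
  √((∫ t in (0 : ℝ)..T, ∫ ω, 𝒯.h1sq t (path (U ω).1 t) ∂P) +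
    ∫ t in (0 : ℝ)..T, ∫ ω, 𝒯.l2sq t (𝒯.matDeriv (path (U ω).1) t) ∂P)

/-- The bilinear form `m_h`. -/
def mh (t : ℝ) (u φ : Ω → Amb n → ℝ) : ℝ :=
  ∫ ω, 𝒯.surfInt t (fun _ x => u ω x * φ ω x) ∂P

/-- The bilinear form `g_h(V_h; ·, ·)`. -/
def gh (t : ℝ) (u φ : Ω → Amb n → ℝ) : ℝ :=
  ∫ ω, 𝒯.surfInt t (fun σ x => u ω x * φ ω x * 𝒯.divVh σ t x) ∂P

/-- The bilinear form `a_h` for the coefficient `α`. -/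
def ah (α : Ω → ℝ → Amb n → ℝ) (t : ℝ) (u φ : Ω → Amb n → ℝ) : ℝ :=
  ∫ ω, 𝒯.surfInt t (fun σ x => S.invLift α ω t x *
    inner ℝ (tangGrad (𝒯.E σ t) (u ω) x) (tangGrad (𝒯.E σ t) (φ ω) x)) ∂P

/-- `U` solves the semi-discrete problem: `U(0) = U₀` and
`d/dt m_h(U,φ) + a_h(U,φ) = m_h(U, ∂_h^• φ)` for all `φ ∈ W_h` and almost every `t`. -/
def IsSolution (α : Ω → ℝ → Amb n → ℝ) (U₀ : Ω → 𝒯.Sh 0) (U : Ω → 𝒯.C1) : Prop :=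
  (∀ᵐ ω ∂P, (U ω).1 0 = U₀ ω) ∧
  ∀ φ : Ω → 𝒯.C1, 𝒯.MemWh P φ → ∀ᵐ t ∂(volume.restrict (Icc 0 T)),
    HasDerivAt (fun s => 𝒯.mh P s (fun ω => path (U ω).1 s) (fun ω => path (φ ω).1 s))
      (𝒯.mh P t (fun ω => path (U ω).1 t) (fun ω => 𝒯.matDeriv (path (φ ω).1) t)
        - 𝒯.ah P α t (fun ω => path (U ω).1 t) (fun ω => path (φ ω).1 t)) t

/-- `U` solves the semi-discrete problem in the form `U(0) = U₀` and
`m_h(∂_h^• U,φ) + a_h(U,φ) + g_h(V_h;U,φ) = 0` for almost every `t` and all `φ ∈ L²(Ω,S_h(t))`. -/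
def IsSolution' (α : Ω → ℝ → Amb n → ℝ) (U₀ : Ω → 𝒯.Sh 0) (U : Ω → 𝒯.C1) : Prop :=
  (∀ᵐ ω ∂P, (U ω).1 0 = U₀ ω) ∧
  ∀ᵐ t ∂(volume.restrict (Icc 0 T)), ∀ φ : Ω → 𝒯.Sh t, 𝒯.MemVh P t φ →
    𝒯.mh P t (fun ω => 𝒯.matDeriv (path (U ω).1) t) (fun ω => ext (φ ω))
      + 𝒯.ah P α t (fun ω => path (U ω).1 t) (fun ω => ext (φ ω))
      + 𝒯.gh P t (fun ω => path (U ω).1 t) (fun ω => ext (φ ω)) = 0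

end Random

end EvolvingMesh

end ESFEM

end

/-! ### Barycentric coordinates, nodal interpolation and nodal values. -/

noncomputable section

open MeasureTheory Set

namespace ESFEM

/-! Everything is done in nodal coordinates. Conformity makes nodal interpolation well defined, and
the discrete motion keeps barycentric coordinates fixed. So a family u(t) ∈ S_h(t) is the same thing
as its vector c(t) ∈ ℝ^J of nodal values, and its material derivative has nodal values c'(t)
(`matDeriv_eq_interp`). Pulled back to a fixed reference simplex, the forms m_h, g_h and a_h become
operators M = `massF`, G = `divF` and A = `stiffF` on ℝ^J. Gradients are constant on elements, so α
enters A only through its element integrals `kap`. The volume factor of an element is the square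
root of the Gram determinant of its edges; its logarithmic derivative is the divergence of V_h,
hence M' = G (`hasDerivWithinAt_massF`). Both weak formulations then say that the residual M c' + G
c + A c is orthogonal, in expectation, to the test functions (`ae_hasDerivAt_mh`,
`ae_forms_eq_residual`).

Existence: M is positive definite, so the residual equation is a linear ODE for each ω. Its Picard
series shows that the solution depends measurably on ω (`exists_measurable_solution`). Uniqueness: a
continuous square integrable random path that is orthogonal in expectation to every random vector at
almost every time vanishes (`L2Path.eq_zero`). Hence any solution of either formulation has zero
residual almost surely, and Gronwall's inequality applies pathwise.

Measurability into C^1_{S_h} reduces to measurability of the nodal values at each time. One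
direction holds because the norm controls point evaluation in time (`continuous_coef`), the other
because the space is separable (`measurable_c1`).

Stability: testing the ODE with c gives the first estimate (`energy_estimate`), testing with c'
gives the second (`higher_energy_estimate`). The second needs A'; elementwise, the derivative of the
stiffness form with frozen nodal values is the integral of B_h ∇u · ∇u, which is what the bound on
B_h controls. All terms are compared in the mass and Dirichlet forms themselves, so no mesh constant
enters; the comparison with the Euclidean norm of ℝ^J serves only measurability and integrability.

Time regularity of the lifted coefficient requires the projection p to be C^1, although p is defined
implicitly by the normal at the foot point. The gradient of d is constant along the segment from x
to its nearest point, so p = x - d ∇d(x) explicitly (`proj_spec`). -/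

/-- A point of the convex hull of finitely many points is a convex combination of them. -/
theorem exists_stdSimplex_of_mem_convexHull_image {ι V : Type*} [Fintype ι] [AddCommGroup V]
    [Module ℝ V] (p : ι → V) (C : Set ι) {x : V} (hx : x ∈ convexHull ℝ (p '' C)) :
    ∃ l ∈ stdSimplex ℝ ι, (∀ j ∉ C, l j = 0) ∧ ∑ j, l j • p j = x := by
  classical
  let K : Set (ι → ℝ) := {l | l ∈ stdSimplex ℝ ι ∧ ∀ j ∉ C, l j = 0}
  have hK : Convex ℝ K := by
    refine (convex_stdSimplex ℝ ι).inter ?_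
    intro l hl m hm a b _ _ _ j hj
    simp [hl j hj, hm j hj]
  have hsub : convexHull ℝ (p '' C) ⊆ (Fintype.linearCombination ℝ p) '' K := by
    refine convexHull_min ?_ (hK.linear_image _)
    rintro _ ⟨j, hj, rfl⟩
    refine ⟨Pi.single j 1, ⟨single_mem_stdSimplex ℝ j, fun i hi => ?_⟩, ?_⟩
    · exact Pi.single_eq_of_ne (by rintro rfl; exact hi hj) _
    · simp
  obtain ⟨l, ⟨h1, h2⟩, h3⟩ := hsub hx
  exact ⟨l, h1, h2, by simpa [Fintype.linearCombination_apply] using h3⟩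

theorem mem_convexHull_range_iff {ι V : Type*} [Fintype ι] [AddCommGroup V]
    [Module ℝ V] (p : ι → V) {x : V} :
    x ∈ convexHull ℝ (range p) ↔ ∃ l ∈ stdSimplex ℝ ι, ∑ j, l j • p j = x := by
  constructor
  · intro hx
    rw [← image_univ] at hx
    obtain ⟨l, h1, -, h3⟩ := exists_stdSimplex_of_mem_convexHull_image p univ hx
    exact ⟨l, h1, h3⟩
  · rintro ⟨l, h1, rfl⟩
    exact (convex_convexHull ℝ _).sum_mem (fun i _ => h1.1 i) h1.2
      (fun i _ => subset_convexHull ℝ _ (mem_range_self i))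

/-- Weights of an affine combination of affinely independent points are unique. -/
theorem _root_.AffineIndependent.weights_unique {ι V : Type*} [Fintype ι] [AddCommGroup V]
    [Module ℝ V] {p : ι → V} (hp : AffineIndependent ℝ p) {l m : ι → ℝ} (hl : ∑ i, l i = 1)
    (hm : ∑ i, m i = 1) (h : ∑ i, l i • p i = ∑ i, m i • p i) : l = m := by
  funext i
  have := hp.eq_zero_of_sum_eq_zero (s := Finset.univ) (w := l - m) (by simp [hl, hm])
    (by simp [sub_smul, h]) i (Finset.mem_univ i)
  simpa [sub_eq_zero] using this

theorem sum_smul_eq_of_sum_eq_one {n : ℕ} {F : Type*} [AddCommGroup F] [Module ℝ F]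
    {l : Fin (n + 1) → ℝ} (hl : ∑ i, l i = 1) (c : Fin (n + 1) → F) :
    ∑ i, l i • c i = c 0 + ∑ i : Fin n, l i.succ • (c i.succ - c 0) := by
  have h0 : l 0 = 1 - ∑ i : Fin n, l i.succ := by
    rw [Fin.sum_univ_succ] at hl; linarith
  rw [Fin.sum_univ_succ, h0]
  simp only [smul_sub, Finset.sum_sub_distrib, sub_smul, one_smul, ← Finset.sum_smul]
  abel

namespace EvolvingMesh

variable {n : ℕ} {T : ℝ} {S : EvolvingSurface n T} (𝒯 : EvolvingMesh S)

/-- The point of the element `σ` with barycentric coordinates `l`. -/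
def baryPt (σ : Fin 𝒯.M) (t : ℝ) (l : Fin (n + 1) → ℝ) : Amb n :=
  ∑ i, l i • 𝒯.X (𝒯.elem σ i) t

theorem mem_E_iff {σ : Fin 𝒯.M} {t : ℝ} {x : Amb n} :
    x ∈ 𝒯.E σ t ↔ ∃ l ∈ stdSimplex ℝ (Fin (n + 1)), 𝒯.baryPt σ t l = x :=
  mem_convexHull_range_iff _

theorem baryPt_mem_E (σ : Fin 𝒯.M) (t : ℝ) {l : Fin (n + 1) → ℝ}
    (hl : l ∈ stdSimplex ℝ (Fin (n + 1))) : 𝒯.baryPt σ t l ∈ 𝒯.E σ t :=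
  𝒯.mem_E_iff.2 ⟨l, hl, rfl⟩

theorem E_subset_Γh (σ : Fin 𝒯.M) (t : ℝ) : 𝒯.E σ t ⊆ 𝒯.Γh t :=
  subset_iUnion (fun σ => 𝒯.E σ t) σ

theorem isCompact_E (σ : Fin 𝒯.M) (t : ℝ) : IsCompact (𝒯.E σ t) :=
  (finite_range _).isCompact_convexHull (𝕜 := ℝ)

theorem convex_E (σ : Fin 𝒯.M) (t : ℝ) : Convex ℝ (𝒯.E σ t) := convex_convexHull _ _

theorem elem_injective {t : ℝ} (ht : t ∈ Icc 0 T) (σ : Fin 𝒯.M) :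
    Function.Injective (𝒯.elem σ) := fun _ _ h =>
  (𝒯.nondegenerate t ht σ).injective (by simp only [h])

/-- Convex combinations of common vertices, seen from one element. -/
theorem sum_elem_eq_sum {t : ℝ} (ht : t ∈ Icc 0 T) (σ : Fin 𝒯.M) {ν : Fin 𝒯.J → ℝ}
    (hν : ∀ j ∉ range (𝒯.elem σ), ν j = 0) {F : Type*} [AddCommGroup F] [Module ℝ F]
    (c : Fin 𝒯.J → F) : ∑ i, ν (𝒯.elem σ i) • c (𝒯.elem σ i) = ∑ j, ν j • c j := by
  classical
  rw [← Finset.sum_image (s := Finset.univ) (g := 𝒯.elem σ) (f := fun j => ν j • c j)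
    (fun a _ b _ h => 𝒯.elem_injective ht σ h)]
  refine Finset.sum_subset (Finset.subset_univ _) fun j _ hj => ?_
  rw [hν j (by simpa using hj), zero_smul]

/-- `interp` picks an element and weights by choice; this shows that the choice is irrelevant. Two
representations of a point place it in two elements, hence by conformity in the hull of their common
vertices. Affine independence in each element forces both sets of weights to be those of the common
face. -/
theorem interp_baryPt {F : Type*} [AddCommGroup F] [Module ℝ F] {t : ℝ} (ht : t ∈ Icc 0 T)
    (c : Fin 𝒯.J → F) (σ : Fin 𝒯.M) {l : Fin (n + 1) → ℝ}
    (hl : l ∈ stdSimplex ℝ (Fin (n + 1))) :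
    𝒯.interp t c (𝒯.baryPt σ t l) = ∑ i, l i • c (𝒯.elem σ i) := by
  have h : ∃ q : Fin 𝒯.M × (Fin (n + 1) → ℝ), q.2 ∈ stdSimplex ℝ (Fin (n + 1)) ∧
      𝒯.baryPt σ t l = ∑ i, q.2 i • 𝒯.X (𝒯.elem q.1 i) t := ⟨(σ, l), hl, rfl⟩
  rw [interp, dif_pos h]
  set q := h.choose with hq
  obtain ⟨h1, h2⟩ : q.2 ∈ stdSimplex ℝ (Fin (n + 1)) ∧
      𝒯.baryPt σ t l = ∑ i, q.2 i • 𝒯.X (𝒯.elem q.1 i) t := h.choose_spec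
  have hmem : 𝒯.baryPt σ t l ∈ convexHull ℝ ((fun j => 𝒯.X j t) ''
      (range (𝒯.elem σ) ∩ range (𝒯.elem q.1))) := by
    rw [← 𝒯.conforming t ht σ q.1]
    exact ⟨𝒯.baryPt_mem_E σ t hl, h2 ▸ 𝒯.baryPt_mem_E q.1 t h1⟩
  obtain ⟨ν, hν, hν0, hνx⟩ := exists_stdSimplex_of_mem_convexHull_image _ _ hmem
  have key : ∀ (τ : Fin 𝒯.M) (m : Fin (n + 1) → ℝ), m ∈ stdSimplex ℝ (Fin (n + 1)) →
      (∀ j ∉ range (𝒯.elem τ), ν j = 0) →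
      𝒯.baryPt σ t l = ∑ i, m i • 𝒯.X (𝒯.elem τ i) t →
      ∑ i, m i • c (𝒯.elem τ i) = ∑ j, ν j • c j := by
    -- The weights `ν` live on the common vertices, so they are admissible in either element and
    -- must agree with the weights given there.
    intro τ m hm hτ hx
    have : m = fun i => ν (𝒯.elem τ i) := by
      refine (𝒯.nondegenerate t ht τ).weights_unique hm.2 ?_ ?_
      · have := 𝒯.sum_elem_eq_sum ht τ hτ (fun _ => (1 : ℝ))
        simp only [smul_eq_mul, mul_one] at this
        rw [this]; exact hν.2
      · rw [← hx, 𝒯.sum_elem_eq_sum ht τ hτ (fun j => 𝒯.X j t)]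
        exact hνx.symm
    rw [this]
    exact 𝒯.sum_elem_eq_sum ht τ hτ c
  rw [key q.1 q.2 h1 (fun j hj => hν0 j fun h => hj h.2) h2,
    key σ l hl (fun j hj => hν0 j fun h => hj h.1) rfl]

theorem interp_add {F : Type*} [AddCommGroup F] [Module ℝ F] (t : ℝ) (c d : Fin 𝒯.J → F)
    (x : Amb n) : 𝒯.interp t (c + d) x = 𝒯.interp t c x + 𝒯.interp t d x := by
  unfold interp
  split_ifs with h
  · simp [Finset.sum_add_distrib]
  · simp

theorem interp_smul {F : Type*} [AddCommGroup F] [Module ℝ F] (t : ℝ) (a : ℝ) (c : Fin 𝒯.J → F)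
    (x : Amb n) : 𝒯.interp t (a • c) x = a • 𝒯.interp t c x := by
  unfold interp
  split_ifs with h
  · simp only [Pi.smul_apply, Finset.smul_sum]
    exact Finset.sum_congr rfl fun i _ => smul_comm _ _ _
  · simp

theorem interp_sub {F : Type*} [AddCommGroup F] [Module ℝ F] (t : ℝ) (c d : Fin 𝒯.J → F)
    (x : Amb n) : 𝒯.interp t (c - d) x = 𝒯.interp t c x - 𝒯.interp t d x := by
  have := 𝒯.interp_add t (c - d) d x
  rw [sub_add_cancel] at this
  rw [this, add_sub_cancel_right]

theorem single_baryPt (σ : Fin 𝒯.M) (t : ℝ) (i : Fin (n + 1)) :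
    𝒯.baryPt σ t (Pi.single i 1) = 𝒯.X (𝒯.elem σ i) t := by
  simp [baryPt, Pi.single_apply]

theorem vertex_mem_Γh (j : Fin 𝒯.J) (t : ℝ) : 𝒯.X j t ∈ 𝒯.Γh t := by
  obtain ⟨σ, i, rfl⟩ := 𝒯.vertex_used j
  exact 𝒯.E_subset_Γh σ t (subset_convexHull ℝ _ (mem_range_self i))

theorem interp_vertex {F : Type*} [AddCommGroup F] [Module ℝ F] {t : ℝ} (ht : t ∈ Icc 0 T)
    (c : Fin 𝒯.J → F) (j : Fin 𝒯.J) : 𝒯.interp t c (𝒯.X j t) = c j := by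
  obtain ⟨σ, i, rfl⟩ := 𝒯.vertex_used j
  rw [← single_baryPt, 𝒯.interp_baryPt ht c σ (single_mem_stdSimplex ℝ i)]
  simp [Pi.single_apply]

/-- Barycentric coordinates are constant along the discrete flow, so time derivatives along
trajectories only see the vertices and the nodal values. -/
theorem flow_baryPt {t : ℝ} (ht : t ∈ Icc 0 T) (s : ℝ) (σ : Fin 𝒯.M) {l : Fin (n + 1) → ℝ}
    (hl : l ∈ stdSimplex ℝ (Fin (n + 1))) :
    𝒯.flow t s (𝒯.baryPt σ t l) = 𝒯.baryPt σ s l :=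
  𝒯.interp_baryPt ht _ σ hl

/-! ### Edges, Gram matrices and tangential derivatives -/

/-- The edge vectors of an element issuing from its first vertex. -/
def edge (σ : Fin 𝒯.M) (t : ℝ) (i : Fin n) : Amb n :=
  𝒯.X (𝒯.elem σ i.succ) t - 𝒯.X (𝒯.elem σ 0) t

/-- The Gram matrix of the edge vectors. -/
def gramE (σ : Fin 𝒯.M) (t : ℝ) : Matrix (Fin n) (Fin n) ℝ := Matrix.gram ℝ (𝒯.edge σ t)

theorem linearIndependent_edge {t : ℝ} (ht : t ∈ Icc 0 T) (σ : Fin 𝒯.M) :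
    LinearIndependent ℝ (𝒯.edge σ t) := by
  have h := (affineIndependent_iff_linearIndependent_vsub ℝ _ 0).1 (𝒯.nondegenerate t ht σ)
  exact h.comp (fun i : Fin n => (⟨i.succ, Fin.succ_ne_zero i⟩ : {x : Fin (n + 1) // x ≠ 0}))
    (fun i j hij => by simpa using hij)

theorem gramE_posDef {t : ℝ} (ht : t ∈ Icc 0 T) (σ : Fin 𝒯.M) : (𝒯.gramE σ t).PosDef :=
  Matrix.posDef_gram_of_linearIndependent (𝒯.linearIndependent_edge ht σ)

theorem gramE_det_pos {t : ℝ} (ht : t ∈ Icc 0 T) (σ : Fin 𝒯.M) : 0 < (𝒯.gramE σ t).det :=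
  (𝒯.gramE_posDef ht σ).det_pos

theorem gramE_mul_inv {t : ℝ} (ht : t ∈ Icc 0 T) (σ : Fin 𝒯.M) :
    𝒯.gramE σ t * (𝒯.gramE σ t)⁻¹ = 1 :=
  Matrix.mul_nonsing_inv _ (𝒯.gramE_det_pos ht σ).ne'.isUnit

theorem gramE_inv_mul {t : ℝ} (ht : t ∈ Icc 0 T) (σ : Fin 𝒯.M) :
    (𝒯.gramE σ t)⁻¹ * 𝒯.gramE σ t = 1 :=
  Matrix.nonsing_inv_mul _ (𝒯.gramE_det_pos ht σ).ne'.isUnit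

/-- The nodal values of `c` on the element `σ`, relative to the first vertex. -/
def diffs {F : Type*} [AddCommGroup F] (σ : Fin 𝒯.M) (c : Fin 𝒯.J → F) (i : Fin n) : F :=
  c (𝒯.elem σ i.succ) - c (𝒯.elem σ 0)

/-- The derivative of the piecewise linear function with nodal values `c` on the element `σ`,
extended by zero to the normal direction. -/
def elemDeriv {F : Type*} [NormedAddCommGroup F] [NormedSpace ℝ F] (σ : Fin 𝒯.M) (t : ℝ)
    (c : Fin 𝒯.J → F) : Amb n →L[ℝ] F :=
  ∑ i, ∑ j, (𝒯.gramE σ t)⁻¹ i j • (innerSL ℝ (𝒯.edge σ t j)).smulRight (𝒯.diffs σ c i)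

theorem elemDeriv_apply {F : Type*} [NormedAddCommGroup F] [NormedSpace ℝ F] (σ : Fin 𝒯.M) (t : ℝ)
    (c : Fin 𝒯.J → F) (w : Amb n) :
    𝒯.elemDeriv σ t c w =
      ∑ i, (∑ j, (𝒯.gramE σ t)⁻¹ i j * inner ℝ (𝒯.edge σ t j) w) • 𝒯.diffs σ c i := by
  simp [elemDeriv, Finset.sum_smul, smul_smul]

/-- The inverse Gram matrix turns the inner products with the edges into coordinates with respect to
the edges. -/
theorem elemDeriv_edge {F : Type*} [NormedAddCommGroup F] [NormedSpace ℝ F] {t : ℝ}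
    (ht : t ∈ Icc 0 T) (σ : Fin 𝒯.M) (c : Fin 𝒯.J → F) (k : Fin n) :
    𝒯.elemDeriv σ t c (𝒯.edge σ t k) = 𝒯.diffs σ c k := by
  have h : ∀ i, (∑ j, (𝒯.gramE σ t)⁻¹ i j * inner ℝ (𝒯.edge σ t j) (𝒯.edge σ t k))
      = if i = k then 1 else 0 := by
    intro i
    have := congrFun (congrFun (𝒯.gramE_inv_mul ht σ) i) k
    rw [Matrix.mul_apply, Matrix.one_apply] at this
    exact this
  rw [elemDeriv_apply]
  simp [h]

theorem baryPt_sub (σ : Fin 𝒯.M) (t : ℝ) {l : Fin (n + 1) → ℝ} (hl : ∑ i, l i = 1) :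
    𝒯.baryPt σ t l = 𝒯.X (𝒯.elem σ 0) t + ∑ i : Fin n, l i.succ • 𝒯.edge σ t i :=
  sum_smul_eq_of_sum_eq_one hl _

theorem interp_eq_affine {F : Type*} [NormedAddCommGroup F] [NormedSpace ℝ F] {t : ℝ}
    (ht : t ∈ Icc 0 T) (c : Fin 𝒯.J → F) (σ : Fin 𝒯.M) {x : Amb n} (hx : x ∈ 𝒯.E σ t) :
    𝒯.interp t c x = c (𝒯.elem σ 0) + 𝒯.elemDeriv σ t c (x - 𝒯.X (𝒯.elem σ 0) t) := by
  obtain ⟨l, hl, rfl⟩ := 𝒯.mem_E_iff.1 hx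
  rw [𝒯.interp_baryPt ht c σ hl, 𝒯.baryPt_sub σ t hl.2, add_sub_cancel_left, map_sum,
    sum_smul_eq_of_sum_eq_one hl.2]
  simp [𝒯.elemDeriv_edge ht, diffs]

theorem edge_mem_vectorSpan (σ : Fin 𝒯.M) (t : ℝ) (i : Fin n) :
    𝒯.edge σ t i ∈ vectorSpan ℝ (𝒯.E σ t) :=
  vsub_mem_vectorSpan ℝ (subset_convexHull ℝ _ (mem_range_self i.succ))
    (subset_convexHull ℝ _ (mem_range_self 0))

/-- The formula only tests a vector against edges, which lie in the direction of the element; normal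
components are already annihilated. -/
theorem elemDeriv_comp_starProjection {F : Type*} [NormedAddCommGroup F] [NormedSpace ℝ F]
    (σ : Fin 𝒯.M) (t : ℝ) (c : Fin 𝒯.J → F) :
    (𝒯.elemDeriv σ t c).comp (vectorSpan ℝ (𝒯.E σ t)).starProjection = 𝒯.elemDeriv σ t c := by
  ext w
  rw [ContinuousLinearMap.comp_apply, elemDeriv_apply, elemDeriv_apply]
  congr! 4 with i _ j _
  rw [← Submodule.inner_starProjection_left_eq_right,
    Submodule.starProjection_eq_self_iff.2 (𝒯.edge_mem_vectorSpan σ t j)]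

/-- Within a convex set, the tangential derivative is determined by any derivative. -/
theorem tangDeriv_eq {F : Type*} [NormedAddCommGroup F] [NormedSpace ℝ F]
    {K : Set (Amb n)} (hK : Convex ℝ K) {f : Amb n → F} {f' : Amb n →L[ℝ] F} {x : Amb n}
    (hx : x ∈ K) (hf : HasFDerivWithinAt f f' K x) :
    tangDeriv K f x = f'.comp (vectorSpan ℝ K).starProjection := by
  have h1 : HasFDerivWithinAt f (fderivWithin ℝ f K x) K x :=
    hf.differentiableWithinAt.hasFDerivWithinAt
  -- A flat set does not determine `fderivWithin` in normal directions. Convexity puts every y - x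
  -- with y ∈ K into the tangent cone at x, and these vectors span the direction of K, which is all
  -- that the projection retains.
  have h2 : ∀ v ∈ vectorSpan ℝ K, fderivWithin ℝ f K x v = f' v := by
    intro v hv
    rw [vectorSpan_eq_span_vsub_set_right ℝ hx] at hv
    refine LinearMap.eqOn_span (f := (fderivWithin ℝ f K x : Amb n →ₗ[ℝ] F))
      (g := (f' : Amb n →ₗ[ℝ] F)) ?_ hv
    rintro _ ⟨y, hy, rfl⟩
    exact h1.unique_on hf (mem_tangentConeAt_of_segment_subset (hK.segment_subset hx hy))
  ext w
  exact h2 _ (Submodule.starProjection_apply_mem _ w)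

theorem tangDeriv_interp {F : Type*} [NormedAddCommGroup F] [NormedSpace ℝ F] {t : ℝ}
    (ht : t ∈ Icc 0 T) (c : Fin 𝒯.J → F) (σ : Fin 𝒯.M) {f : Amb n → F}
    (hf : EqOn f (𝒯.interp t c) (𝒯.E σ t)) {x : Amb n} (hx : x ∈ 𝒯.E σ t) :
    tangDeriv (𝒯.E σ t) f x = 𝒯.elemDeriv σ t c := by
  have h : HasFDerivWithinAt f (𝒯.elemDeriv σ t c) (𝒯.E σ t) x := by
    have h0 : HasFDerivWithinAt (fun y => c (𝒯.elem σ 0) +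
        𝒯.elemDeriv σ t c (y - 𝒯.X (𝒯.elem σ 0) t)) (𝒯.elemDeriv σ t c) (𝒯.E σ t) x := by
      have := ((𝒯.elemDeriv σ t c).hasFDerivAt.comp x
        ((hasFDerivAt_id x).sub_const (𝒯.X (𝒯.elem σ 0) t))).const_add (c (𝒯.elem σ 0))
      simpa using this.hasFDerivWithinAt (s := 𝒯.E σ t)
    refine h0.congr (fun y hy => ?_) ?_
    · rw [hf hy, 𝒯.interp_eq_affine ht c σ hy]
    · rw [hf hx, 𝒯.interp_eq_affine ht c σ hx]
  rw [tangDeriv_eq (𝒯.convex_E σ t) hx h, elemDeriv_comp_starProjection]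

/-! ### Nodal values -/

variable {𝒯}

/-- The nodal values of a finite element function. -/
def nodal {t : ℝ} (η : 𝒯.Sh t) (j : Fin 𝒯.J) : ℝ := ext η (𝒯.X j t)

theorem ext_of_mem {t : ℝ} (η : 𝒯.Sh t) {x : Amb n} (hx : x ∈ 𝒯.Γh t) :
    ext η x = (η : C(𝒯.Γh t, ℝ)) ⟨x, hx⟩ := dif_pos hx

theorem nodal_apply {t : ℝ} (η : 𝒯.Sh t) (j : Fin 𝒯.J) :
    nodal η j = (η : C(𝒯.Γh t, ℝ)) ⟨𝒯.X j t, 𝒯.vertex_mem_Γh j t⟩ := ext_of_mem η _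

theorem ext_baryPt {t : ℝ} (η : 𝒯.Sh t) (σ : Fin 𝒯.M) {l : Fin (n + 1) → ℝ}
    (hl : l ∈ stdSimplex ℝ (Fin (n + 1))) :
    ext η (𝒯.baryPt σ t l) = ∑ i, l i • nodal η (𝒯.elem σ i) := by
  obtain ⟨A, hA⟩ := η.2 σ
  have hE := 𝒯.baryPt_mem_E σ t hl
  have h1 : ∀ x (hx : x ∈ 𝒯.E σ t), ext η x = A x := fun x hx => by
    rw [ext_of_mem η (𝒯.E_subset_Γh σ t hx)]
    exact hA ⟨x, 𝒯.E_subset_Γh σ t hx⟩ hx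
  have h2 : ∀ i, nodal η (𝒯.elem σ i) = A (𝒯.X (𝒯.elem σ i) t) := fun i =>
    h1 _ (subset_convexHull ℝ _ (mem_range_self i))
  rw [h1 _ hE, sum_smul_eq_of_sum_eq_one hl.2, 𝒯.baryPt_sub σ t hl.2]
  have h3 : ∀ x v : Amb n, A (x + v) = A x + A.linear v := fun x v => by
    have := A.map_vadd x v
    rwa [vadd_eq_add, vadd_eq_add, add_comm v x, add_comm (A.linear v)] at this
  rw [h3, map_sum, h2 0]
  congr! 1
  refine Finset.sum_congr rfl fun i _ => ?_
  rw [map_smul, h2, edge, ← vsub_eq_sub, A.linearMap_vsub, vsub_eq_sub]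

theorem ext_eq_interp {t : ℝ} (ht : t ∈ Icc 0 T) (η : 𝒯.Sh t) {x : Amb n} (hx : x ∈ 𝒯.Γh t) :
    ext η x = 𝒯.interp t (nodal η) x := by
  obtain ⟨σ, hσ⟩ := mem_iUnion.1 hx
  obtain ⟨l, hl, rfl⟩ := 𝒯.mem_E_iff.1 hσ
  rw [ext_baryPt η σ hl, 𝒯.interp_baryPt ht _ σ hl]

theorem ext_of_nodal_eq {t : ℝ} (ht : t ∈ Icc 0 T) {η ζ : 𝒯.Sh t} (h : nodal η = nodal ζ) :
    η = ζ := by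
  apply Subtype.ext
  ext ⟨x, hx⟩
  rw [← ext_of_mem η hx, ← ext_of_mem ζ hx, ext_eq_interp ht η hx, ext_eq_interp ht ζ hx, h]

variable (𝒯)

/-- The space of vectors of nodal values. -/
abbrev Cf : Type := EuclideanSpace ℝ (Fin 𝒯.J)

/-- Taking nodal values, as a continuous linear map. -/
def nodalL (t : ℝ) : 𝒯.Sh t →L[ℝ] 𝒯.Cf :=
  ((EuclideanSpace.equiv (Fin 𝒯.J) ℝ).symm : (Fin 𝒯.J → ℝ) →L[ℝ] 𝒯.Cf).comp
  (ContinuousLinearMap.pi fun j =>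
    (ContinuousMap.evalCLM ℝ (⟨𝒯.X j t, 𝒯.vertex_mem_Γh j t⟩ : 𝒯.Γh t)).comp (𝒯.Sh t).subtypeL)

theorem nodalL_apply {t : ℝ} (η : 𝒯.Sh t) : 𝒯.nodalL t η = WithLp.toLp 2 (nodal η) := by
  ext j
  exact (nodal_apply η j).symm

/-- The elements form a finite closed cover, and the interpolation is affine on each of them. -/
theorem continuousOn_interp {t : ℝ} (ht : t ∈ Icc 0 T) (c : Fin 𝒯.J → ℝ) :
    ContinuousOn (𝒯.interp t c) (𝒯.Γh t) := by
  refine (locallyFinite_of_finite _).continuousOn_iUnion (fun σ => (𝒯.isCompact_E σ t).isClosed)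
    fun σ => ?_
  have : ContinuousOn (fun x => c (𝒯.elem σ 0) + 𝒯.elemDeriv σ t c (x - 𝒯.X (𝒯.elem σ 0) t))
      (𝒯.E σ t) := by fun_prop
  exact this.congr fun x hx => 𝒯.interp_eq_affine ht c σ hx

/-- The finite element function with given nodal values. -/
def mkSh {t : ℝ} (ht : t ∈ Icc 0 T) : (Fin 𝒯.J → ℝ) →ₗ[ℝ] 𝒯.Sh t where
  toFun c := ⟨⟨fun x => 𝒯.interp t c x, (𝒯.continuousOn_interp ht c).domRestrict⟩, fun σ =>
    ⟨(𝒯.elemDeriv σ t c : Amb n →ₗ[ℝ] ℝ).toAffineMap +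
      AffineMap.const ℝ (Amb n) (c (𝒯.elem σ 0) - 𝒯.elemDeriv σ t c (𝒯.X (𝒯.elem σ 0) t)),
      fun x hx => by
        change 𝒯.interp t c x = _
        rw [𝒯.interp_eq_affine ht c σ hx]
        simp
        ring⟩⟩
  map_add' c d := by
    apply Subtype.ext
    ext x
    exact 𝒯.interp_add t c d x
  map_smul' a c := by
    apply Subtype.ext
    ext x
    exact 𝒯.interp_smul t a c x

/-- `mkSh` as a continuous linear map. -/
def mkShL {t : ℝ} (ht : t ∈ Icc 0 T) : 𝒯.Cf →L[ℝ] 𝒯.Sh t :=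
  ⟨(𝒯.mkSh ht).comp (EuclideanSpace.equiv (Fin 𝒯.J) ℝ).toLinearMap,
    LinearMap.continuous_of_finiteDimensional _⟩

theorem contDiff_mkShL {t : ℝ} (ht : t ∈ Icc 0 T) : ContDiff ℝ 1 fun c => 𝒯.mkShL ht c := by
  fun_prop

theorem ext_mkSh {t : ℝ} (ht : t ∈ Icc 0 T) (c : Fin 𝒯.J → ℝ) {x : Amb n} (hx : x ∈ 𝒯.Γh t) :
    ext (𝒯.mkSh ht c) x = 𝒯.interp t c x := ext_of_mem _ hx

theorem nodal_mkSh {t : ℝ} (ht : t ∈ Icc 0 T) (c : Fin 𝒯.J → ℝ) : nodal (𝒯.mkSh ht c) = c := by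
  funext j
  rw [nodal, 𝒯.ext_mkSh ht c (𝒯.vertex_mem_Γh j t), 𝒯.interp_vertex ht]

theorem mkSh_nodal {t : ℝ} (ht : t ∈ Icc 0 T) (η : 𝒯.Sh t) : 𝒯.mkSh ht (nodal η) = η :=
  ext_of_nodal_eq ht (𝒯.nodal_mkSh ht _)

variable {𝒯}

/-- The path of nodal values of an element of `C^1_{S_h}`. -/
def C1.coef (u : 𝒯.C1) (t : ℝ) : 𝒯.Cf := WithLp.toLp 2 (nodal (u.1 t))

theorem C1.path_eq (u : 𝒯.C1) {t : ℝ} (ht : t ∈ Icc 0 T) {x : Amb n} (hx : x ∈ 𝒯.Γh t) :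
    path u.1 t x = 𝒯.interp t (u.coef t) x := ext_eq_interp ht _ hx

theorem flow_vertex (hT : 0 < T) (j : Fin 𝒯.J) (t : ℝ) : 𝒯.flow 0 t (𝒯.X j 0) = 𝒯.X j t :=
  𝒯.interp_vertex ⟨le_rfl, hT.le⟩ _ j

/-- The flow carries X_j(0) to X_j(t), so the nodal values of u(t) are those of its pull-back, on
which the linear map `nodalL` preserves smoothness. -/
theorem C1.contDiffOn_coef (hT : 0 < T) (u : 𝒯.C1) : ContDiffOn ℝ 1 u.coef (Icc 0 T) := by
  obtain ⟨c, hc, hcu⟩ := u.2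
  refine ((𝒯.nodalL 0).contDiff.comp_contDiffOn hc).congr fun t ht => ?_
  ext j
  have := hcu t ht ⟨𝒯.X j 0, 𝒯.vertex_mem_Γh j 0⟩
  rw [flow_vertex hT] at this
  rw [Function.comp_apply, nodalL_apply]
  exact this.symm.trans (nodal_apply (c t) j).symm

variable (𝒯)

open Classical in
/-- The element of `C^1_{S_h}` with a given path of nodal values. -/
def mkC1 (hT : 0 < T) (c : ℝ → 𝒯.Cf) (hc : ContDiffOn ℝ 1 c (Icc 0 T)) : 𝒯.C1 :=
  ⟨fun t => if ht : t ∈ Icc 0 T then 𝒯.mkSh ht (c t) else 0,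
    fun t => 𝒯.mkSh ⟨le_rfl, hT.le⟩ (c t), by
      refine ⟨(𝒯.contDiff_mkShL ⟨le_rfl, hT.le⟩).comp_contDiffOn hc, ?_⟩
      intro t ht ⟨x, hx⟩
      dsimp only
      rw [dif_pos ht]
      obtain ⟨σ, hσ⟩ := mem_iUnion.1 hx
      obtain ⟨l, hl, rfl⟩ := 𝒯.mem_E_iff.1 hσ
      rw [𝒯.flow_baryPt ⟨le_rfl, hT.le⟩ t σ hl,
        𝒯.ext_mkSh ht _ (𝒯.E_subset_Γh σ t (𝒯.baryPt_mem_E σ t hl)), 𝒯.interp_baryPt ht _ σ hl]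
      exact 𝒯.interp_baryPt ⟨le_rfl, hT.le⟩ _ σ hl⟩

theorem mkC1_apply (hT : 0 < T) (c : ℝ → 𝒯.Cf) (hc : ContDiffOn ℝ 1 c (Icc 0 T)) {t : ℝ}
    (ht : t ∈ Icc 0 T) : (𝒯.mkC1 hT c hc).1 t = 𝒯.mkSh ht (c t) := dif_pos ht

theorem coef_mkC1 (hT : 0 < T) (c : ℝ → 𝒯.Cf) (hc : ContDiffOn ℝ 1 c (Icc 0 T)) {t : ℝ}
    (ht : t ∈ Icc 0 T) : (𝒯.mkC1 hT c hc).coef t = c t := by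
  rw [C1.coef, 𝒯.mkC1_apply hT c hc ht, nodal_mkSh, WithLp.toLp_ofLp]

theorem C1.eq_of_coef_eq {u w : 𝒯.C1} {t : ℝ} (ht : t ∈ Icc 0 T) (h : u.coef t = w.coef t) :
    u.1 t = w.1 t := ext_of_nodal_eq ht (WithLp.toLp_injective 2 h)

/-- Along a trajectory the weights do not change, so the material derivative differentiates the
nodal values only. -/
theorem matDeriv_eq_interp (hT : 0 < T) {f : ℝ → Amb n → ℝ} {c : ℝ → 𝒯.Cf}
    (hf : ∀ s ∈ Icc 0 T, EqOn (f s) (𝒯.interp s (c s)) (𝒯.Γh s)) {t : ℝ} (ht : t ∈ Icc 0 T)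
    {c' : 𝒯.Cf} (hc : HasDerivWithinAt c c' (Icc 0 T) t) {x : Amb n} (hx : x ∈ 𝒯.Γh t) :
    𝒯.matDeriv f t x = 𝒯.interp t c' x := by
  obtain ⟨σ, hσ⟩ := mem_iUnion.1 hx
  obtain ⟨l, hl, rfl⟩ := 𝒯.mem_E_iff.1 hσ
  have h1 : ∀ s ∈ Icc 0 T, f s (𝒯.flow t s (𝒯.baryPt σ t l)) =
      ∑ i, l i • c s (𝒯.elem σ i) := fun s hs => by
    rw [𝒯.flow_baryPt ht s σ hl, hf s hs (𝒯.E_subset_Γh σ s (𝒯.baryPt_mem_E σ s hl)),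
      𝒯.interp_baryPt hs _ σ hl]
  have h2 : HasDerivWithinAt (fun s => ∑ i, l i • c s (𝒯.elem σ i))
      (∑ i, l i • c' (𝒯.elem σ i)) (Icc 0 T) t :=
    HasDerivWithinAt.fun_sum fun i _ => HasDerivWithinAt.const_smul (l i)
      ((EuclideanSpace.proj (𝒯.elem σ i) : 𝒯.Cf →L[ℝ] ℝ).hasFDerivAt.comp_hasDerivWithinAt t hc)
  rw [𝒯.interp_baryPt ht c' σ hl, matDeriv]
  exact (h2.congr h1 (h1 t ht)).derivWithin (uniqueDiffOn_Icc hT t ht)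

end EvolvingMesh
end ESFEM
end

/-! ### The reference simplex and the change of variables for surface integrals. -/

noncomputable section

open MeasureTheory Set

namespace ESFEM

/-- The reference simplex in `ℝⁿ`. -/
def refSimplex (n : ℕ) : Set (EuclideanSpace ℝ (Fin n)) := {y | (∀ i, 0 ≤ y i) ∧ ∑ i, y i ≤ 1}

/-- Barycentric coordinates on the reference simplex. -/
def bary {n : ℕ} (y : EuclideanSpace ℝ (Fin n)) : Fin (n + 1) → ℝ :=
  Fin.cons (1 - ∑ i, y i) fun i => y i

theorem bary_zero {n : ℕ} (y : EuclideanSpace ℝ (Fin n)) : bary y 0 = 1 - ∑ i, y i := rfl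

theorem bary_succ {n : ℕ} (y : EuclideanSpace ℝ (Fin n)) (i : Fin n) : bary y i.succ = y i := rfl

theorem sum_bary {n : ℕ} (y : EuclideanSpace ℝ (Fin n)) : ∑ i, bary y i = 1 := by
  rw [Fin.sum_univ_succ]
  simp [bary_zero, bary_succ]

theorem bary_mem {n : ℕ} {y : EuclideanSpace ℝ (Fin n)} (hy : y ∈ refSimplex n) :
    bary y ∈ stdSimplex ℝ (Fin (n + 1)) := by
  refine ⟨fun i => ?_, sum_bary y⟩
  refine Fin.cases ?_ (fun i => ?_) i
  · rw [bary_zero]; linarith [hy.2]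
  · exact hy.1 i

theorem exists_bary_eq {n : ℕ} {l : Fin (n + 1) → ℝ} (hl : l ∈ stdSimplex ℝ (Fin (n + 1))) :
    ∃ y ∈ refSimplex n, bary y = l := by
  have h0 : ∑ i : Fin n, l i.succ = 1 - l 0 := by
    have := hl.2
    rw [Fin.sum_univ_succ] at this
    linarith
  refine ⟨WithLp.toLp 2 fun i => l i.succ, ⟨fun i => hl.1 i.succ, ?_⟩, ?_⟩
  · change ∑ i : Fin n, l i.succ ≤ 1
    rw [h0]
    linarith [hl.1 0]
  · funext i
    refine Fin.cases ?_ (fun i => rfl) i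
    change 1 - ∑ i : Fin n, l i.succ = l 0
    rw [h0]; ring

theorem continuous_bary {n : ℕ} (i : Fin (n + 1)) :
    Continuous fun y : EuclideanSpace ℝ (Fin n) => bary y i := by
  refine Fin.cases ?_ (fun i => ?_) i
  · simp only [bary_zero]; fun_prop
  · simp only [bary_succ]; fun_prop

theorem isClosed_refSimplex (n : ℕ) : IsClosed (refSimplex n) := by
  have h1 : IsClosed {y : EuclideanSpace ℝ (Fin n) | ∀ i, 0 ≤ y i} := by
    simp only [ofPred_forall]
    exact isClosed_iInter fun i => isClosed_le continuous_const (by fun_prop)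
  have h2 : IsClosed {y : EuclideanSpace ℝ (Fin n) | ∑ i, y i ≤ 1} :=
    isClosed_le (by fun_prop) continuous_const
  exact h1.inter h2

theorem isCompact_refSimplex (n : ℕ) : IsCompact (refSimplex n) := by
  refine Metric.isCompact_of_isClosed_isBounded (isClosed_refSimplex n) ?_
  refine (Metric.isBounded_closedBall (x := 0) (r := 1)).subset fun y hy => ?_
  rw [mem_closedBall_zero_iff, EuclideanSpace.norm_eq, Real.sqrt_le_one]
  -- Coordinates lie in [0,1], so the Euclidean norm is dominated by the coordinate sum, which is at
  -- most 1.
  have h : ∀ i, ‖y i‖ ^ 2 ≤ y i := fun i => by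
    have h1 : y i ≤ 1 :=
      (Finset.single_le_sum (f := fun i => y i) (fun j _ => hy.1 j) (Finset.mem_univ i)).trans hy.2
    rw [Real.norm_eq_abs, sq_abs]
    nlinarith [hy.1 i]
  exact (Finset.sum_le_sum fun i _ => h i).trans hy.2

theorem convex_refSimplex (n : ℕ) : Convex ℝ (refSimplex n) := by
  intro x hx y hy a b ha hb hab
  refine ⟨fun i => ?_, ?_⟩
  · have h1 := hx.1 i
    have h2 := hy.1 i
    simp only [PiLp.add_apply, PiLp.smul_apply, smul_eq_mul]
    positivity
  · simp only [PiLp.add_apply, PiLp.smul_apply, smul_eq_mul, Finset.sum_add_distrib,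
      ← Finset.mul_sum]
    nlinarith [hx.2, hy.2]

theorem interior_refSimplex_nonempty (n : ℕ) : (interior (refSimplex n)).Nonempty := by
  have hopen : IsOpen {y : EuclideanSpace ℝ (Fin n) | (∀ i, 0 < y i) ∧ ∑ i, y i < 1} := by
    have h1 : IsOpen {y : EuclideanSpace ℝ (Fin n) | ∀ i, 0 < y i} := by
      simp only [ofPred_forall]
      exact isOpen_iInter_of_finite fun i => isOpen_lt continuous_const (by fun_prop)
    have h2 : IsOpen {y : EuclideanSpace ℝ (Fin n) | ∑ i, y i < 1} :=
      isOpen_lt (by fun_prop) continuous_const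
    exact h1.inter h2
  have hsub : {y : EuclideanSpace ℝ (Fin n) | (∀ i, 0 < y i) ∧ ∑ i, y i < 1} ⊆ refSimplex n :=
    fun y hy => ⟨fun i => (hy.1 i).le, hy.2.le⟩
  refine ⟨WithLp.toLp 2 fun _ => 1 / (n + 1 : ℝ), interior_maximal hsub hopen ⟨fun i => ?_, ?_⟩⟩
  · change (0 : ℝ) < 1 / (n + 1 : ℝ)
    positivity
  · change ∑ _ : Fin n, 1 / (n + 1 : ℝ) < 1
    rw [Finset.sum_const, Finset.card_univ, Fintype.card_fin, nsmul_eq_mul, mul_one_div,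
      div_lt_one (by positivity)]
    linarith

/-- This transfers almost everywhere identities for continuous functions to the whole simplex,
including its vertices. -/
theorem refSimplex_subset_closure_interior (n : ℕ) :
    refSimplex n ⊆ closure (interior (refSimplex n)) := by
  rw [(convex_refSimplex n).closure_interior_eq_closure_of_nonempty_interior
    (interior_refSimplex_nonempty n)]
  exact subset_closure

/-- The volume of the reference simplex. -/
def refVol (n : ℕ) : ℝ := (volume (refSimplex n)).toReal

theorem refVol_nonneg (n : ℕ) : 0 ≤ refVol n := ENNReal.toReal_nonneg

theorem measurableSet_refSimplex (n : ℕ) : MeasurableSet (refSimplex n) :=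
  (isClosed_refSimplex n).measurableSet

instance (n : ℕ) : IsFiniteMeasure (volume.restrict (refSimplex n)) :=
  ⟨by simpa using (isCompact_refSimplex n).measure_lt_top⟩

namespace EvolvingMesh

variable {n : ℕ} {T : ℝ} {S : EvolvingSurface n T} (𝒯 : EvolvingMesh S)

/-- The parametrization of an element by the reference simplex. -/
def param (σ : Fin 𝒯.M) (t : ℝ) (y : EuclideanSpace ℝ (Fin n)) : Amb n := 𝒯.baryPt σ t (bary y)

/-- The linear part of the parametrization of an element. -/
def edgeMap (σ : Fin 𝒯.M) (t : ℝ) : EuclideanSpace ℝ (Fin n) →ₗ[ℝ] Amb n where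
  toFun y := ∑ i, y i • 𝒯.edge σ t i
  map_add' x y := by simp [add_smul, Finset.sum_add_distrib]
  map_smul' a x := by simp [mul_smul, Finset.smul_sum]

theorem param_eq (σ : Fin 𝒯.M) (t : ℝ) (y : EuclideanSpace ℝ (Fin n)) :
    𝒯.param σ t y = 𝒯.X (𝒯.elem σ 0) t + 𝒯.edgeMap σ t y :=
  𝒯.baryPt_sub σ t (sum_bary y)

theorem image_param (σ : Fin 𝒯.M) (t : ℝ) : 𝒯.param σ t '' refSimplex n = 𝒯.E σ t := by
  ext x
  rw [𝒯.mem_E_iff]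
  constructor
  · rintro ⟨y, hy, rfl⟩
    exact ⟨bary y, bary_mem hy, rfl⟩
  · rintro ⟨l, hl, rfl⟩
    obtain ⟨y, hy, rfl⟩ := exists_bary_eq hl
    exact ⟨y, hy, rfl⟩

theorem param_mem_E (σ : Fin 𝒯.M) (t : ℝ) {y : EuclideanSpace ℝ (Fin n)} (hy : y ∈ refSimplex n) :
    𝒯.param σ t y ∈ 𝒯.E σ t := 𝒯.image_param σ t ▸ mem_image_of_mem _ hy

/-- The volume factor of the parametrization of an element. -/
def wt (σ : Fin 𝒯.M) (t : ℝ) : ℝ := √(𝒯.gramE σ t).det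

theorem wt_nonneg (σ : Fin 𝒯.M) (t : ℝ) : 0 ≤ 𝒯.wt σ t := Real.sqrt_nonneg _

theorem wt_pos {t : ℝ} (ht : t ∈ Icc 0 T) (σ : Fin 𝒯.M) : 0 < 𝒯.wt σ t :=
  Real.sqrt_pos.2 (𝒯.gramE_det_pos ht σ)

theorem edgeMap_basis (σ : Fin 𝒯.M) (t : ℝ) (i : Fin n) :
    𝒯.edgeMap σ t (EuclideanSpace.basisFun (Fin n) ℝ i) = 𝒯.edge σ t i := by
  simp [edgeMap]

theorem normDet_edgeMap (σ : Fin 𝒯.M) (t : ℝ) : (𝒯.edgeMap σ t).normDet = 𝒯.wt σ t := by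
  have h := (𝒯.edgeMap σ t).normDet_sq_eq_det_gram (EuclideanSpace.basisFun (Fin n) ℝ)
  simp only [edgeMap_basis] at h
  rw [wt, gramE, ← h]
  exact (Real.sqrt_sq (LinearMap.normDet_nonneg _)).symm

theorem edgeMap_injective {t : ℝ} (ht : t ∈ Icc 0 T) (σ : Fin 𝒯.M) :
    Function.Injective (𝒯.edgeMap σ t) := by
  rw [← LinearMap.ker_eq_bot, LinearMap.ker_eq_bot']
  intro y hy
  have := Fintype.linearIndependent_iff.1 (𝒯.linearIndependent_edge ht σ) y.ofLp hy
  ext i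
  exact this i

theorem continuous_param (σ : Fin 𝒯.M) (t : ℝ) : Continuous (𝒯.param σ t) := by
  have : 𝒯.param σ t = fun y => 𝒯.X (𝒯.elem σ 0) t + 𝒯.edgeMap σ t y :=
    funext fun y => 𝒯.param_eq σ t y
  rw [this]
  exact continuous_const.add (LinearMap.continuous_of_finiteDimensional _)

theorem measurableEmbedding_param {t : ℝ} (ht : t ∈ Icc 0 T) (σ : Fin 𝒯.M) :
    MeasurableEmbedding (𝒯.param σ t) := by
  refine (𝒯.continuous_param σ t).measurableEmbedding fun y z h => 𝒯.edgeMap_injective ht σ ?_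
  simpa [param_eq] using h

/-- The parametrization is a linear map followed by a translation: the linear part scales the
measure by its norm determinant, the translation is an isometry. -/
theorem hausdorff_image_param (σ : Fin 𝒯.M) (t : ℝ) (s : Set (EuclideanSpace ℝ (Fin n))) :
    μHE[n] (𝒯.param σ t '' s) = ENNReal.ofReal (𝒯.wt σ t) * volume s := by
  have h := (𝒯.edgeMap σ t).euclideanHausdorffMeasure_image_eq_normDet_mul_volume s
  rw [finrank_euclideanSpace_fin, normDet_edgeMap] at h
  rw [← h]
  have h1 : 𝒯.param σ t '' s = (fun x => 𝒯.X (𝒯.elem σ 0) t + x) '' (𝒯.edgeMap σ t '' s) := by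
    rw [image_image]
    exact image_congr fun y _ => 𝒯.param_eq σ t y
  rw [h1]
  exact (isometry_add_left _).euclideanHausdorffMeasure_image _

/-- Change of variables to the reference simplex. -/
theorem setIntegral_E {t : ℝ} (ht : t ∈ Icc 0 T) (σ : Fin 𝒯.M) (f : Amb n → ℝ) :
    ∫ x in 𝒯.E σ t, f x ∂μHE[n] = 𝒯.wt σ t * ∫ y in refSimplex n, f (𝒯.param σ t y) := by
  have he := 𝒯.measurableEmbedding_param ht σ
  -- The surface measure is the push-forward of scaled Lebesgue measure under a measurable
  -- embedding, so the formula holds for every f, without measurability or integrability.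
  have hm : (μHE[n] : Measure (Amb n)).restrict (𝒯.E σ t) =
      (ENNReal.ofReal (𝒯.wt σ t) • volume.restrict (refSimplex n)).map (𝒯.param σ t) := by
    ext s hs
    rw [he.map_apply, Measure.restrict_apply hs, Measure.smul_apply,
      Measure.restrict_apply (he.measurable hs), smul_eq_mul, ← 𝒯.hausdorff_image_param,
      image_preimage_inter, image_param]
  rw [hm, he.integral_map, integral_smul_measure, ENNReal.toReal_ofReal (𝒯.wt_pos ht σ).le,
    smul_eq_mul]

end EvolvingMesh
end ESFEM
end

/-! ### The bilinear forms as operators on nodal vectors. -/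

noncomputable section

open MeasureTheory Set

namespace ESFEM
namespace EvolvingMesh

variable {n : ℕ} {T : ℝ} {S : EvolvingSurface n T} (𝒯 : EvolvingMesh S)

/-- The Riesz vector of the nodal value at the vertex `i` of the element `σ`. -/
def unitVec (σ : Fin 𝒯.M) (i : Fin (n + 1)) : 𝒯.Cf := EuclideanSpace.single (𝒯.elem σ i) 1

theorem inner_unitVec (σ : Fin 𝒯.M) (i : Fin (n + 1)) (c : 𝒯.Cf) :
    inner ℝ (𝒯.unitVec σ i) c = c (𝒯.elem σ i) := by
  simp [unitVec, EuclideanSpace.inner_single_left]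

/-- Evaluation, at a point of the element `σ`, of the interpolation of nodal values. -/
def evalAt (σ : Fin 𝒯.M) (y : EuclideanSpace ℝ (Fin n)) (c : 𝒯.Cf) : ℝ :=
  ∑ i, bary y i • c (𝒯.elem σ i)

/-- The Riesz vector of `evalAt`. -/
def evalVec (σ : Fin 𝒯.M) (y : EuclideanSpace ℝ (Fin n)) : 𝒯.Cf :=
  ∑ i, bary y i • 𝒯.unitVec σ i

theorem inner_evalVec (σ : Fin 𝒯.M) (y : EuclideanSpace ℝ (Fin n)) (c : 𝒯.Cf) :
    inner ℝ (𝒯.evalVec σ y) c = 𝒯.evalAt σ y c := by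
  simp [evalVec, evalAt, sum_inner, inner_smul_left, inner_unitVec]

theorem interp_param {t : ℝ} (ht : t ∈ Icc 0 T) (σ : Fin 𝒯.M) {y : EuclideanSpace ℝ (Fin n)}
    (hy : y ∈ refSimplex n) (c : 𝒯.Cf) :
    𝒯.interp t c (𝒯.param σ t y) = 𝒯.evalAt σ y c :=
  𝒯.interp_baryPt ht c σ (bary_mem hy)

theorem continuous_evalVec (σ : Fin 𝒯.M) : Continuous (𝒯.evalVec σ) :=
  continuous_finsetSum _ fun i _ => (continuous_bary i).smul continuous_const

theorem continuous_evalAt (σ : Fin 𝒯.M) (c : 𝒯.Cf) : Continuous fun y => 𝒯.evalAt σ y c := by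
  simp only [← inner_evalVec]
  exact (𝒯.continuous_evalVec σ).inner continuous_const

/-- The operator of the mass form of the reference element. -/
def massE (σ : Fin 𝒯.M) : 𝒯.Cf →L[ℝ] 𝒯.Cf :=
  ∫ y in refSimplex n, (innerSL ℝ (𝒯.evalVec σ y)).smulRight (𝒯.evalVec σ y)

/-- The operator is an integral of rank one operators given by the evaluation vectors. It does not
involve t: all time dependence of the mass form sits in the scalar `wt`. -/
theorem massE_apply (σ : Fin 𝒯.M) (c d : 𝒯.Cf) :
    inner ℝ (𝒯.massE σ c) d = ∫ y in refSimplex n, 𝒯.evalAt σ y c * 𝒯.evalAt σ y d := by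
  have hv := 𝒯.continuous_evalVec σ
  have hc : Continuous fun y => (innerSL ℝ (𝒯.evalVec σ y)).smulRight (𝒯.evalVec σ y) := by
    have : Continuous fun y => ContinuousLinearMap.smulRightL ℝ 𝒯.Cf 𝒯.Cf
      (innerSL ℝ (𝒯.evalVec σ y)) (𝒯.evalVec σ y) := by fun_prop
    exact this
  have h : IntegrableOn (fun y => (innerSL ℝ (𝒯.evalVec σ y)).smulRight (𝒯.evalVec σ y))
      (refSimplex n) := hc.continuousOn.integrableOn_compact (isCompact_refSimplex n)
  rw [massE, ContinuousLinearMap.integral_apply h, real_inner_comm,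
    ← integral_inner (h.apply_continuousLinearMap c)]
  refine integral_congr_ae (Filter.Eventually.of_forall fun y => ?_)
  simp only [ContinuousLinearMap.smulRight_apply, innerSL_apply_apply, inner_smul_right,
    inner_evalVec]
  rw [real_inner_comm, inner_evalVec]

theorem integrableOn_evalAt_mul (σ : Fin 𝒯.M) (c d : 𝒯.Cf) :
    IntegrableOn (fun y => 𝒯.evalAt σ y c * 𝒯.evalAt σ y d) (refSimplex n) :=
  ((𝒯.continuous_evalAt σ c).mul (𝒯.continuous_evalAt σ d)).continuousOn.integrableOn_compact
    (isCompact_refSimplex n)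

theorem massE_symm (σ : Fin 𝒯.M) (c d : 𝒯.Cf) :
    inner ℝ (𝒯.massE σ c) d = inner ℝ (𝒯.massE σ d) c := by
  simp only [massE_apply, mul_comm]

theorem massE_nonneg (σ : Fin 𝒯.M) (c : 𝒯.Cf) : 0 ≤ inner ℝ (𝒯.massE σ c) c := by
  rw [massE_apply]
  exact integral_nonneg fun y => mul_self_nonneg _

/-- A continuous function whose square has integral zero vanishes almost everywhere, hence on the
interior and by continuity on its closure. -/
theorem evalAt_eq_zero_of_massE (σ : Fin 𝒯.M) (c : 𝒯.Cf) (h : inner ℝ (𝒯.massE σ c) c = 0)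
    {y : EuclideanSpace ℝ (Fin n)} (hy : y ∈ refSimplex n) : 𝒯.evalAt σ y c = 0 := by
  have hc := 𝒯.continuous_evalAt σ c
  rw [massE_apply, integral_eq_zero_iff_of_nonneg (fun y => mul_self_nonneg _)
    (𝒯.integrableOn_evalAt_mul σ c c)] at h
  have h2 : (fun y => 𝒯.evalAt σ y c) =ᵐ[volume.restrict (interior (refSimplex n))] 0 := by
    filter_upwards [ae_restrict_of_ae_restrict_of_subset interior_subset h] with y hy
    simpa using hy
  have h3 : EqOn (fun y => 𝒯.evalAt σ y c) 0 (interior (refSimplex n)) :=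
    Measure.eqOn_open_of_ae_eq h2 isOpen_interior hc.continuousOn continuousOn_const
  exact h3.closure hc continuous_const (refSimplex_subset_closure_interior n hy)

theorem coef_eq_zero_of_massE (σ : Fin 𝒯.M) (c : 𝒯.Cf) (h : inner ℝ (𝒯.massE σ c) c = 0)
    (i : Fin (n + 1)) : c (𝒯.elem σ i) = 0 := by
  obtain ⟨y, hy, hyi⟩ := exists_bary_eq (single_mem_stdSimplex ℝ i)
  have := 𝒯.evalAt_eq_zero_of_massE σ c h hy
  rw [evalAt, hyi] at this
  simpa [Pi.single_apply] using this

/-- The Riesz vector of a nodal difference on the element `σ`. -/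
def diffVec (σ : Fin 𝒯.M) (i : Fin n) : 𝒯.Cf := 𝒯.unitVec σ i.succ - 𝒯.unitVec σ 0

theorem inner_diffVec (σ : Fin 𝒯.M) (i : Fin n) (c : 𝒯.Cf) :
    inner ℝ (𝒯.diffVec σ i) c = 𝒯.diffs σ c i := by
  simp [diffVec, inner_sub_left, inner_unitVec, diffs]

/-- The tangential gradient on the element `σ` of the function with nodal values `c`. -/
def gradE (σ : Fin 𝒯.M) (t : ℝ) (c : 𝒯.Cf) : Amb n :=
  ∑ j, (∑ i, (𝒯.gramE σ t)⁻¹ i j * 𝒯.diffs σ c i) • 𝒯.edge σ t j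

theorem inner_gradE (σ : Fin 𝒯.M) (t : ℝ) (c : 𝒯.Cf) (w : Amb n) :
    inner ℝ (𝒯.gradE σ t c) w = 𝒯.elemDeriv σ t c w := by
  rw [elemDeriv_apply, gradE, sum_inner]
  simp only [inner_smul_left, RCLike.conj_to_real, smul_eq_mul, Finset.sum_mul]
  rw [Finset.sum_comm]
  exact Finset.sum_congr rfl fun i _ => Finset.sum_congr rfl fun j _ => by ring

theorem toDual_symm_elemDeriv (σ : Fin 𝒯.M) (t : ℝ) (c : 𝒯.Cf) :
    (InnerProductSpace.toDual ℝ (Amb n)).symm (𝒯.elemDeriv σ t c) = 𝒯.gradE σ t c := by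
  rw [LinearIsometryEquiv.symm_apply_eq]
  ext w
  rw [InnerProductSpace.toDual_apply_apply, inner_gradE]

/-- The stiffness form of the element `σ`, relative to its volume. -/
def stiffE (σ : Fin 𝒯.M) (t : ℝ) : 𝒯.Cf →L[ℝ] 𝒯.Cf :=
  ∑ i, ∑ j, (𝒯.gramE σ t)⁻¹ i j • (innerSL ℝ (𝒯.diffVec σ j)).smulRight (𝒯.diffVec σ i)

theorem stiffE_apply (σ : Fin 𝒯.M) (t : ℝ) (c d : 𝒯.Cf) :
    inner ℝ (𝒯.stiffE σ t c) d =
      ∑ i, ∑ j, (𝒯.gramE σ t)⁻¹ i j * (𝒯.diffs σ c j * 𝒯.diffs σ d i) := by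
  simp [stiffE, sum_inner, inner_smul_left, inner_diffVec]

/-- Pairing one gradient with the edges expanding the other cancels one inverse Gram matrix. The
form with the inverse Gram matrix is preferred because only that matrix depends on time. -/
theorem stiffE_eq_inner {t : ℝ} (ht : t ∈ Icc 0 T) (σ : Fin 𝒯.M) (c d : 𝒯.Cf) :
    inner ℝ (𝒯.stiffE σ t c) d = inner ℝ (𝒯.gradE σ t c) (𝒯.gradE σ t d) := by
  rw [inner_gradE, gradE, map_sum, stiffE_apply, Finset.sum_comm]
  refine Finset.sum_congr rfl fun j _ => ?_
  rw [map_smul, 𝒯.elemDeriv_edge ht, smul_eq_mul, Finset.sum_mul]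
  exact Finset.sum_congr rfl fun i _ => by ring

theorem stiffE_self {t : ℝ} (ht : t ∈ Icc 0 T) (σ : Fin 𝒯.M) (c : 𝒯.Cf) :
    inner ℝ (𝒯.stiffE σ t c) c = ‖𝒯.gradE σ t c‖ ^ 2 := by
  rw [𝒯.stiffE_eq_inner ht, real_inner_self_eq_norm_sq]

theorem tangGrad_interp {t : ℝ} (ht : t ∈ Icc 0 T) (c : 𝒯.Cf) (σ : Fin 𝒯.M)
    {f : Amb n → ℝ} (hf : EqOn f (𝒯.interp t c) (𝒯.Γh t)) {x : Amb n} (hx : x ∈ 𝒯.E σ t) :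
    tangGrad (𝒯.E σ t) f x = 𝒯.gradE σ t c := by
  rw [tangGrad, 𝒯.tangDeriv_interp ht c σ (hf.mono (𝒯.E_subset_Γh σ t)) hx, toDual_symm_elemDeriv]

/-- The divergence of `V_h` on the element `σ`. -/
def divE (σ : Fin 𝒯.M) (t : ℝ) : ℝ :=
  LinearMap.trace ℝ (Amb n) (𝒯.elemDeriv σ t fun j => S.v t (𝒯.X j t)).toLinearMap

theorem tangDeriv_Vh {t : ℝ} (ht : t ∈ Icc 0 T) (σ : Fin 𝒯.M) {x : Amb n} (hx : x ∈ 𝒯.E σ t) :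
    tangDeriv (𝒯.E σ t) (𝒯.Vh t) x = 𝒯.elemDeriv σ t fun j => S.v t (𝒯.X j t) :=
  𝒯.tangDeriv_interp ht _ σ (fun _ _ => rfl) hx

theorem divVh_eq {t : ℝ} (ht : t ∈ Icc 0 T) (σ : Fin 𝒯.M) {x : Amb n} (hx : x ∈ 𝒯.E σ t) :
    𝒯.divVh σ t x = 𝒯.divE σ t := by
  rw [divVh, 𝒯.tangDeriv_Vh ht σ hx, divE]

/-! ### The global bilinear forms -/

/-- The mass form. -/
def massF (t : ℝ) : 𝒯.Cf →L[ℝ] 𝒯.Cf := ∑ σ, 𝒯.wt σ t • 𝒯.massE σ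

/-- The mass form weighted with the divergence of `V_h`. -/
def divF (t : ℝ) : 𝒯.Cf →L[ℝ] 𝒯.Cf :=
  ∑ σ, (𝒯.wt σ t * 𝒯.divE σ t) • 𝒯.massE σ

/-- The stiffness form with elementwise weights. -/
def stiffF (κ : Fin 𝒯.M → ℝ) (t : ℝ) : 𝒯.Cf →L[ℝ] 𝒯.Cf :=
  ∑ σ, (𝒯.wt σ t * κ σ) • 𝒯.stiffE σ t

theorem massF_apply (t : ℝ) (c d : 𝒯.Cf) :
    inner ℝ (𝒯.massF t c) d = ∑ σ, 𝒯.wt σ t * inner ℝ (𝒯.massE σ c) d := by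
  simp [massF, sum_inner, inner_smul_left]

theorem divF_apply (t : ℝ) (c d : 𝒯.Cf) :
    inner ℝ (𝒯.divF t c) d = ∑ σ, 𝒯.wt σ t * 𝒯.divE σ t * inner ℝ (𝒯.massE σ c) d := by
  simp [divF, sum_inner, inner_smul_left]

theorem stiffF_apply (κ : Fin 𝒯.M → ℝ) (t : ℝ) (c d : 𝒯.Cf) :
    inner ℝ (𝒯.stiffF κ t c) d = ∑ σ, 𝒯.wt σ t * κ σ * inner ℝ (𝒯.stiffE σ t c) d := by
  simp [stiffF, sum_inner, inner_smul_left]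

theorem massF_symm (t : ℝ) (c d : 𝒯.Cf) : inner ℝ (𝒯.massF t c) d = inner ℝ (𝒯.massF t d) c := by
  simp only [massF_apply, 𝒯.massE_symm _ c d]

theorem massF_nonneg (t : ℝ) (c : 𝒯.Cf) : 0 ≤ inner ℝ (𝒯.massF t c) c := by
  rw [massF_apply]
  exact Finset.sum_nonneg fun σ _ => mul_nonneg (𝒯.wt_nonneg _ _) (𝒯.massE_nonneg σ c)

/-- A vector of zero mass vanishes at the vertices of every element, and every vertex belongs to
some element. -/
theorem massF_pos {t : ℝ} (ht : t ∈ Icc 0 T) {c : 𝒯.Cf} (hc : c ≠ 0) :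
    0 < inner ℝ (𝒯.massF t c) c := by
  refine (𝒯.massF_nonneg t c).lt_of_ne fun h => hc ?_
  rw [massF_apply, eq_comm, Finset.sum_eq_zero_iff_of_nonneg fun σ _ =>
    mul_nonneg (𝒯.wt_nonneg _ _) (𝒯.massE_nonneg σ c)] at h
  ext j
  obtain ⟨σ, i, rfl⟩ := 𝒯.vertex_used j
  have := h σ (Finset.mem_univ σ)
  exact 𝒯.coef_eq_zero_of_massE σ c ((mul_eq_zero.1 this).resolve_left (𝒯.wt_pos ht σ).ne') i

theorem stiffF_symm {t : ℝ} (ht : t ∈ Icc 0 T) (κ : Fin 𝒯.M → ℝ) (c d : 𝒯.Cf) :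
    inner ℝ (𝒯.stiffF κ t c) d = inner ℝ (𝒯.stiffF κ t d) c := by
  rw [stiffF_apply, stiffF_apply]
  refine Finset.sum_congr rfl fun σ _ => ?_
  rw [𝒯.stiffE_eq_inner ht, 𝒯.stiffE_eq_inner ht, real_inner_comm]

theorem stiffF_mono {t : ℝ} (ht : t ∈ Icc 0 T) {κ κ' : Fin 𝒯.M → ℝ} (h : ∀ σ, κ σ ≤ κ' σ)
    (c : 𝒯.Cf) : inner ℝ (𝒯.stiffF κ t c) c ≤ inner ℝ (𝒯.stiffF κ' t c) c := by
  simp only [stiffF_apply, 𝒯.stiffE_self ht]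
  gcongr with σ
  · exact (𝒯.wt_pos ht σ).le
  · exact h σ

theorem stiffF_nonneg {t : ℝ} (ht : t ∈ Icc 0 T) {κ : Fin 𝒯.M → ℝ} (h : ∀ σ, 0 ≤ κ σ)
    (c : 𝒯.Cf) : 0 ≤ inner ℝ (𝒯.stiffF κ t c) c := by
  simp only [stiffF_apply, 𝒯.stiffE_self ht]
  exact Finset.sum_nonneg fun σ _ =>
    mul_nonneg (mul_nonneg (𝒯.wt_pos ht σ).le (h σ)) (sq_nonneg _)

theorem stiffF_smul (a : ℝ) (κ : Fin 𝒯.M → ℝ) (t : ℝ) (c d : 𝒯.Cf) :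
    inner ℝ (𝒯.stiffF (fun σ => a * κ σ) t c) d = a * inner ℝ (𝒯.stiffF κ t c) d := by
  simp only [stiffF_apply, Finset.mul_sum]
  exact Finset.sum_congr rfl fun σ _ => by ring

theorem abs_divF_le {t : ℝ} {D : ℝ} (hD : ∀ σ, |𝒯.divE σ t| ≤ D)
    (c : 𝒯.Cf) : |inner ℝ (𝒯.divF t c) c| ≤ D * inner ℝ (𝒯.massF t c) c := by
  rw [divF_apply, massF_apply, Finset.mul_sum]
  refine (Finset.abs_sum_le_sum_abs _ _).trans (Finset.sum_le_sum fun σ _ => ?_)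
  rw [abs_mul, abs_mul, abs_of_nonneg (𝒯.massE_nonneg σ c),
    abs_of_nonneg (𝒯.wt_nonneg σ t)]
  have h1 : 0 ≤ 𝒯.wt σ t * inner ℝ (𝒯.massE σ c) c :=
    mul_nonneg (𝒯.wt_nonneg _ _) (𝒯.massE_nonneg σ c)
  nlinarith [hD σ]

/-- Young's inequality on each element, where the divergence is a constant that can be moved onto
one argument. -/
theorem two_mul_abs_divF_le {t : ℝ} {D : ℝ} (hD : ∀ σ, |𝒯.divE σ t| ≤ D)
    (c d : 𝒯.Cf) : 2 * |inner ℝ (𝒯.divF t c) d| ≤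
      D ^ 2 * inner ℝ (𝒯.massF t c) c + inner ℝ (𝒯.massF t d) d := by
  have key : ∀ σ, 2 * |𝒯.wt σ t * 𝒯.divE σ t * inner ℝ (𝒯.massE σ c) d| ≤
      D ^ 2 * (𝒯.wt σ t * inner ℝ (𝒯.massE σ c) c) + 𝒯.wt σ t * inner ℝ (𝒯.massE σ d) d := by
    intro σ
    have hw := 𝒯.wt_nonneg σ t
    have hc := 𝒯.massE_nonneg σ c
    -- Nonnegativity of the mass form at a c + d; taking a = ± the divergence bounds the mixed term
    -- with either sign.
    have hq : ∀ a : ℝ, 0 ≤ a ^ 2 * inner ℝ (𝒯.massE σ c) c + 2 * a * inner ℝ (𝒯.massE σ c) d +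
        inner ℝ (𝒯.massE σ d) d := by
      intro a
      have := 𝒯.massE_nonneg σ (a • c + d)
      simp only [map_add, map_smul, inner_add_left, inner_add_right, inner_smul_left,
        inner_smul_right, RCLike.conj_to_real, 𝒯.massE_symm σ d c] at this
      linarith
    have h1 := hq (𝒯.divE σ t)
    have h2 := hq (-𝒯.divE σ t)
    have h3 : 𝒯.divE σ t ^ 2 ≤ D ^ 2 := sq_le_sq' (by linarith [abs_le.1 (hD σ)])
      (abs_le.1 (hD σ)).2
    have h4 : 2 * |𝒯.divE σ t * inner ℝ (𝒯.massE σ c) d| ≤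
        D ^ 2 * inner ℝ (𝒯.massE σ c) c + inner ℝ (𝒯.massE σ d) d := by
      have h5 := mul_le_mul_of_nonneg_right h3 hc
      rcases abs_cases (𝒯.divE σ t * inner ℝ (𝒯.massE σ c) d) with ⟨h, _⟩ | ⟨h, _⟩ <;>
        rw [h] <;> nlinarith
    rw [mul_assoc, abs_mul, abs_of_nonneg hw]
    nlinarith [mul_le_mul_of_nonneg_left h4 hw]
  rw [divF_apply, massF_apply, massF_apply, Finset.mul_sum, ← Finset.sum_add_distrib]
  calc _ ≤ 2 * ∑ σ, |𝒯.wt σ t * 𝒯.divE σ t * inner ℝ (𝒯.massE σ c) d| := by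
        gcongr; exact Finset.abs_sum_le_sum_abs _ _
    _ ≤ _ := by rw [Finset.mul_sum]; exact Finset.sum_le_sum fun σ _ => key σ

/-! ### Surface integrals in terms of nodal values -/

theorem surfInt_congr {t : ℝ} {f g : Fin 𝒯.M → Amb n → ℝ}
    (h : ∀ σ, EqOn (f σ) (g σ) (𝒯.E σ t)) : 𝒯.surfInt t f = 𝒯.surfInt t g :=
  Finset.sum_congr rfl fun σ _ =>
    setIntegral_congr_fun (𝒯.isCompact_E σ t).measurableSet (h σ)

variable {𝒯} {t : ℝ} {f g : Amb n → ℝ} {c d : 𝒯.Cf}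

theorem setIntegral_mul_eq (ht : t ∈ Icc 0 T) (hf : EqOn f (𝒯.interp t c) (𝒯.Γh t))
    (hg : EqOn g (𝒯.interp t d) (𝒯.Γh t)) (σ : Fin 𝒯.M) :
    ∫ x in 𝒯.E σ t, f x * g x ∂μHE[n] = 𝒯.wt σ t * inner ℝ (𝒯.massE σ c) d := by
  rw [𝒯.setIntegral_E ht σ, massE_apply]
  congr 1
  refine setIntegral_congr_fun (measurableSet_refSimplex n) fun y hy => ?_
  have hE := 𝒯.E_subset_Γh σ t (𝒯.param_mem_E σ t hy)
  simp only [hf hE, hg hE, 𝒯.interp_param ht σ hy]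

theorem surfInt_mul_eq (ht : t ∈ Icc 0 T) (hf : EqOn f (𝒯.interp t c) (𝒯.Γh t))
    (hg : EqOn g (𝒯.interp t d) (𝒯.Γh t)) :
    𝒯.surfInt t (fun _ x => f x * g x) = inner ℝ (𝒯.massF t c) d := by
  rw [massF_apply]
  exact Finset.sum_congr rfl fun σ _ => setIntegral_mul_eq ht hf hg σ

theorem l2sq_eq (ht : t ∈ Icc 0 T) (hf : EqOn f (𝒯.interp t c) (𝒯.Γh t)) :
    𝒯.l2sq t f = inner ℝ (𝒯.massF t c) c := by
  simp only [l2sq, pow_two]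
  exact surfInt_mul_eq ht hf hf

theorem surfInt_mul_div_eq (ht : t ∈ Icc 0 T) (hf : EqOn f (𝒯.interp t c) (𝒯.Γh t))
    (hg : EqOn g (𝒯.interp t d) (𝒯.Γh t)) :
    𝒯.surfInt t (fun σ x => f x * g x * 𝒯.divVh σ t x) = inner ℝ (𝒯.divF t c) d := by
  rw [𝒯.surfInt_congr (g := fun σ x => f x * g x * 𝒯.divE σ t)
    (fun σ x hx => by simp only [𝒯.divVh_eq ht σ hx]), divF_apply]
  refine Finset.sum_congr rfl fun σ _ => ?_
  rw [integral_mul_const, setIntegral_mul_eq ht hf hg σ]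
  ring

/-- Both gradients are constant on each element, so the coefficient enters only through its integral
over the reference simplex, whatever its regularity. -/
theorem surfInt_stiff_eq (ht : t ∈ Icc 0 T) (hf : EqOn f (𝒯.interp t c) (𝒯.Γh t))
    (hg : EqOn g (𝒯.interp t d) (𝒯.Γh t)) (a : Amb n → ℝ) :
    𝒯.surfInt t (fun σ x => a x * inner ℝ (tangGrad (𝒯.E σ t) f x) (tangGrad (𝒯.E σ t) g x)) =
      inner ℝ (𝒯.stiffF (fun σ => ∫ y in refSimplex n, a (𝒯.param σ t y)) t c) d := by
  rw [𝒯.surfInt_congr (g := fun σ x => a x * inner ℝ (𝒯.stiffE σ t c) d)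
    (fun σ x hx => by
      simp only [𝒯.tangGrad_interp ht c σ hf hx, 𝒯.tangGrad_interp ht d σ hg hx,
        𝒯.stiffE_eq_inner ht]), stiffF_apply]
  refine Finset.sum_congr rfl fun σ _ => ?_
  rw [integral_mul_const, 𝒯.setIntegral_E ht σ]

theorem h1sq_eq (ht : t ∈ Icc 0 T) (hf : EqOn f (𝒯.interp t c) (𝒯.Γh t)) :
    𝒯.h1sq t f = inner ℝ (𝒯.massF t c) c + inner ℝ (𝒯.stiffF (fun _ => refVol n) t c) c := by
  have h := surfInt_stiff_eq ht hf hf (fun _ => 1)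
  simp only [one_mul, real_inner_self_eq_norm_sq] at h
  rw [h1sq, l2sq_eq ht hf, h]
  congr! 4
  simp [refVol, Measure.real]

end EvolvingMesh
end ESFEM
end

/-! ### Time derivatives of volume factors, Gram matrices and forms. -/

noncomputable section

open MeasureTheory Set

namespace ESFEM

/-! ### Derivatives of determinants and inverses of small matrices -/

section SmallMatrix

variable {n : ℕ} {g : ℝ → Matrix (Fin n) (Fin n) ℝ} {g' : Matrix (Fin n) (Fin n) ℝ} {s : Set ℝ}
  {t : ℝ}

/-- Jacobi's formula, written out for the two dimensions that occur. -/
theorem hasDerivWithinAt_det (hn : n = 1 ∨ n = 2)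
    (hg : ∀ i j, HasDerivWithinAt (fun s => g s i j) (g' i j) s t) :
    HasDerivWithinAt (fun s => (g s).det) (((g t).adjugate * g').trace) s t := by
  rcases hn with rfl | rfl
  · simp only [Matrix.det_fin_one, Matrix.adjugate_fin_one, one_mul, Matrix.trace_fin_one]
    exact hg 0 0
  · simp only [Matrix.det_fin_two]
    refine (((hg 0 0).fun_mul (hg 1 1)).fun_sub ((hg 0 1).fun_mul (hg 1 0))).congr_deriv ?_
    rw [Matrix.trace_fin_two, Matrix.mul_apply, Matrix.mul_apply]
    simp only [Matrix.adjugate_fin_two, Fin.sum_univ_two, Matrix.of_apply, Matrix.cons_val_zero,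
      Matrix.cons_val_one]
    ring

/-- Cramer's rule: the inverse is the adjugate divided by a nonvanishing determinant. -/
theorem differentiableWithinAt_matrix_inv (hn : n = 1 ∨ n = 2)
    (hg : ∀ i j, DifferentiableWithinAt ℝ (fun s => g s i j) s t) (hdet : (g t).det ≠ 0)
    (i j : Fin n) : DifferentiableWithinAt ℝ (fun s => (g s)⁻¹ i j) s t := by
  have hd : DifferentiableWithinAt ℝ (fun s => (g s).det) s t :=
    (hasDerivWithinAt_det (g' := fun i j => derivWithin (fun s => g s i j) s t) hn
      fun i j => (hg i j).hasDerivWithinAt).differentiableWithinAt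
  have ha : DifferentiableWithinAt ℝ (fun s => (g s).adjugate i j) s t := by
    rcases hn with rfl | rfl
    · simp only [Matrix.adjugate_fin_one]
      exact differentiableWithinAt_const _
    · simp only [Matrix.adjugate_fin_two]
      fin_cases i <;> fin_cases j <;> simp <;> exact hg _ _
  simp only [Matrix.inv_def, Matrix.smul_apply, Ring.inverse_eq_inv', smul_eq_mul]
  exact (hd.inv hdet).mul ha

end SmallMatrix

namespace EvolvingMesh

variable {n : ℕ} {T : ℝ} {S : EvolvingSurface n T} (𝒯 : EvolvingMesh S)

/-- The nodal values of the discrete velocity. -/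
def velo (t : ℝ) (j : Fin 𝒯.J) : Amb n := S.v t (𝒯.X j t)

theorem continuousOn_X (j : Fin 𝒯.J) : ContinuousOn (𝒯.X j) (Icc 0 T) := fun t ht =>
  (𝒯.vertex_ode j t ht).continuousWithinAt

theorem continuousOn_velo (j : Fin 𝒯.J) : ContinuousOn (fun t => 𝒯.velo t j) (Icc 0 T) :=
  S.v_smooth.continuousOn.comp (continuousOn_id.prodMk (𝒯.continuousOn_X j))
    fun _ ht => ⟨ht, mem_univ _⟩

theorem hasDerivWithinAt_edge {t : ℝ} (ht : t ∈ Icc 0 T) (σ : Fin 𝒯.M) (i : Fin n) :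
    HasDerivWithinAt (fun s => 𝒯.edge σ s i) (𝒯.diffs σ (𝒯.velo t) i) (Icc 0 T) t :=
  (𝒯.vertex_ode _ t ht).fun_sub (𝒯.vertex_ode _ t ht)

/-- The time derivative of the Gram matrix. -/
def gramE' (σ : Fin 𝒯.M) (t : ℝ) : Matrix (Fin n) (Fin n) ℝ := fun i j =>
  inner ℝ (𝒯.edge σ t i) (𝒯.diffs σ (𝒯.velo t) j) + inner ℝ (𝒯.diffs σ (𝒯.velo t) i) (𝒯.edge σ t j)

theorem hasDerivWithinAt_gramE {t : ℝ} (ht : t ∈ Icc 0 T) (σ : Fin 𝒯.M) (i j : Fin n) :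
    HasDerivWithinAt (fun s => 𝒯.gramE σ s i j) (𝒯.gramE' σ t i j) (Icc 0 T) t :=
  (𝒯.hasDerivWithinAt_edge ht σ i).inner ℝ (𝒯.hasDerivWithinAt_edge ht σ j)

theorem gramE_inv_symm (σ : Fin 𝒯.M) (t : ℝ) (i j : Fin n) :
    (𝒯.gramE σ t)⁻¹ i j = (𝒯.gramE σ t)⁻¹ j i := by
  have h : (𝒯.gramE σ t).IsHermitian := Matrix.isHermitian_gram _ _
  have := congrFun (congrFun h.inv j) i
  simpa [Matrix.conjTranspose_apply] using this

theorem divE_eq (σ : Fin 𝒯.M) (t : ℝ) : 𝒯.divE σ t =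
    ∑ i, ∑ j, (𝒯.gramE σ t)⁻¹ i j * inner ℝ (𝒯.edge σ t j) (𝒯.diffs σ (𝒯.velo t) i) := by
  have : (𝒯.elemDeriv σ t fun j => S.v t (𝒯.X j t)).toLinearMap =
      ∑ i, ∑ j, (𝒯.gramE σ t)⁻¹ i j •
        (innerSL ℝ (𝒯.edge σ t j)).toLinearMap.smulRight (𝒯.diffs σ (𝒯.velo t) i) := by
    ext w : 1
    simp [elemDeriv, velo, diffs]
  rw [divE, this]
  simp only [map_sum, map_smul, LinearMap.trace_smulRight, smul_eq_mul]
  rfl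

/-- The derivative of the Gram matrix is a matrix plus its transpose; as the inverse Gram matrix is
symmetric, each half contributes one divergence. -/
theorem trace_inv_mul_gramE' (σ : Fin 𝒯.M) (t : ℝ) :
    ((𝒯.gramE σ t)⁻¹ * 𝒯.gramE' σ t).trace = 2 * 𝒯.divE σ t := by
  have h2 : 𝒯.divE σ t = ∑ i, ∑ j, (𝒯.gramE σ t)⁻¹ i j *
      inner ℝ (𝒯.diffs σ (𝒯.velo t) j) (𝒯.edge σ t i) := by
    rw [divE_eq, Finset.sum_comm]
    refine Finset.sum_congr rfl fun i _ => Finset.sum_congr rfl fun j _ => ?_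
    rw [gramE_inv_symm, real_inner_comm]
  rw [two_mul]
  nth_rewrite 1 [divE_eq]
  rw [h2, Matrix.trace, ← Finset.sum_add_distrib]
  refine Finset.sum_congr rfl fun i _ => ?_
  rw [Matrix.diag_apply, Matrix.mul_apply, ← Finset.sum_add_distrib]
  exact Finset.sum_congr rfl fun j _ => by rw [gramE']; ring

/-- Transport of area: the derivative of √det g is √det g · tr(g⁻¹ g') / 2, and the trace is twice
the divergence of V_h. -/
theorem hasDerivWithinAt_wt (hn : n = 1 ∨ n = 2) {t : ℝ} (ht : t ∈ Icc 0 T) (σ : Fin 𝒯.M) :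
    HasDerivWithinAt (𝒯.wt σ) (𝒯.wt σ t * 𝒯.divE σ t) (Icc 0 T) t := by
  have hpos := 𝒯.gramE_det_pos ht σ
  have h := (hasDerivWithinAt_det hn fun i j => 𝒯.hasDerivWithinAt_gramE ht σ i j).sqrt hpos.ne'
  refine h.congr_deriv ?_
  have hadj : (𝒯.gramE σ t).adjugate = (𝒯.gramE σ t).det • (𝒯.gramE σ t)⁻¹ := by
    rw [Matrix.inv_def, Ring.inverse_eq_inv', smul_smul, mul_inv_cancel₀ hpos.ne', one_smul]
  rw [hadj, Matrix.smul_mul, Matrix.trace_smul, trace_inv_mul_gramE', wt, smul_eq_mul]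
  have hs := Real.sqrt_pos.2 hpos
  field_simp
  rw [Real.sq_sqrt hpos.le, mul_comm]

theorem differentiableWithinAt_gramE_inv (hn : n = 1 ∨ n = 2) {t : ℝ} (ht : t ∈ Icc 0 T)
    (σ : Fin 𝒯.M) (i j : Fin n) :
    DifferentiableWithinAt ℝ (fun s => (𝒯.gramE σ s)⁻¹ i j) (Icc 0 T) t :=
  differentiableWithinAt_matrix_inv hn
    (fun i j => (𝒯.hasDerivWithinAt_gramE ht σ i j).differentiableWithinAt)
    (𝒯.gramE_det_pos ht σ).ne' i j

/-- The time derivative of the inverse Gram matrix. -/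
def gramInv' (σ : Fin 𝒯.M) (t : ℝ) : Matrix (Fin n) (Fin n) ℝ :=
  -((𝒯.gramE σ t)⁻¹ * 𝒯.gramE' σ t * (𝒯.gramE σ t)⁻¹)

theorem hasDerivWithinAt_gramE_inv (hT : 0 < T) (hn : n = 1 ∨ n = 2) {t : ℝ} (ht : t ∈ Icc 0 T)
    (σ : Fin 𝒯.M) (i j : Fin n) :
    HasDerivWithinAt (fun s => (𝒯.gramE σ s)⁻¹ i j) (𝒯.gramInv' σ t i j) (Icc 0 T) t := by
  set R : Matrix (Fin n) (Fin n) ℝ :=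
    fun i j => derivWithin (fun s => (𝒯.gramE σ s)⁻¹ i j) (Icc 0 T) t with hR
  have hRd : ∀ i j, HasDerivWithinAt (fun s => (𝒯.gramE σ s)⁻¹ i j) (R i j) (Icc 0 T) t :=
    fun i j => (𝒯.differentiableWithinAt_gramE_inv hn ht σ i j).hasDerivWithinAt
  -- Differentiate the identity g⁻¹ g = 1, which holds on all of [0,T]; differentiability of the
  -- inverse is already known, so this equation determines the derivative.
  have h0 : R * 𝒯.gramE σ t + (𝒯.gramE σ t)⁻¹ * 𝒯.gramE' σ t = 0 := by
    ext i j
    have h1 : HasDerivWithinAt (fun s => ∑ k, (𝒯.gramE σ s)⁻¹ i k * 𝒯.gramE σ s k j)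
        (∑ k, (R i k * 𝒯.gramE σ t k j + (𝒯.gramE σ t)⁻¹ i k * 𝒯.gramE' σ t k j)) (Icc 0 T) t :=
      HasDerivWithinAt.fun_sum fun k _ => (hRd i k).fun_mul (𝒯.hasDerivWithinAt_gramE ht σ k j)
    have h2 : HasDerivWithinAt (fun s => ∑ k, (𝒯.gramE σ s)⁻¹ i k * 𝒯.gramE σ s k j) 0
        (Icc 0 T) t := by
      refine (hasDerivWithinAt_const t (Icc 0 T) ((1 : Matrix (Fin n) (Fin n) ℝ) i j)).congr
        (fun s hs => ?_) ?_
      · rw [← 𝒯.gramE_inv_mul hs σ, Matrix.mul_apply]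
      · rw [← 𝒯.gramE_inv_mul ht σ, Matrix.mul_apply]
    have h3 := (uniqueDiffOn_Icc hT t ht).eq_deriv _ h1 h2
    simpa [Matrix.add_apply, Matrix.mul_apply, Finset.sum_add_distrib] using h3
  have h4 : R = 𝒯.gramInv' σ t := by
    have h5 := congrArg (· * (𝒯.gramE σ t)⁻¹) h0
    simp only [add_mul, zero_mul] at h5
    rw [mul_assoc R, 𝒯.gramE_mul_inv ht, mul_one] at h5
    exact eq_neg_of_add_eq_zero_left h5
  rw [← h4]
  exact hRd i j

/-- The time derivative of the stiffness form of an element. -/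
def stiffE' (σ : Fin 𝒯.M) (t : ℝ) : 𝒯.Cf →L[ℝ] 𝒯.Cf :=
  ∑ i, ∑ j, 𝒯.gramInv' σ t i j • (innerSL ℝ (𝒯.diffVec σ j)).smulRight (𝒯.diffVec σ i)

theorem hasDerivWithinAt_stiffE (hT : 0 < T) (hn : n = 1 ∨ n = 2) {t : ℝ} (ht : t ∈ Icc 0 T)
    (σ : Fin 𝒯.M) : HasDerivWithinAt (𝒯.stiffE σ) (𝒯.stiffE' σ t) (Icc 0 T) t := by
  unfold stiffE stiffE'
  exact HasDerivWithinAt.fun_sum fun i _ => HasDerivWithinAt.fun_sum fun j _ =>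
    HasDerivWithinAt.smul_const (F := 𝒯.Cf →L[ℝ] 𝒯.Cf)
      (𝒯.hasDerivWithinAt_gramE_inv hT hn ht σ i j) _

/-- Differentiating the inverse Gram matrix gives -g⁻¹ g' g⁻¹; applied to the nodal differences, the
outer factors produce the gradient coefficients β and the two halves of g' coincide. This is the
origin of the term -2 α D_h(V_h) in B_h. -/
theorem inner_stiffE'_self {t : ℝ} (ht : t ∈ Icc 0 T) (σ : Fin 𝒯.M) (c : 𝒯.Cf) :
    inner ℝ (𝒯.stiffE' σ t c) c =
      -2 * inner ℝ (𝒯.elemDeriv σ t (𝒯.velo t) (𝒯.gradE σ t c)) (𝒯.gradE σ t c) := by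
  set P := (𝒯.gramE σ t)⁻¹ with hP
  set β : Fin n → ℝ := fun k => ∑ i, P i k * 𝒯.diffs σ c i with hβ
  have h1 : inner ℝ (𝒯.stiffE' σ t c) c = -∑ k, ∑ l, β k * 𝒯.gramE' σ t k l * β l := by
    have h2 : inner ℝ (𝒯.stiffE' σ t c) c =
        ∑ i, ∑ j, 𝒯.gramInv' σ t i j * (𝒯.diffs σ c j * 𝒯.diffs σ c i) := by
      simp [stiffE', sum_inner, inner_smul_left, inner_diffVec]
    have h3 : dotProduct (𝒯.diffs σ c) ((P * 𝒯.gramE' σ t * P).mulVec (𝒯.diffs σ c)) =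
        dotProduct β ((𝒯.gramE' σ t).mulVec β) := by
      have hb1 : β = P.mulVec (𝒯.diffs σ c) := by
        funext k
        simp only [hβ, Matrix.mulVec, dotProduct]
        exact Finset.sum_congr rfl fun i _ => by rw [hP, gramE_inv_symm]
      have hb2 : β = Matrix.vecMul (𝒯.diffs σ c) P := by
        funext k
        simp only [hβ, Matrix.vecMul, dotProduct]
        exact Finset.sum_congr rfl fun i _ => mul_comm _ _
      rw [← Matrix.mulVec_mulVec, ← Matrix.mulVec_mulVec, Matrix.dotProduct_mulVec, ← hb1, ← hb2]
    rw [h2]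
    have h4 : ∑ i, ∑ j, 𝒯.gramInv' σ t i j * (𝒯.diffs σ c j * 𝒯.diffs σ c i) =
        -dotProduct (𝒯.diffs σ c) ((P * 𝒯.gramE' σ t * P).mulVec (𝒯.diffs σ c)) := by
      simp only [dotProduct, Matrix.mulVec, gramInv', Matrix.neg_apply, Finset.mul_sum, ← hP,
        ← Finset.sum_neg_distrib]
      exact Finset.sum_congr rfl fun i _ => Finset.sum_congr rfl fun j _ => by ring
    rw [h4, h3]
    simp only [dotProduct, Matrix.mulVec, Finset.mul_sum]
    congr 1
    exact Finset.sum_congr rfl fun i _ => Finset.sum_congr rfl fun j _ => by ring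
  have hg : 𝒯.gradE σ t c = ∑ k, β k • 𝒯.edge σ t k := rfl
  have hv : 𝒯.elemDeriv σ t (𝒯.velo t) (𝒯.gradE σ t c) = ∑ k, β k • 𝒯.diffs σ (𝒯.velo t) k := by
    rw [hg, map_sum]
    exact Finset.sum_congr rfl fun k _ => by rw [map_smul, 𝒯.elemDeriv_edge ht]
  have h5 : inner ℝ (∑ k, β k • 𝒯.diffs σ (𝒯.velo t) k) (∑ k, β k • 𝒯.edge σ t k) =
      ∑ k, ∑ l, β k * β l * inner ℝ (𝒯.diffs σ (𝒯.velo t) k) (𝒯.edge σ t l) := by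
    rw [sum_inner]
    refine Finset.sum_congr rfl fun i _ => ?_
    rw [inner_smul_left, inner_sum, Finset.mul_sum]
    refine Finset.sum_congr rfl fun j _ => ?_
    rw [inner_smul_right, RCLike.conj_to_real]
    ring
  have h6 : ∑ k, ∑ l, β k * β l * inner ℝ (𝒯.edge σ t k) (𝒯.diffs σ (𝒯.velo t) l) =
      ∑ k, ∑ l, β k * β l * inner ℝ (𝒯.diffs σ (𝒯.velo t) k) (𝒯.edge σ t l) := by
    rw [Finset.sum_comm]
    exact Finset.sum_congr rfl fun i _ => Finset.sum_congr rfl fun j _ => by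
      rw [real_inner_comm]; ring
  rw [h1, hv, hg, h5]
  have h7 : ∑ k, ∑ l, β k * 𝒯.gramE' σ t k l * β l =
      ∑ k, ∑ l, β k * β l * inner ℝ (𝒯.edge σ t k) (𝒯.diffs σ (𝒯.velo t) l) +
      ∑ k, ∑ l, β k * β l * inner ℝ (𝒯.diffs σ (𝒯.velo t) k) (𝒯.edge σ t l) := by
    simp only [← Finset.sum_add_distrib]
    exact Finset.sum_congr rfl fun i _ => Finset.sum_congr rfl fun j _ => by rw [gramE']; ring
  rw [h7, h6]
  ring

/-! ### Regularity in time of the bilinear forms -/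

/-- The discrete transport theorem d/dt m_h = g_h for fixed nodal values. -/
theorem hasDerivWithinAt_massF (hn : n = 1 ∨ n = 2) {t : ℝ} (ht : t ∈ Icc 0 T) :
    HasDerivWithinAt 𝒯.massF (𝒯.divF t) (Icc 0 T) t := by
  unfold massF divF
  exact HasDerivWithinAt.fun_sum fun σ _ =>
    HasDerivWithinAt.smul_const (F := 𝒯.Cf →L[ℝ] 𝒯.Cf) (𝒯.hasDerivWithinAt_wt hn ht σ) _

theorem continuousOn_edge (σ : Fin 𝒯.M) (i : Fin n) :
    ContinuousOn (fun t => 𝒯.edge σ t i) (Icc 0 T) := fun _ ht =>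
  (𝒯.hasDerivWithinAt_edge ht σ i).continuousWithinAt

theorem continuousOn_wt (hn : n = 1 ∨ n = 2) (σ : Fin 𝒯.M) :
    ContinuousOn (𝒯.wt σ) (Icc 0 T) := fun _ ht =>
  (𝒯.hasDerivWithinAt_wt hn ht σ).continuousWithinAt

theorem continuousOn_divE (hn : n = 1 ∨ n = 2) (σ : Fin 𝒯.M) :
    ContinuousOn (𝒯.divE σ) (Icc 0 T) := by
  have h : ∀ i : Fin n, ContinuousOn (fun t => 𝒯.diffs σ (𝒯.velo t) i) (Icc 0 T) := fun i =>
    (𝒯.continuousOn_velo _).sub (𝒯.continuousOn_velo _)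
  have : 𝒯.divE σ = fun t => ∑ i, ∑ j, (𝒯.gramE σ t)⁻¹ i j *
      inner ℝ (𝒯.edge σ t j) (𝒯.diffs σ (𝒯.velo t) i) := funext fun t => 𝒯.divE_eq σ t
  rw [this]
  refine continuousOn_finsetSum _ fun i _ => continuousOn_finsetSum _ fun j _ => ?_
  refine ContinuousOn.mul (fun t ht => ?_) ((𝒯.continuousOn_edge σ j).inner (h i))
  exact (𝒯.differentiableWithinAt_gramE_inv hn ht σ i j).continuousWithinAt

theorem continuousOn_stiffE (hT : 0 < T) (hn : n = 1 ∨ n = 2) (σ : Fin 𝒯.M) :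
    ContinuousOn (𝒯.stiffE σ) (Icc 0 T) := fun _ ht =>
  (𝒯.hasDerivWithinAt_stiffE hT hn ht σ).continuousWithinAt

theorem continuousOn_divF (hn : n = 1 ∨ n = 2) : ContinuousOn 𝒯.divF (Icc 0 T) :=
  continuousOn_finsetSum _ fun σ _ =>
    ((𝒯.continuousOn_wt hn σ).mul (𝒯.continuousOn_divE hn σ)).smul continuousOn_const

theorem continuousOn_stiffF (hT : 0 < T) (hn : n = 1 ∨ n = 2) {κ : Fin 𝒯.M → ℝ → ℝ}
    (hκ : ∀ σ, ContinuousOn (κ σ) (Icc 0 T)) :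
    ContinuousOn (fun t => 𝒯.stiffF (fun σ => κ σ t) t) (Icc 0 T) :=
  continuousOn_finsetSum _ fun σ _ =>
    ((𝒯.continuousOn_wt hn σ).mul (hκ σ)).smul (𝒯.continuousOn_stiffE hT hn σ)

end EvolvingMesh
end ESFEM
end

/-! ### Signed distance and regularity of the normal projection. -/

noncomputable section

open MeasureTheory Set Filter Topology

namespace ESFEM
namespace EvolvingSurface

variable {n : ℕ} {T : ℝ} (S : EvolvingSurface n T)

/-! ### The normal projection -/

theorem isOpen_slice (t : ℝ) : IsOpen {x : Amb n | (t, x) ∈ S.nbhd} :=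
  S.nbhd_open.preimage (by fun_prop)

theorem differentiableAt_d {t : ℝ} (ht : t ∈ Icc 0 T) {x : Amb n} (hx : (t, x) ∈ S.nbhd) :
    DifferentiableAt ℝ (S.d t) x := by
  have h : ContDiffOn ℝ 1 (fun y => S.d t y) {y : Amb n | (t, y) ∈ S.nbhd} :=
    S.d_smooth.comp (f := fun y : Amb n => (t, y)) (contDiff_prodMk_right t).contDiffOn
      fun y hy => ⟨hy, ht, mem_univ _⟩
  exact (h.differentiableOn one_ne_zero).differentiableAt ((S.isOpen_slice t).mem_nhds hx)

theorem continuousAt_gradient {t : ℝ} (ht : t ∈ Icc 0 T) {x : Amb n} (hx : (t, x) ∈ S.nbhd) :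
    ContinuousAt (gradient (S.d t)) x := by
  have h : ContinuousOn (fun y => gradient (S.d t) y) {y : Amb n | (t, y) ∈ S.nbhd} :=
    S.d_grad_smooth.continuousOn.comp (f := fun y : Amb n => (t, y)) (by fun_prop)
      fun y hy => ⟨hy, ht, mem_univ _⟩
  exact h.continuousAt ((S.isOpen_slice t).mem_nhds hx)

end EvolvingSurface

section SignedDistance

variable {E : Type*} [NormedAddCommGroup E] [InnerProductSpace ℝ E]

/-- Along the segment from x to a nearest point q, q stays nearest: a closer point would, by the
triangle inequality, be too close to x. -/
theorem infDist_add_smul_of_nearest {K : Set E} {x q : E} (hq : q ∈ K)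
    (hxq : Metric.infDist x K = ‖x - q‖) {r : ℝ} (h0 : 0 ≤ r) (h1 : r ≤ 1) :
    Metric.infDist (q + r • (x - q)) K = r * ‖x - q‖ := by
  apply le_antisymm
  · refine (Metric.infDist_le_dist_of_mem hq).trans_eq ?_
    rw [dist_eq_norm, add_sub_cancel_left, norm_smul, Real.norm_of_nonneg h0]
  · have h := Metric.infDist_le_infDist_add_dist (s := K) (x := x) (y := q + r • (x - q))
    have h2 : dist x (q + r • (x - q)) = (1 - r) * ‖x - q‖ := by
      have : x - (q + r • (x - q)) = (1 - r) • (x - q) := by rw [sub_smul, one_smul]; abel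
      rw [dist_eq_norm, this, norm_smul, Real.norm_of_nonneg (by linarith)]
    rw [hxq, h2] at h
    linarith

/-- The gradient of a differentiable function that is, near `x`, plus or minus the distance to
`K` points away from, or towards, a nearest point of `K`. -/
theorem gradient_of_eventuallyEq_infDist [CompleteSpace E] {K : Set E} {f : E → ℝ} {ε : ℝ}
    (hε : ε ^ 2 = 1) {x q : E} (hf : DifferentiableAt ℝ f x)
    (hfd : f =ᶠ[𝓝 x] fun y => ε * Metric.infDist y K) (hq : q ∈ K)
    (hxq : Metric.infDist x K = ‖x - q‖) (hne : x ≠ q) :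
    ‖x - q‖ • gradient f x = ε • (x - q) := by
  have hρ : 0 < ‖x - q‖ := norm_pos_iff.2 (sub_ne_zero.2 hne)
  have habs : |ε| = 1 := by
    rw [← sq_abs] at hε
    nlinarith [abs_nonneg ε]
  have hg : HasFDerivAt f (innerSL ℝ (gradient f x)) x := by
    have := hf.hasGradientAt.hasFDerivAt
    exact this
  -- The distance function is 1-Lipschitz.
  have hnorm : ‖gradient f x‖ ≤ 1 := by
    have h1 : ‖innerSL ℝ (gradient f x)‖ ≤ 1 := by
      refine hg.le_of_lip' zero_le_one ?_
      filter_upwards [hfd] with y hy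
      rw [hy, hfd.self_of_nhds, ← mul_sub, Real.norm_eq_abs, abs_mul, habs, one_mul, one_mul,
        ← dist_eq_norm, ← Real.dist_eq]
      simpa using (Metric.lipschitz_infDist_pt K).dist_le_mul y x
    rwa [innerSL_apply_norm] at h1
  have hinner : inner ℝ (gradient f x) (x - q) = ε * ‖x - q‖ := by
    let γ : ℝ → E := fun r => q + r • (x - q)
    have hγ1 : γ 1 = x := by simp [γ]
    have hγ : HasDerivAt γ (x - q) 1 := by
      have := ((hasDerivAt_id (1 : ℝ)).smul_const (x - q)).const_add q
      simpa [γ] using this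
    -- The distance along the ray is known only up to x, that is for r ≤ 1, so one-sided derivatives
    -- are compared.
    have h1 : HasDerivWithinAt (f ∘ γ) (inner ℝ (gradient f x) (x - q)) (Iic 1) 1 := by
      have hg' : HasFDerivAt f (innerSL ℝ (gradient f x)) (γ 1) := by rw [hγ1]; exact hg
      exact (hg'.comp_hasDerivAt 1 hγ).hasDerivWithinAt
    have h2 : HasDerivWithinAt (f ∘ γ) (ε * ‖x - q‖) (Iic 1) 1 := by
      have h3 : HasDerivWithinAt (fun r : ℝ => ε * (r * ‖x - q‖)) (ε * ‖x - q‖) (Iic 1) 1 := by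
        have := (((hasDerivAt_id (1 : ℝ)).mul_const ‖x - q‖).const_mul ε).hasDerivWithinAt
          (s := Iic 1)
        simpa using this
      refine h3.congr_of_eventuallyEq ?_ ?_
      · have h4 : ∀ᶠ r in 𝓝[Iic 1] (1 : ℝ), f (γ r) = ε * Metric.infDist (γ r) K := by
          have : Tendsto γ (𝓝[Iic 1] 1) (𝓝 x) := by
            have := hγ.continuousAt.tendsto
            rw [hγ1] at this
            exact this.mono_left nhdsWithin_le_nhds
          exact this.eventually hfd
        have h5 : ∀ᶠ r in 𝓝[Iic 1] (1 : ℝ), 0 ≤ r :=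
          nhdsWithin_le_nhds (eventually_ge_nhds zero_lt_one)
        filter_upwards [h4, h5, self_mem_nhdsWithin] with r hr h0 h1
        rw [Function.comp_apply, hr, infDist_add_smul_of_nearest hq hxq h0 h1]
      · rw [Function.comp_apply, hγ1, hfd.self_of_nhds, one_mul, ← hxq]
    exact (uniqueDiffWithinAt_Iic 1).eq_deriv _ h1 h2
  -- Equality in Cauchy–Schwarz: a vector of norm at most 1 whose product with x - q is ε ‖x - q‖
  -- must be ε times the unit vector.
  have h0 : ‖‖x - q‖ • gradient f x - ε • (x - q)‖ ^ 2 ≤ 0 := by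
    rw [norm_sub_sq_real, norm_smul, norm_smul, inner_smul_left, inner_smul_right, hinner,
      norm_norm, Real.norm_eq_abs, habs, RCLike.conj_to_real, one_mul]
    have : ‖x - q‖ * (ε * (ε * ‖x - q‖)) = ‖x - q‖ ^ 2 := by
      linear_combination ‖x - q‖ ^ 2 * hε
    rw [this]
    have h6 : (‖x - q‖ * ‖gradient f x‖) ^ 2 ≤ ‖x - q‖ ^ 2 := by
      rw [mul_pow]
      exact mul_le_of_le_one_right (sq_nonneg _) (pow_le_one₀ (norm_nonneg _) hnorm)
    linarith
  have h7 := pow_eq_zero_iff (two_ne_zero) |>.1 (le_antisymm h0 (sq_nonneg _))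
  exact sub_eq_zero.1 (norm_eq_zero.1 h7)

end SignedDistance

namespace EvolvingSurface

variable {n : ℕ} {T : ℝ} (S : EvolvingSurface n T)

/-- A nearest point is given by both the gradient at the point and that at its projection. -/
theorem nearest_point_eq {t : ℝ} (ht : t ∈ Icc 0 T) {x q : Amb n} (hx : (t, x) ∈ S.nbhd)
    (hq : q ∈ S.Γ t) (hxq : Metric.infDist x (S.Γ t) = ‖x - q‖) :
    x - q = S.d t x • gradient (S.d t) x ∧ x = q + S.d t x • gradient (S.d t) q := by
  classical
  obtain ⟨D, hDo, -, hDf, hD⟩ := S.signed_distance t ht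
  let ε : Amb n → ℝ := fun y => if y ∈ D then -1 else 1
  have hε : ∀ y, ε y ^ 2 = 1 := fun y => by simp only [ε]; split_ifs <;> norm_num
  have hd : ∀ y, (t, y) ∈ S.nbhd → S.d t y = ε y * Metric.infDist y (S.Γ t) := fun y hy => by
    simp only [ε]
    split_ifs with h
    · rw [(hD y hy).1 h]; ring
    · rw [(hD y hy).2 h]; ring
  rcases eq_or_ne x q with rfl | hne
  · have h0 : S.d t x = 0 := by rw [hd x hx, hxq]; simp
    simp [h0]
  have hρ : 0 < ‖x - q‖ := norm_pos_iff.2 (sub_ne_zero.2 hne)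
  -- Off the surface, which is the frontier of D, a point is interior to D or to its complement, so
  -- the sign is locally constant.
  have hloc : ∀ y, (t, y) ∈ S.nbhd → y ∉ S.Γ t →
      S.d t =ᶠ[𝓝 y] fun z => ε y * Metric.infDist z (S.Γ t) := by
    intro y hy hyΓ
    have h1 : ∀ᶠ z in 𝓝 y, ε z = ε y := by
      by_cases hyD : y ∈ D
      · filter_upwards [hDo.mem_nhds hyD] with z hz
        simp only [ε, if_pos hz, if_pos hyD]
      · have : y ∉ closure D := fun hc => hyΓ (by
          rw [← hDf, frontier, hDo.interior_eq]
          exact ⟨hc, hyD⟩)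
        filter_upwards [isClosed_closure.isOpen_compl.mem_nhds this] with z hz
        have hz' : z ∉ D := fun h => hz (subset_closure h)
        simp only [ε, if_neg hz', if_neg hyD]
    filter_upwards [h1, (S.isOpen_slice t).mem_nhds hy] with z hz hz'
    rw [hd z hz', hz]
  let γ : ℝ → Amb n := fun r => q + r • (x - q)
  have hγd : ∀ r ∈ Ioc (0 : ℝ) 1, Metric.infDist (γ r) (S.Γ t) = r * ‖x - q‖ := fun r hr =>
    infDist_add_smul_of_nearest hq hxq hr.1.le hr.2
  have hγΓ : ∀ r ∈ Ioc (0 : ℝ) 1, γ r ∉ S.Γ t := fun r hr hmem => by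
    have h1 := hγd r hr
    rw [Metric.infDist_zero_of_mem hmem] at h1
    exact (mul_pos hr.1 hρ).ne h1
  have hγ1 : γ 1 = x := by simp [γ]
  have hγc : Continuous γ := by fun_prop
  -- The half-open segment is connected and misses the frontier of D, so it stays on one side.
  have hγε : ∀ r ∈ Ioc (0 : ℝ) 1, ε (γ r) = ε x := by
    have hpre : IsPreconnected (γ '' Ioc 0 1) := isPreconnected_Ioc.image _ hγc.continuousOn
    have hdis : ∀ a ∈ γ '' Ioc 0 1, ∀ b ∈ γ '' Ioc 0 1, a ∈ D → b ∈ D := by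
      have hcl : ∀ b ∈ γ '' Ioc 0 1, b ∉ D → b ∈ (closure D)ᶜ := by
        rintro _ ⟨r, hr, rfl⟩ h1 h2
        refine hγΓ r hr ?_
        rw [← hDf, frontier, hDo.interior_eq]
        exact ⟨h2, h1⟩
      intro a ha b hb haD
      by_contra hbD
      obtain ⟨z, -, hz1, hz2⟩ := hpre D (closure D)ᶜ hDo isClosed_closure.isOpen_compl
        (fun z hz => or_iff_not_imp_left.2 fun h => hcl z hz h) ⟨a, ha, haD⟩ ⟨b, hb, hcl b hb hbD⟩
      exact hz2 (subset_closure hz1)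
    intro r hr
    have hm1 : x ∈ γ '' Ioc 0 1 := ⟨1, ⟨zero_lt_one, le_rfl⟩, hγ1⟩
    have hm2 : γ r ∈ γ '' Ioc 0 1 := mem_image_of_mem _ hr
    by_cases h1 : γ r ∈ D <;> by_cases h2 : x ∈ D
    · simp only [ε, if_pos h1, if_pos h2]
    · exact absurd (hdis _ hm2 _ hm1 h1) h2
    · exact absurd (hdis _ hm1 _ hm2 h2) h1
    · simp only [ε, if_neg h1, if_neg h2]
  have hgrad : ∀ r ∈ Ioc (0 : ℝ) 1, (t, γ r) ∈ S.nbhd →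
      ‖x - q‖ • gradient (S.d t) (γ r) = ε x • (x - q) := by
    intro r hr hmem
    have hsub : γ r - q = r • (x - q) := by simp [γ]
    have hnorm : ‖γ r - q‖ = r * ‖x - q‖ := by
      rw [hsub, norm_smul, Real.norm_of_nonneg hr.1.le]
    have h1 := gradient_of_eventuallyEq_infDist (hε (γ r)) (S.differentiableAt_d ht hmem)
      (hloc _ hmem (hγΓ r hr)) hq ((hγd r hr).trans hnorm.symm)
      (fun h => hγΓ r hr (h ▸ hq))
    rw [hnorm, hsub, hγε r hr, smul_comm, mul_smul] at h1
    exact smul_right_injective _ hr.1.ne' h1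
  have hdx : S.d t x = ε x * ‖x - q‖ := by rw [hd x hx, hxq]
  have hfin : ∀ g : Amb n, ‖x - q‖ • g = ε x • (x - q) → x - q = S.d t x • g := fun g hg => by
    rw [hdx, mul_smul, hg, smul_smul, ← pow_two, hε, one_smul]
  constructor
  · apply hfin
    have := hgrad 1 ⟨zero_lt_one, le_rfl⟩ (by rw [hγ1]; exact hx)
    rwa [hγ1] at this
  · rw [← sub_eq_iff_eq_add']
    apply hfin
    have hqn : (t, q) ∈ S.nbhd := S.nbhd_covers t ht q hq
    -- The distance representation is not available near q itself. The gradient is constant on the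
    -- part of the segment near q, so its continuity up to the surface gives the value at q. Only
    -- points near q and x need lie in the neighbourhood, not the whole segment.
    have hγ0 : Tendsto γ (𝓝[>] 0) (𝓝 q) := by
      have := hγc.tendsto 0
      simp only [γ, zero_smul, add_zero] at this
      exact this.mono_left nhdsWithin_le_nhds
    have hlim : Tendsto (fun r => ‖x - q‖ • gradient (S.d t) (γ r)) (𝓝[>] 0)
        (𝓝 (‖x - q‖ • gradient (S.d t) q)) :=
      ((S.continuousAt_gradient ht hqn).tendsto.comp hγ0).const_smul _
    refine tendsto_nhds_unique hlim (tendsto_const_nhds.congr' ?_)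
    have hev : ∀ᶠ r in 𝓝[>] (0 : ℝ), (t, γ r) ∈ S.nbhd :=
      hγ0.eventually ((S.isOpen_slice t).mem_nhds hqn)
    filter_upwards [hev, Ioc_mem_nhdsGT zero_lt_one] with r h1 h2
    exact (hgrad r h2 h1).symm

/-- A nearest point satisfies the defining equation of the projection, so by uniqueness it is the
projection. Evaluating the gradient at x instead of at the foot point makes the formula explicit,
and p inherits the regularity of d and ∇d. -/
theorem proj_spec {t : ℝ} (ht : t ∈ Icc 0 T) {x : Amb n} (hx : (t, x) ∈ S.nbhd) :
    S.proj t x ∈ S.Γ t ∧ S.proj t x = x - S.d t x • gradient (S.d t) x := by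
  obtain ⟨q, hq, hdist⟩ := (S.compact t ht).exists_infDist_eq_dist (S.connected t ht).nonempty x
  rw [dist_eq_norm] at hdist
  obtain ⟨h1, h2⟩ := S.nearest_point_eq ht hx hq hdist
  have h3 : S.proj t x = q := by
    have hspec := Classical.epsilon_spec (S.proj_unique t ht x hx).exists
    exact (S.proj_unique t ht x hx).unique hspec ⟨hq, h2⟩
  rw [h3]
  exact ⟨hq, by rw [← h1]; abel⟩

theorem contDiffOn_proj : ContDiffOn ℝ 1 (fun q : ℝ × Amb n => S.proj q.1 q.2)
    (S.nbhd ∩ Icc 0 T ×ˢ univ) :=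
  (contDiffOn_snd.sub (S.d_smooth.smul S.d_grad_smooth)).congr fun _ hq =>
    (S.proj_spec hq.2.1 hq.1).2

theorem continuousOn_proj_slice {t : ℝ} (ht : t ∈ Icc 0 T) :
    ContinuousOn (S.proj t) {x : Amb n | (t, x) ∈ S.nbhd} :=
  S.contDiffOn_proj.continuousOn.comp (f := fun y : Amb n => (t, y)) (by fun_prop)
    fun _ hy => ⟨hy, ht, mem_univ _⟩

end EvolvingSurface
end ESFEM
end

/-! ### The lifted diffusion coefficient, its element integrals and the tensor B_h. -/

noncomputable section

open MeasureTheory Set Filter Topology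

namespace ESFEM

namespace EvolvingSurface

variable {n : ℕ} {T : ℝ} (S : EvolvingSurface n T)

/-- A realization of the diffusion coefficient with the required regularity and bounds. -/
structure GoodPath (αmin αmax : ℝ) (a : ℝ → Amb n → ℝ) : Prop where
  smooth : ∃ (O : Set (ℝ × Amb n)) (F : ℝ × Amb n → ℝ), IsOpen O ∧ S.GT ⊆ O ∧
    ContDiffOn ℝ 1 F O ∧ ∀ q ∈ S.GT, F q = a q.1 q.2
  bounds : ∀ t ∈ Icc 0 T, ∀ x ∈ S.Γ t, αmin ≤ a t x ∧ a t x ≤ αmax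

variable {S}

theorem DiffusionCoeff.ae_goodPath {Ω : Type*} [MeasurableSpace Ω] {P : Measure Ω}
    {αmin αmax : ℝ} {α : Ω → ℝ → Amb n → ℝ} (h : S.DiffusionCoeff P αmin αmax α) :
    ∀ᵐ ω ∂P, S.GoodPath αmin αmax (α ω) := by
  filter_upwards [h.smooth, h.bounds] with ω h1 h2
  exact ⟨h1, h2⟩

/-- The lift of one realization to the discrete surface. -/
abbrev pathLift (S : EvolvingSurface n T) (a : ℝ → Amb n → ℝ) (t : ℝ) (x : Amb n) : ℝ :=
  a t (S.proj t x)

theorem GoodPath.contDiffOn_pathLift {αmin αmax : ℝ} {a : ℝ → Amb n → ℝ}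
    (h : S.GoodPath αmin αmax a) :
    ContDiffOn ℝ 1 (fun q : ℝ × Amb n => S.pathLift a q.1 q.2) (S.nbhd ∩ Icc 0 T ×ˢ univ) := by
  obtain ⟨O, F, -, hGO, hF, hFa⟩ := h.smooth
  have hmem : ∀ q ∈ S.nbhd ∩ Icc 0 T ×ˢ univ, (q.1, S.proj q.1 q.2) ∈ S.GT := fun q hq =>
    ⟨hq.2.1, (S.proj_spec hq.2.1 hq.1).1⟩
  refine (hF.comp (f := fun q : ℝ × Amb n => (q.1, S.proj q.1 q.2))
    (contDiffOn_fst.prodMk S.contDiffOn_proj) fun q hq => hGO (hmem q hq)).congr fun q hq => ?_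
  exact (hFa _ (hmem q hq)).symm

end EvolvingSurface

namespace EvolvingMesh

variable {n : ℕ} {T : ℝ} {S : EvolvingSurface n T} (𝒯 : EvolvingMesh S)

theorem param_mem_nbhd {t : ℝ} (ht : t ∈ Icc 0 T) (σ : Fin 𝒯.M) {y : EuclideanSpace ℝ (Fin n)}
    (hy : y ∈ refSimplex n) : (t, 𝒯.param σ t y) ∈ S.nbhd :=
  𝒯.subset_nbhd t ht σ _ (𝒯.param_mem_E σ t hy)

theorem hasDerivWithinAt_param {t : ℝ} (ht : t ∈ Icc 0 T) (σ : Fin 𝒯.M)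
    (y : EuclideanSpace ℝ (Fin n)) :
    HasDerivWithinAt (fun s => 𝒯.param σ s y) (∑ i, bary y i • 𝒯.velo t (𝒯.elem σ i))
      (Icc 0 T) t := by
  unfold param baryPt velo
  exact HasDerivWithinAt.fun_sum fun i _ =>
    (𝒯.vertex_ode (𝒯.elem σ i) t ht).fun_const_smul (bary y i)

variable {𝒯} {αmin αmax : ℝ} {a : ℝ → Amb n → ℝ}

theorem pathLift_bounds (h : S.GoodPath αmin αmax a) {t : ℝ} (ht : t ∈ Icc 0 T) (σ : Fin 𝒯.M)
    {y : EuclideanSpace ℝ (Fin n)} (hy : y ∈ refSimplex n) :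
    αmin ≤ S.pathLift a t (𝒯.param σ t y) ∧ S.pathLift a t (𝒯.param σ t y) ≤ αmax :=
  h.bounds t ht _ (S.proj_spec ht (𝒯.param_mem_nbhd ht σ hy)).1

/-- In reference coordinates the trajectories of V_h are the curves of fixed y, so the material
derivative is the time derivative of the pulled-back coefficient. -/
theorem hasDerivWithinAt_pathLift (h : S.GoodPath αmin αmax a) {t : ℝ}
    (ht : t ∈ Icc 0 T) (σ : Fin 𝒯.M) {y : EuclideanSpace ℝ (Fin n)} (hy : y ∈ refSimplex n) :
    HasDerivWithinAt (fun s => S.pathLift a s (𝒯.param σ s y))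
      (𝒯.matDeriv (S.pathLift a) t (𝒯.param σ t y)) (Icc 0 T) t := by
  have h1 : DifferentiableWithinAt ℝ (fun s => S.pathLift a s (𝒯.param σ s y)) (Icc 0 T) t := by
    have hd := h.contDiffOn_pathLift.differentiableOn one_ne_zero (t, 𝒯.param σ t y)
      ⟨𝒯.param_mem_nbhd ht σ hy, ht, mem_univ _⟩
    exact hd.comp (f := fun s => (s, 𝒯.param σ s y)) t
      (differentiableWithinAt_id.prodMk (𝒯.hasDerivWithinAt_param ht σ y).differentiableWithinAt)
      fun s hs => ⟨𝒯.param_mem_nbhd hs σ hy, hs, mem_univ _⟩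
  have h2 : 𝒯.matDeriv (S.pathLift a) t (𝒯.param σ t y) =
      derivWithin (fun s => S.pathLift a s (𝒯.param σ s y)) (Icc 0 T) t := by
    rw [matDeriv]
    congr! 2 with s
    exact congrArg (S.pathLift a s) (𝒯.flow_baryPt ht s σ (bary_mem hy))
  rw [h2]
  exact h1.hasDerivWithinAt

theorem continuousOn_pathLift (h : S.GoodPath αmin αmax a) {t : ℝ} (ht : t ∈ Icc 0 T)
    (σ : Fin 𝒯.M) : ContinuousOn (fun y => S.pathLift a t (𝒯.param σ t y)) (refSimplex n) :=
  h.contDiffOn_pathLift.continuousOn.comp (f := fun y => (t, 𝒯.param σ t y))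
    (continuousOn_const.prodMk (𝒯.continuous_param σ t).continuousOn)
    fun _ hy => ⟨𝒯.param_mem_nbhd ht σ hy, ht, mem_univ _⟩

variable (𝒯)

/-- The elementwise means of a coefficient, in reference coordinates. -/
def kap (b : ℝ → Amb n → ℝ) (σ : Fin 𝒯.M) (t : ℝ) : ℝ := ∫ y in refSimplex n, b t (𝒯.param σ t y)

variable {𝒯}

theorem integrableOn_pathLift (h : S.GoodPath αmin αmax a) {t : ℝ} (ht : t ∈ Icc 0 T)
    (σ : Fin 𝒯.M) : IntegrableOn (fun y => S.pathLift a t (𝒯.param σ t y)) (refSimplex n) :=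
  (continuousOn_pathLift h ht σ).integrableOn_compact (isCompact_refSimplex n)

theorem setIntegral_refSimplex_const (c : ℝ) : ∫ _ in refSimplex n, c = c * refVol n := by
  simp [refVol, Measure.real, mul_comm]

theorem kap_bounds (h : S.GoodPath αmin αmax a) {t : ℝ} (ht : t ∈ Icc 0 T) (σ : Fin 𝒯.M) :
    αmin * refVol n ≤ 𝒯.kap (S.pathLift a) σ t ∧ 𝒯.kap (S.pathLift a) σ t ≤ αmax * refVol n := by
  rw [← setIntegral_refSimplex_const, ← setIntegral_refSimplex_const, kap]
  exact ⟨setIntegral_mono_on (integrable_const _) (integrableOn_pathLift h ht σ)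
      (measurableSet_refSimplex n) fun y hy => (pathLift_bounds h ht σ hy).1,
    setIntegral_mono_on (integrableOn_pathLift h ht σ) (integrable_const _)
      (measurableSet_refSimplex n) fun y hy => (pathLift_bounds h ht σ hy).2⟩

theorem abs_pathLift_le (h : S.GoodPath αmin αmax a) {t : ℝ} (ht : t ∈ Icc 0 T) (σ : Fin 𝒯.M)
    {y : EuclideanSpace ℝ (Fin n)} (hy : y ∈ refSimplex n) :
    |S.pathLift a t (𝒯.param σ t y)| ≤ max |αmin| |αmax| :=
  abs_le_max_abs_abs (pathLift_bounds h ht σ hy).1 (pathLift_bounds h ht σ hy).2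

/-- Dominated convergence with the uniform bounds of the coefficient as majorant. -/
theorem continuousOn_kap (h : S.GoodPath αmin αmax a) (σ : Fin 𝒯.M) :
    ContinuousOn (𝒯.kap (S.pathLift a) σ) (Icc 0 T) := by
  intro t ht
  refine continuousWithinAt_of_dominated (bound := fun _ => max |αmin| |αmax|) ?_ ?_
    (integrable_const _) ?_
  · filter_upwards [self_mem_nhdsWithin] with s hs
    exact (integrableOn_pathLift h hs σ).aestronglyMeasurable
  · filter_upwards [self_mem_nhdsWithin] with s hs
    filter_upwards [ae_restrict_mem (measurableSet_refSimplex n)] with y hy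
    exact abs_pathLift_le h hs σ hy
  · filter_upwards [ae_restrict_mem (measurableSet_refSimplex n)] with y hy
    exact (hasDerivWithinAt_pathLift h ht σ hy).continuousWithinAt

theorem measurable_kap {Ω : Type*} [MeasurableSpace Ω] {α : Ω → ℝ → Amb n → ℝ}
    (hα : Measurable fun q : Ω × S.GT => α q.1 q.2.1.1 q.2.1.2) {t : ℝ} (ht : t ∈ Icc 0 T)
    (σ : Fin 𝒯.M) : Measurable fun ω => 𝒯.kap (S.invLift α ω) σ t := by
  -- Joint measurability of α is given only on Ω × G_T, so the integral is taken over the reference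
  -- simplex as a subtype, whose points are mapped into G_T.
  let p : refSimplex n → S.GT := fun y =>
    ⟨(t, S.proj t (𝒯.param σ t y)), ht, (S.proj_spec ht (𝒯.param_mem_nbhd ht σ y.2)).1⟩
  have hp : Measurable p := by
    refine Measurable.subtype_mk (measurable_const.prodMk ?_)
    refine Continuous.measurable ?_
    have : ContinuousOn (fun y => S.proj t (𝒯.param σ t y)) (refSimplex n) :=
      (S.continuousOn_proj_slice ht).comp (𝒯.continuous_param σ t).continuousOn
        fun y hy => 𝒯.param_mem_nbhd ht σ hy
    exact this.domRestrict
  have hm : Measurable fun q : Ω × refSimplex n => S.invLift α q.1 t (𝒯.param σ t q.2) :=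
    hα.comp (measurable_fst.prodMk (hp.comp measurable_snd))
  have : IsFiniteMeasure (Measure.comap (Subtype.val : refSimplex n → _) volume) := by
    refine ⟨?_⟩
    rw [(MeasurableEmbedding.subtype_coe (measurableSet_refSimplex n)).comap_apply]
    simpa using (isCompact_refSimplex n).measure_lt_top
  have h2 : (fun ω => 𝒯.kap (S.invLift α ω) σ t) = fun ω => ∫ y : refSimplex n,
      S.invLift α ω t (𝒯.param σ t y) ∂(Measure.comap Subtype.val volume) := by
    funext ω
    exact (integral_subtype_comap (measurableSet_refSimplex n)
      (fun y => S.invLift α ω t (𝒯.param σ t y))).symm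
  rw [h2]
  exact (hm.stronglyMeasurable.integral_prod_right).measurable

/-! ### Consequences of a bound for `B_h` -/

/-- The n edges cannot span an (n+1)-dimensional space. The normal serves to read off the scalar
part of B_h. -/
theorem exists_normal (σ : Fin 𝒯.M) (t : ℝ) :
    ∃ ν : Amb n, ν ≠ 0 ∧ ∀ j, inner ℝ (𝒯.edge σ t j) ν = 0 := by
  have h1 : (Submodule.span ℝ (range (𝒯.edge σ t)))ᗮ ≠ ⊥ := by
    intro h
    rw [Submodule.orthogonal_eq_bot_iff] at h
    have h2 := finrank_range_le_card (R := ℝ) (𝒯.edge σ t)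
    rw [Set.finrank, h, finrank_top] at h2
    simp at h2
  obtain ⟨ν, hν, hν0⟩ := Submodule.exists_mem_ne_zero_of_ne_bot h1
  exact ⟨ν, hν0, fun j => hν _ (Submodule.subset_span (mem_range_self j))⟩

theorem Bh_apply {t : ℝ} (ht : t ∈ Icc 0 T) (σ : Fin 𝒯.M) {x : Amb n} (hx : x ∈ 𝒯.E σ t)
    (b : ℝ → Amb n → ℝ) (w : Amb n) :
    𝒯.Bh b σ t x w = (𝒯.matDeriv b t x + b t x * 𝒯.divE σ t) • w
      - (2 * b t x) • 𝒯.elemDeriv σ t (𝒯.velo t) w := by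
  simp only [Bh, 𝒯.divVh_eq ht σ hx, 𝒯.tangDeriv_Vh ht σ hx]
  rfl

/-- D_h(V_h) annihilates the normal, so B_h acts on it as multiplication by the scalar ∂_h^• α + α ∇
· V_h. -/
theorem abs_matDeriv_add_le {t : ℝ} (ht : t ∈ Icc 0 T) (σ : Fin 𝒯.M) {x : Amb n}
    (hx : x ∈ 𝒯.E σ t) {b : ℝ → Amb n → ℝ} {B : ℝ} (hB : ‖𝒯.Bh b σ t x‖ ≤ B) :
    |𝒯.matDeriv b t x + b t x * 𝒯.divE σ t| ≤ B := by
  obtain ⟨ν, hν0, hν⟩ := exists_normal (𝒯 := 𝒯) σ t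
  have h1 : 𝒯.elemDeriv σ t (𝒯.velo t) ν = 0 := by
    rw [elemDeriv_apply]
    simp [hν]
  have h2 := (𝒯.Bh b σ t x).le_of_opNorm_le hB ν
  rw [Bh_apply ht σ hx, h1, smul_zero, sub_zero, norm_smul, Real.norm_eq_abs] at h2
  exact le_of_mul_le_mul_right h2 (norm_pos_iff.2 hν0)

/-- The left side is B_h ∇u · ∇u: the scalar part acts on |∇u|² and `inner_stiffE'_self` supplies
the part with D_h(V_h). -/
theorem abs_inner_Bh_le {t : ℝ} (ht : t ∈ Icc 0 T) (σ : Fin 𝒯.M) {x : Amb n}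
    (hx : x ∈ 𝒯.E σ t) {b : ℝ → Amb n → ℝ} {B : ℝ} (hB : ‖𝒯.Bh b σ t x‖ ≤ B) (c : 𝒯.Cf) :
    |(𝒯.matDeriv b t x + b t x * 𝒯.divE σ t) * inner ℝ (𝒯.stiffE σ t c) c
      + b t x * inner ℝ (𝒯.stiffE' σ t c) c| ≤ B * inner ℝ (𝒯.stiffE σ t c) c := by
  have h : (𝒯.matDeriv b t x + b t x * 𝒯.divE σ t) * inner ℝ (𝒯.stiffE σ t c) c
      + b t x * inner ℝ (𝒯.stiffE' σ t c) c =
      inner ℝ (𝒯.Bh b σ t x (𝒯.gradE σ t c)) (𝒯.gradE σ t c) := by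
    rw [Bh_apply ht σ hx, inner_sub_left, inner_smul_left, inner_smul_left,
      𝒯.inner_stiffE'_self ht, 𝒯.stiffE_eq_inner ht]
    simp only [RCLike.conj_to_real]
    ring
  rw [h, 𝒯.stiffE_self ht, pow_two, ← mul_assoc]
  exact (abs_real_inner_le_norm _ _).trans
    (mul_le_mul_of_nonneg_right ((𝒯.Bh b σ t x).le_of_opNorm_le hB _) (norm_nonneg _))

/-- The time derivative of the elementwise means, when `B_h` is bounded. -/
theorem hasDerivAt_kap (h : S.GoodPath αmin αmax a) {B : ℝ}
    (hB : ∀ t ∈ Icc 0 T, ∀ σ, ∀ x ∈ 𝒯.E σ t, ‖𝒯.Bh (S.pathLift a) σ t x‖ ≤ B) {D : ℝ}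
    (hD : ∀ t ∈ Icc 0 T, ∀ σ, |𝒯.divE σ t| ≤ D) (σ : Fin 𝒯.M) {t : ℝ} (ht : t ∈ Ioo 0 T) :
    IntegrableOn (fun y => 𝒯.matDeriv (S.pathLift a) t (𝒯.param σ t y)) (refSimplex n) ∧
    HasDerivAt (𝒯.kap (S.pathLift a) σ)
      (∫ y in refSimplex n, 𝒯.matDeriv (S.pathLift a) t (𝒯.param σ t y)) t := by
  have hI : ∀ s ∈ Ioo 0 T, s ∈ Icc 0 T := fun s hs => Ioo_subset_Icc_self hs
  have hder : ∀ y ∈ refSimplex n, ∀ s ∈ Ioo 0 T,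
      HasDerivAt (fun s => S.pathLift a s (𝒯.param σ s y))
        (𝒯.matDeriv (S.pathLift a) s (𝒯.param σ s y)) s := fun y hy s hs =>
    (hasDerivWithinAt_pathLift h (hI s hs) σ hy).hasDerivAt (Icc_mem_nhds hs.1 hs.2)
  refine hasDerivAt_integral_of_dominated_loc_of_deriv_le (s := Ioo 0 T)
    (μ := volume.restrict (refSimplex n)) (F := fun s y => S.pathLift a s (𝒯.param σ s y))
    (F' := fun s y => 𝒯.matDeriv (S.pathLift a) s (𝒯.param σ s y))
    -- The scalar part of B_h is bounded by B and α ∇ · V_h by max(|αmin|, |αmax|) D; the difference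
    -- bounds the material derivative uniformly in time and space.
    (bound := fun _ => B + max |αmin| |αmax| * D) (Ioo_mem_nhds ht.1 ht.2) ?_
    (integrableOn_pathLift h (hI t ht) σ) ?_ ?_ (integrable_const _) ?_
  · filter_upwards [Ioo_mem_nhds ht.1 ht.2] with s hs
    exact (integrableOn_pathLift h (hI s hs) σ).aestronglyMeasurable
  -- Measurability of the derivative in y: it is the limit of difference quotients at times
  -- decreasing to t.
  · obtain ⟨u, -, hu, hut⟩ := exists_seq_strictAnti_tendsto' ht.2
    refine aestronglyMeasurable_of_tendsto_ae atTop
      (f := fun k y => slope (fun s => S.pathLift a s (𝒯.param σ s y)) t (u k)) (fun k => ?_) ?_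
    · have hk : u k ∈ Icc 0 T := ⟨(ht.1.trans (hu k).1).le, (hu k).2.le⟩
      have := ((integrableOn_pathLift h hk σ).aestronglyMeasurable.sub
        (integrableOn_pathLift h (hI t ht) σ).aestronglyMeasurable).const_smul ((u k - t)⁻¹)
      exact this
    · filter_upwards [ae_restrict_mem (measurableSet_refSimplex n)] with y hy
      have h1 := (hder y hy t ht).tendsto_slope
      refine h1.comp (tendsto_nhdsWithin_iff.2 ⟨hut, Eventually.of_forall fun k => ?_⟩)
      exact (hu k).1.ne'
  · filter_upwards [ae_restrict_mem (measurableSet_refSimplex n)] with y hy s hs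
    have hE := 𝒯.param_mem_E σ s hy
    have h1 := abs_matDeriv_add_le (hI s hs) σ hE (hB s (hI s hs) σ _ hE)
    have h2 : |S.pathLift a s (𝒯.param σ s y) * 𝒯.divE σ s| ≤ max |αmin| |αmax| * D := by
      rw [abs_mul]
      exact mul_le_mul (abs_pathLift_le h (hI s hs) σ hy) (hD s (hI s hs) σ) (abs_nonneg _)
        (le_max_of_le_left (abs_nonneg _))
    rw [Real.norm_eq_abs]
    rw [abs_le] at *
    constructor <;> linarith
  · filter_upwards [ae_restrict_mem (measurableSet_refSimplex n)] with y hy s hs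
    exact hder y hy s hs

/-- Under a bound for `B_h`, the stiffness form is differentiable in time, with a derivative
bounded by the unweighted stiffness form. -/
theorem exists_hasDerivAt_stiffF (hT : 0 < T) (hn : n = 1 ∨ n = 2) (h : S.GoodPath αmin αmax a)
    {B : ℝ} (hB : ∀ t ∈ Icc 0 T, ∀ σ, ∀ x ∈ 𝒯.E σ t, ‖𝒯.Bh (S.pathLift a) σ t x‖ ≤ B) {D : ℝ}
    (hD : ∀ t ∈ Icc 0 T, ∀ σ, |𝒯.divE σ t| ≤ D) {t : ℝ} (ht : t ∈ Ioo 0 T) :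
    ∃ A' : 𝒯.Cf →L[ℝ] 𝒯.Cf,
      HasDerivAt (fun s => 𝒯.stiffF (fun σ => 𝒯.kap (S.pathLift a) σ s) s) A' t ∧
      ∀ c, inner ℝ (A' c) c ≤ B * inner ℝ (𝒯.stiffF (fun _ => refVol n) t c) c := by
  have htI := Ioo_subset_Icc_self ht
  have hnh := Icc_mem_nhds ht.1 ht.2
  let κ' : Fin 𝒯.M → ℝ := fun σ =>
    ∫ y in refSimplex n, 𝒯.matDeriv (S.pathLift a) t (𝒯.param σ t y)
  let κ : Fin 𝒯.M → ℝ := fun σ => 𝒯.kap (S.pathLift a) σ t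
  refine ⟨∑ σ, ((𝒯.wt σ t * κ σ) • 𝒯.stiffE' σ t +
    (𝒯.wt σ t * 𝒯.divE σ t * κ σ + 𝒯.wt σ t * κ' σ) • 𝒯.stiffE σ t), ?_, fun c => ?_⟩
  · unfold stiffF
    refine HasDerivAt.fun_sum fun σ _ => ?_
    have h1 := ((𝒯.hasDerivWithinAt_wt hn htI σ).hasDerivAt hnh).fun_mul
      (hasDerivAt_kap h hB hD σ ht).2
    exact HasDerivAt.fun_smul (F := 𝒯.Cf →L[ℝ] 𝒯.Cf) h1
      ((𝒯.hasDerivWithinAt_stiffE hT hn htI σ).hasDerivAt hnh)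
  · rw [stiffF_apply, sum_apply, sum_inner, Finset.mul_sum]
    refine Finset.sum_le_sum fun σ _ => ?_
    set r := inner ℝ (𝒯.stiffE σ t c) c with hr
    set r' := inner ℝ (𝒯.stiffE' σ t c) c with hr'
    have hint := (hasDerivAt_kap h hB hD σ ht).1
    have hintb := integrableOn_pathLift h htI σ
    -- The bound by B holds pointwise only for the combination that forms B_h, so the terms are
    -- gathered under one integral before it is applied.
    have h2 : κ' σ * r + κ σ * (𝒯.divE σ t * r + r') ≤ B * refVol n * r := by
      have h3 : κ' σ * r + κ σ * (𝒯.divE σ t * r + r') =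
          ∫ y in refSimplex n, (𝒯.matDeriv (S.pathLift a) t (𝒯.param σ t y) * r +
            S.pathLift a t (𝒯.param σ t y) * (𝒯.divE σ t * r + r')) := by
        rw [integral_add (hint.mul_const _) (hintb.mul_const _), integral_mul_const,
          integral_mul_const]
        rfl
      have h4 : B * refVol n * r = ∫ _ in refSimplex n, B * r := by
        rw [setIntegral_refSimplex_const]; ring
      rw [h3, h4]
      refine setIntegral_mono_on ((hint.mul_const _).add (hintb.mul_const _)) (integrable_const _)
        (measurableSet_refSimplex n) fun y hy => ?_
      have hE := 𝒯.param_mem_E σ t hy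
      have h5 := (abs_le.1 (abs_inner_Bh_le htI σ hE (hB t htI σ _ hE) c)).2
      calc _ = (𝒯.matDeriv (S.pathLift a) t (𝒯.param σ t y) +
            S.pathLift a t (𝒯.param σ t y) * 𝒯.divE σ t) * r +
            S.pathLift a t (𝒯.param σ t y) * r' := by ring
        _ ≤ _ := h5
    have hw := (𝒯.wt_pos htI σ).le
    simp only [add_apply, smul_apply, inner_add_left, inner_smul_left, RCLike.conj_to_real]
    calc _ = 𝒯.wt σ t * (κ' σ * r + κ σ * (𝒯.divE σ t * r + r')) := by ring
      _ ≤ 𝒯.wt σ t * (B * refVol n * r) := mul_le_mul_of_nonneg_left h2 hw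
      _ = _ := by ring

end EvolvingMesh
end ESFEM
end

noncomputable section

open MeasureTheory Set Filter Topology

namespace ESFEM

/-! ### Linear differential equations depending measurably on a parameter -/

section LinearODE

variable {F : Type*} [NormedAddCommGroup F] [NormedSpace ℝ F]

/-- The terms of the Picard series of `y' = L y`, `y 0 = y₀`. -/
def picard (L : ℝ → F →L[ℝ] F) (y₀ : F) : ℕ → ℝ → F
  | 0 => fun _ => y₀
  | k + 1 => fun t => ∫ s in (0 : ℝ)..t, L s (picard L y₀ k s)

/-- The solution of `y' = L y`, `y 0 = y₀`. -/
def linSol (L : ℝ → F →L[ℝ] F) (y₀ : F) (t : ℝ) : F := ∑' k, picard L y₀ k t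

variable {L : ℝ → F →L[ℝ] F} (y₀ : F) {K : ℝ}

theorem continuous_picard (hL : Continuous L) (k : ℕ) : Continuous (picard L y₀ k) := by
  induction k with
  | zero => exact continuous_const
  | succ k ih =>
    exact intervalIntegral.continuous_primitive
      (fun a b => (hL.clm_apply ih).intervalIntegrable a b) 0

/-- Each iterated integral gains a factor K |t| / (k + 1), which makes the series exponential. -/
theorem norm_picard_le (hK : ∀ t, ‖L t‖ ≤ K) (k : ℕ) (t : ℝ) :
    ‖picard L y₀ k t‖ ≤ ‖y₀‖ * ((K * |t|) ^ k / k.factorial) := by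
  have hK0 : 0 ≤ K := (norm_nonneg _).trans (hK 0)
  induction k generalizing t with
  | zero => simp [picard]
  | succ k ih =>
    have h1 : ∀ s, ‖L s (picard L y₀ k s)‖ ≤ K * ‖y₀‖ * K ^ k / k.factorial * |s - 0| ^ k := by
      intro s
      refine ((L s).le_opNorm _).trans ((mul_le_mul (hK s) (ih s) (norm_nonneg _) hK0).trans_eq ?_)
      rw [sub_zero, mul_pow]; ring
    calc ‖picard L y₀ (k + 1) t‖ ≤ ∫ s in uIoc 0 t, ‖L s (picard L y₀ k s)‖ :=
          intervalIntegral.norm_integral_le_integral_norm_uIoc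
      _ ≤ ∫ s in uIoc 0 t, K * ‖y₀‖ * K ^ k / k.factorial * |s - 0| ^ k := by
          refine integral_mono_of_nonneg (ae_of_all _ fun s => norm_nonneg _) ?_ (ae_of_all _ h1)
          have hc : Continuous fun s : ℝ => K * ‖y₀‖ * K ^ k / k.factorial * |s - 0| ^ k := by
            fun_prop
          exact (intervalIntegrable_iff.1 (hc.intervalIntegrable 0 t))
      _ = ‖y₀‖ * ((K * |t|) ^ (k + 1) / (k + 1).factorial) := by
          rw [integral_const_mul, integral_pow_abs_sub_uIoc, Nat.factorial_succ, sub_zero]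
          push_cast
          field_simp
          ring

theorem summable_norm_picard (hK : ∀ t, ‖L t‖ ≤ K) (t : ℝ) :
    Summable fun k => ‖picard L y₀ k t‖ :=
  .of_nonneg_of_le (fun _ => norm_nonneg _) (fun k => norm_picard_le y₀ hK k t)
    ((Real.summable_pow_div_factorial _).mul_left _)

theorem norm_linSol_le (hK : ∀ t, ‖L t‖ ≤ K) (t : ℝ) :
    ‖linSol L y₀ t‖ ≤ ‖y₀‖ * Real.exp (K * |t|) := by
  refine tsum_of_norm_bounded ?_ (fun k => norm_picard_le y₀ hK k t)
  have := NormedSpace.expSeries_div_hasSum_exp (K * |t|)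
  rw [← Real.exp_eq_exp_ℝ] at this
  exact this.mul_left _

theorem linSol_zero : linSol L y₀ 0 = y₀ := by
  rw [linSol, tsum_eq_single 0]
  · rfl
  · rintro (_ | k) hk
    · exact absurd rfl hk
    · simp [picard]

theorem hasDerivAt_linSol [CompleteSpace F] (hL : Continuous L) (hK : ∀ t, ‖L t‖ ≤ K) (t : ℝ) :
    HasDerivAt (linSol L y₀) (L t (linSol L y₀ t)) t := by
  have hK0 : 0 ≤ K := (norm_nonneg _).trans (hK 0)
  -- On (-R, R) the derivatives have a summable majorant independent of the point, so the series may
  -- be differentiated termwise at t.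
  set R := |t| + 1
  have htR : t ∈ Ioo (-R) R := abs_lt.1 (lt_add_one _)
  let g' : ℕ → ℝ → F := fun k s => match k with
    | 0 => 0
    | k + 1 => L s (picard L y₀ k s)
  let u : ℕ → ℝ := fun k => match k with
    | 0 => 0
    | k + 1 => K * (‖y₀‖ * ((K * R) ^ k / k.factorial))
  have hu : Summable u := by
    rw [← summable_nat_add_iff 1]
    exact ((Real.summable_pow_div_factorial _).mul_left _).mul_left _
  have h := hasDerivAt_tsum_of_isPreconnected (g := picard L y₀) (g' := g') (u := u)
    (t := Ioo (-R) R) (y₀ := t) (y := t) hu isOpen_Ioo isPreconnected_Ioo ?_ ?_ htR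
    (summable_norm_picard y₀ hK t).of_norm htR
  · have e : ∑' k, g' k t = L t (linSol L y₀ t) := by
      rw [linSol, (L t).map_tsum (summable_norm_picard y₀ hK t).of_norm, tsum_eq_zero_add']
      · simp [g']
      · exact (L t).summable (summable_norm_picard y₀ hK t).of_norm
    rw [← e]
    exact h
  · rintro (_ | k) s -
    · exact hasDerivAt_const _ _
    · exact intervalIntegral.integral_hasDerivAt_right
        ((hL.clm_apply (continuous_picard y₀ hL k)).intervalIntegrable _ _)
        (hL.clm_apply (continuous_picard y₀ hL k)).aestronglyMeasurable.stronglyMeasurableAtFilter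
        (hL.clm_apply (continuous_picard y₀ hL k)).continuousAt
  · rintro (_ | k) s hs
    · simp [g', u]
    · refine ((L s).le_opNorm _).trans (mul_le_mul (hK s) ((norm_picard_le y₀ hK k s).trans ?_)
        (norm_nonneg _) hK0)
      have := abs_le.2 ⟨hs.1.le, hs.2.le⟩
      gcongr

/-- Continuity in time and measurability in ω give joint measurability, so parameter integrals stay
measurable. This is the reason for writing the solution as a Picard series. -/
theorem measurable_picard {Ω : Type*} [MeasurableSpace Ω] [FiniteDimensional ℝ F]
    [MeasurableSpace F] [BorelSpace F]
    {L : Ω → ℝ → F →L[ℝ] F} {y₀ : Ω → F} (hL : ∀ ω, Continuous (L ω))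
    (hLm : ∀ t, Measurable fun ω => L ω t) (hy : Measurable y₀) (k : ℕ) (t : ℝ) :
    Measurable fun ω => picard (L ω) (y₀ ω) k t := by
  have : CompleteSpace F := FiniteDimensional.complete ℝ F
  have : SecondCountableTopology F := (secondCountable_of_proper : SecondCountableTopology F)
  induction k generalizing t with
  | zero => exact hy
  | succ k ih =>
    have h1 : Measurable (Function.uncurry fun t ω => L ω t) :=
      measurable_uncurry_of_continuous_of_measurable hL hLm
    have h2 : Measurable (Function.uncurry fun t ω => picard (L ω) (y₀ ω) k t) :=
      measurable_uncurry_of_continuous_of_measurable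
        (fun ω => continuous_picard (y₀ ω) (hL ω) k) ih
    have h3 : Measurable fun q : Ω × ℝ => L q.1 q.2 (picard (L q.1) (y₀ q.1) k q.2) :=
      ContinuousLinearMap.measurable_apply₂.comp
        ((h1.comp measurable_swap).prodMk (h2.comp measurable_swap))
    have h4 : ∀ s : Set ℝ, Measurable fun ω => ∫ r in s, L ω r (picard (L ω) (y₀ ω) k r) :=
      fun s => (h3.stronglyMeasurable.integral_prod_right (ν := volume.restrict s)).measurable
    exact (h4 _).sub (h4 _)

theorem measurable_linSol {Ω : Type*} [MeasurableSpace Ω] [FiniteDimensional ℝ F]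
    [MeasurableSpace F] [BorelSpace F]
    {L : Ω → ℝ → F →L[ℝ] F} {y₀ : Ω → F} (hL : ∀ ω, Continuous (L ω)) (hK : ∀ ω t, ‖L ω t‖ ≤ K)
    (hLm : ∀ t, Measurable fun ω => L ω t) (hy : Measurable y₀) (t : ℝ) :
    Measurable fun ω => linSol (L ω) (y₀ ω) t := by
  have : CompleteSpace F := FiniteDimensional.complete ℝ F
  have : SecondCountableTopology F := (secondCountable_of_proper : SecondCountableTopology F)
  refine measurable_of_tendsto_metrizable
    (f := fun N ω => ∑ k ∈ Finset.range N, picard (L ω) (y₀ ω) k t)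
    (fun N => Finset.measurable_fun_sum _ fun k _ => measurable_picard hL hLm hy k t) ?_
  rw [tendsto_pi_nhds]
  intro ω
  exact (summable_norm_picard (y₀ ω) (hK ω) t).of_norm.hasSum.tendsto_sum_nat

end LinearODE

section Solution

variable {E : Type*} [NormedAddCommGroup E] [InnerProductSpace ℝ E] [FiniteDimensional ℝ E]
  {T : ℝ} {M G : ℝ → E →L[ℝ] E}

theorem isInvertible_of_posDef {A : E →L[ℝ] E} (hA : ∀ c, c ≠ 0 → 0 < inner ℝ (A c) c) :
    A.IsInvertible := by
  have hinj : Function.Injective (A : E →ₗ[ℝ] E) := by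
    rw [← LinearMap.ker_eq_bot, LinearMap.ker_eq_bot']
    intro c hc
    by_contra hne
    have h := hA c hne
    rw [show A c = 0 from hc, inner_zero_left] at h
    exact lt_irrefl _ h
  exact ⟨(LinearEquiv.ofInjectiveEndo _ hinj).toContinuousLinearEquiv, by ext; rfl⟩

theorem continuousOn_inverse (hM : ContinuousOn M (Icc 0 T))
    (hpos : ∀ t ∈ Icc 0 T, ∀ c, c ≠ 0 → 0 < inner ℝ (M t c) c) :
    ContinuousOn (fun t => (M t).inverse) (Icc 0 T) := fun t ht =>
  ((isInvertible_of_posDef (hpos t ht)).contDiffAt_map_inverse (n := 0)).continuousAt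
    |>.comp_continuousWithinAt (hM t ht)

/-- Inverting M gives c' = -M⁻¹ G c with a coefficient bounded on [0,T]; Gronwall's inequality with
zero data concludes. -/
theorem eq_zero_of_linear_ode (hM : ContinuousOn M (Icc 0 T)) (hG : ContinuousOn G (Icc 0 T))
    (hpos : ∀ t ∈ Icc 0 T, ∀ c, c ≠ 0 → 0 < inner ℝ (M t c) c)
    {c c' : ℝ → E} (hc : ∀ t ∈ Icc 0 T, HasDerivWithinAt c (c' t) (Icc 0 T) t)
    (heq : ∀ t ∈ Icc 0 T, M t (c' t) + G t (c t) = 0) (h0 : c 0 = 0) :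
    ∀ t ∈ Icc 0 T, c t = 0 := by
  obtain ⟨K, hK⟩ := isCompact_Icc.exists_bound_of_continuousOn
    ((continuousOn_inverse hM hpos).clm_comp hG)
  intro t ht
  have h := norm_le_gronwallBound_of_norm_deriv_right_le (f := c) (f' := c') (δ := 0) (K := K)
    (ε := 0) (a := 0) (b := T) (fun s hs => (hc s hs).continuousWithinAt)
    (fun s hs => (hc s ⟨hs.1, hs.2.le⟩).mono_of_mem_nhdsWithin (Icc_mem_nhdsGE_of_mem hs))
    (by simp [h0])
    (fun s hs => ?_) t ht
  · simpa [gronwallBound_ε0] using h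
  · have hs' : s ∈ Icc 0 T := ⟨hs.1, hs.2.le⟩
    have e : c' s = -((M s).inverse.comp (G s)) (c s) := by
      have h1 : M s (c' s) = -G s (c s) := eq_neg_of_add_eq_zero_left (heq s hs')
      have h2 := congrArg (M s).inverse h1
      rw [(isInvertible_of_posDef (hpos s hs')).inverse_apply_self, map_neg] at h2
      exact h2
    rw [e, norm_neg, add_zero]
    exact (ContinuousLinearMap.le_opNorm _ _).trans (by gcongr; exact hK s hs')

/-- The bound is linear in the initial value with one constant for all ω, which carries square
integrability from the data to the solution. -/
theorem exists_measurable_solution [MeasurableSpace E] [BorelSpace E] {Ω : Type*}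
    [MeasurableSpace Ω] (hT : 0 ≤ T)
    (hM : ContinuousOn M (Icc 0 T)) (hG : ContinuousOn G (Icc 0 T))
    (hpos : ∀ t ∈ Icc 0 T, ∀ c, c ≠ 0 → 0 < inner ℝ (M t c) c)
    {A : Ω → ℝ → E →L[ℝ] E} {K : ℝ} (hA : ∀ ω, ContinuousOn (A ω) (Icc 0 T))
    (hAm : ∀ t ∈ Icc 0 T, Measurable fun ω => A ω t) (hAK : ∀ ω, ∀ t ∈ Icc 0 T, ‖A ω t‖ ≤ K)
    {c₀ : Ω → E} (hc₀ : Measurable c₀) :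
    ∃ (c c' : Ω → ℝ → E) (C : ℝ), (∀ ω, c ω 0 = c₀ ω) ∧
      (∀ ω t, HasDerivAt (c ω) (c' ω t) t) ∧ (∀ ω, Continuous (c' ω)) ∧
      (∀ ω, ∀ t ∈ Icc 0 T, M t (c' ω t) + G t (c ω t) + A ω t (c ω t) = 0) ∧
      (∀ t, Measurable fun ω => c ω t) ∧ (∀ t, Measurable fun ω => c' ω t) ∧
      ∀ ω, ∀ t ∈ Icc 0 T, ‖c ω t‖ ≤ C * ‖c₀ ω‖ ∧ ‖c' ω t‖ ≤ C * ‖c₀ ω‖ := by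
  have : CompleteSpace E := FiniteDimensional.complete ℝ E
  have hN := continuousOn_inverse hM hpos
  obtain ⟨K₁, hK₁⟩ := isCompact_Icc.exists_bound_of_continuousOn hN
  obtain ⟨K₂, hK₂⟩ := isCompact_Icc.exists_bound_of_continuousOn hG
  -- Freezing the coefficients outside [0,T] makes them continuous and bounded on the whole line, as
  -- the Picard series requires.
  let π : ℝ → ℝ := fun t => projIcc 0 T hT t
  have hπ : ∀ t, π t ∈ Icc 0 T := fun t => (projIcc 0 T hT t).2
  have hπc : Continuous π := continuous_subtype_val.comp continuous_projIcc
  have hcl : ∀ {f : ℝ → E →L[ℝ] E}, ContinuousOn f (Icc 0 T) → Continuous fun t => f (π t) :=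
    fun hf => hf.comp_continuous hπc hπ
  let L : Ω → ℝ → E →L[ℝ] E := fun ω t =>
    -((M (π t)).inverse.comp (G (π t) + A ω (π t)))
  have hL : ∀ ω, Continuous (L ω) := fun ω =>
    ((hcl hN).clm_comp ((hcl hG).add (hcl (hA ω)))).neg
  have hLK : ∀ ω t, ‖L ω t‖ ≤ K₁ * (K₂ + K) := by
    intro ω t
    rw [norm_neg]
    exact (ContinuousLinearMap.opNorm_comp_le _ _).trans (mul_le_mul (hK₁ _ (hπ t))
      ((norm_add_le _ _).trans (add_le_add (hK₂ _ (hπ t)) (hAK ω _ (hπ t)))) (norm_nonneg _)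
      ((norm_nonneg _).trans (hK₁ _ (hπ t))))
  have hLm : ∀ t, Measurable fun ω => L ω t := by
    intro t
    have hcont : Continuous fun B : E →L[ℝ] E => -((M (π t)).inverse.comp (G (π t) + B)) :=
      (continuous_const.clm_comp (continuous_const.add continuous_id)).neg
    exact hcont.measurable.comp (hAm _ (hπ t))
  let c : Ω → ℝ → E := fun ω t => linSol (L ω) (c₀ ω) t
  have hd : ∀ ω t, HasDerivAt (c ω) (L ω t (c ω t)) t := fun ω t =>
    hasDerivAt_linSol (c₀ ω) (hL ω) (hLK ω) t
  have hcm : ∀ t, Measurable fun ω => c ω t := fun t => measurable_linSol hL hLK hLm hc₀ t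
  set Q := K₁ * (K₂ + K)
  have hcb : ∀ ω, ∀ t ∈ Icc 0 T, ‖c ω t‖ ≤ Real.exp (|Q| * T) * ‖c₀ ω‖ := by
    intro ω t ht
    refine (norm_linSol_le (c₀ ω) (hLK ω) t).trans ?_
    rw [mul_comm, abs_of_nonneg ht.1]
    have := ht.1
    have h2 := ht.2
    gcongr
    exact le_abs_self _
  -- The exponential bounds c; since c' = L c with ‖L‖ ≤ |Q|, the factor max(1, |Q|) covers both
  -- bounds.
  refine ⟨c, fun ω t => L ω t (c ω t), max 1 |Q| * Real.exp (|Q| * T), fun ω => linSol_zero _, hd,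
    fun ω => (hL ω).clm_apply (continuous_iff_continuousAt.2 fun t => (hd ω t).continuousAt), ?_,
    hcm,
    fun t => ContinuousLinearMap.measurable_apply₂.comp ((hLm t).prodMk (hcm t)), ?_⟩
  · intro ω t ht
    have e : π t = t := by simp [π, projIcc_of_mem hT ht]
    simp only [L, e, neg_apply, map_neg, ContinuousLinearMap.comp_apply]
    rw [(isInvertible_of_posDef (hpos t ht)).self_apply_inverse, add_apply]
    abel
  · intro ω t ht
    constructor
    · refine (hcb ω t ht).trans ?_
      rw [mul_assoc]
      exact le_mul_of_one_le_left (by positivity) (le_max_left _ _)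
    · refine ((L ω t).le_opNorm _).trans ?_
      rw [mul_assoc]
      exact mul_le_mul ((hLK ω t).trans ((le_abs_self _).trans (le_max_right _ _))) (hcb ω t ht)
        (norm_nonneg _) (by positivity)

end Solution

end ESFEM

end

noncomputable section

open MeasureTheory Set Filter Topology

namespace ESFEM

/-! ### Energy estimates -/

theorem le_apply_zero_of_deriv_nonpos {T : ℝ} {f f' : ℝ → ℝ} (hf : ContinuousOn f (Icc 0 T))
    (hd : ∀ t ∈ Ioo 0 T, HasDerivAt f (f' t) t) (hf' : ∀ t ∈ Ioo 0 T, f' t ≤ 0) {t : ℝ}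
    (ht : t ∈ Icc 0 T) : f t ≤ f 0 := by
  refine antitoneOn_of_deriv_nonpos (convex_Icc 0 T) hf ?_ ?_ (left_mem_Icc.2 (ht.1.trans ht.2)) ht
    ht.1
  · rw [interior_Icc]
    exact fun s hs => (hd s hs).differentiableAt.differentiableWithinAt
  · rw [interior_Icc]
    exact fun s hs => by rw [(hd s hs).deriv]; exact hf' s hs

theorem hasDerivAt_primitive {T : ℝ} {g : ℝ → ℝ} (hg : ContinuousOn g (Icc 0 T)) {t : ℝ}
    (ht : t ∈ Ioo 0 T) : HasDerivAt (fun s => ∫ r in (0 : ℝ)..s, g r) (g t) t := by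
  have hi : ContinuousOn g (uIcc 0 t) := by
    rw [uIcc_of_le ht.1.le]
    exact hg.mono (Icc_subset_Icc_right ht.2.le)
  exact intervalIntegral.integral_hasDerivAt_right hi.intervalIntegrable
    ((hg.mono Ioo_subset_Icc_self).stronglyMeasurableAtFilter isOpen_Ioo t ht)
    (hg.continuousAt (Icc_mem_nhds ht.1 ht.2))

theorem continuousOn_primitive_Icc {T : ℝ} (hT : 0 ≤ T) {g : ℝ → ℝ}
    (hg : ContinuousOn g (Icc 0 T)) : ContinuousOn (fun s => ∫ r in (0 : ℝ)..s, g r) (Icc 0 T) := by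
  have h := intervalIntegral.continuousOn_primitive_interval (f := g) (a := 0) (b := T)
    (μ := volume)
  rw [uIcc_of_le hT] at h
  exact h hg.integrableOn_Icc

theorem apply_eq_add_integral {T : ℝ} {f f' : ℝ → ℝ}
    (hd : ∀ t ∈ Icc 0 T, HasDerivWithinAt f (f' t) (Icc 0 T) t)
    (hc : ContinuousOn f' (Icc 0 T)) {s : ℝ} (hs : s ∈ Icc 0 T) :
    f s = f 0 + ∫ r in (0 : ℝ)..s, f' r := by
  have hsub : Icc 0 s ⊆ Icc 0 T := Icc_subset_Icc_right hs.2
  rw [intervalIntegral.integral_eq_sub_of_hasDeriv_right_of_le hs.1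
    (f := f) (fun r hr => ((hd r (hsub hr)).continuousWithinAt).mono hsub)
    (fun r hr => (hd r (hsub ⟨hr.1.le, hr.2.le⟩)).mono_of_mem_nhdsWithin
      (Icc_mem_nhdsGT_of_mem ⟨hr.1.le, hr.2.trans_le hs.2⟩))
    (by
      apply ContinuousOn.intervalIntegrable
      rw [uIcc_of_le hs.1]
      exact hc.mono hsub)]
  ring

section Energy

variable {E : Type*} [NormedAddCommGroup E] [InnerProductSpace ℝ E]
  {T : ℝ} {M G K A : ℝ → E →L[ℝ] E} {c c' : ℝ → E} {αmin D : ℝ}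

theorem continuousOn_form {c d : ℝ → E} (hA : ContinuousOn A (Icc 0 T))
    (hc : ContinuousOn c (Icc 0 T)) (hd : ContinuousOn d (Icc 0 T)) :
    ContinuousOn (fun t => inner ℝ (A t (c t)) (d t)) (Icc 0 T) :=
  (hA.clm_apply hc).inner hd

/-- Testing with c and using M' = G gives d/dt M(c,c) = -G(c,c) - 2A(c,c) ≤ D M(c,c) - 2 αmin
K(c,c). The weight e^{-|D|t} absorbs the first term. -/
theorem energy_estimate (hT : 0 ≤ T) (hα : 0 < αmin)
    (hM : ∀ t ∈ Icc 0 T, HasDerivWithinAt M (G t) (Icc 0 T) t)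
    (hMs : ∀ t c d, inner ℝ (M t c) d = inner ℝ (M t d) c)
    (hM0 : ∀ t c, 0 ≤ inner ℝ (M t c) c)
    (hK : ContinuousOn K (Icc 0 T)) (hK0 : ∀ t ∈ Icc 0 T, ∀ c, 0 ≤ inner ℝ (K t c) c)
    (hAK : ∀ t ∈ Icc 0 T, ∀ c, αmin * inner ℝ (K t c) c ≤ inner ℝ (A t c) c)
    (hG : ∀ t ∈ Icc 0 T, ∀ c, |inner ℝ (G t c) c| ≤ D * inner ℝ (M t c) c)
    (hc : ∀ t ∈ Icc 0 T, HasDerivWithinAt c (c' t) (Icc 0 T) t)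
    (heq : ∀ t ∈ Icc 0 T, M t (c' t) + G t (c t) + A t (c t) = 0) :
    (∀ t ∈ Icc 0 T, inner ℝ (M t (c t)) (c t) ≤ Real.exp (|D| * T) * inner ℝ (M 0 (c 0)) (c 0)) ∧
    ∫ t in (0 : ℝ)..T, inner ℝ (K t (c t)) (c t) ≤
      Real.exp (|D| * T) / (2 * αmin) * inner ℝ (M 0 (c 0)) (c 0) := by
  have hcc : ContinuousOn c (Icc 0 T) := fun t ht => (hc t ht).continuousWithinAt
  have hMc : ContinuousOn M (Icc 0 T) := fun t ht => (hM t ht).continuousWithinAt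
  have hk := continuousOn_form hK hcc hcc
  have hm := continuousOn_form hMc hcc hcc
  -- A nonincreasing functional containing both quantities to be estimated. The integral carries
  -- e^{-|D|T}, a lower bound for the weight on [0,T].
  have main := fun t ht => le_apply_zero_of_deriv_nonpos (T := T) (t := t)
    (f := fun t => Real.exp (-|D| * t) * inner ℝ (M t (c t)) (c t) +
      2 * αmin * Real.exp (-|D| * T) * ∫ s in (0 : ℝ)..t, inner ℝ (K s (c s)) (c s))
    (f' := fun t => (Real.exp (-|D| * t) * (-|D| * 1)) * inner ℝ (M t (c t)) (c t) +
      Real.exp (-|D| * t) * (inner ℝ (M t (c t)) (c' t) + inner ℝ (G t (c t) + M t (c' t)) (c t)) +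
      2 * αmin * Real.exp (-|D| * T) * inner ℝ (K t (c t)) (c t))
    ((ContinuousOn.mul (by fun_prop) hm).add
      (continuousOn_const.mul (continuousOn_primitive_Icc hT hk)))
    (fun t ht => by
      have hn : Icc 0 T ∈ 𝓝 t := Icc_mem_nhds ht.1 ht.2
      have ht' := Ioo_subset_Icc_self ht
      exact (((((hasDerivAt_id t).const_mul (-|D|)).exp).mul
        ((((hM t ht').hasDerivAt hn).clm_apply ((hc t ht').hasDerivAt hn)).inner ℝ
          ((hc t ht').hasDerivAt hn))).add ((hasDerivAt_primitive hk ht).const_mul _)))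
    (fun t ht => by
      have ht' := Ioo_subset_Icc_self ht
      have h1 : inner ℝ (M t (c' t)) (c t) =
          -inner ℝ (G t (c t)) (c t) - inner ℝ (A t (c t)) (c t) := by
        have : M t (c' t) = -G t (c t) - A t (c t) := by
          rw [← sub_eq_zero, ← heq t ht']; abel
        rw [this, inner_sub_left, inner_neg_left]
      have h2 := neg_le_of_abs_le (hG t ht' (c t))
      have h3 := hAK t ht' (c t)
      have h4 := hM0 t (c t)
      have h5 := hK0 t ht' (c t)
      have h6 : Real.exp (-|D| * T) ≤ Real.exp (-|D| * t) := by
        apply Real.exp_le_exp.2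
        nlinarith [ht'.2, abs_nonneg D]
      have h7 := le_abs_self D
      rw [inner_add_left, hMs t (c t) (c' t), h1]
      have e1 := Real.exp_pos (-|D| * t)
      have h8 : D * inner ℝ (M t (c t)) (c t) ≤ |D| * inner ℝ (M t (c t)) (c t) := by gcongr
      have h9 : 2 * αmin * Real.exp (-|D| * T) * inner ℝ (K t (c t)) (c t) ≤
          2 * αmin * Real.exp (-|D| * t) * inner ℝ (K t (c t)) (c t) := by gcongr
      have h10 : 0 ≤ Real.exp (-|D| * t) * (|D| * inner ℝ (M t (c t)) (c t) +
          2 * inner ℝ (A t (c t)) (c t) + inner ℝ (G t (c t)) (c t)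
          - 2 * (αmin * inner ℝ (K t (c t)) (c t))) := mul_nonneg e1.le (by linarith)
      nlinarith [h9, h10]) ht
  have h0 : ∀ t ∈ Icc 0 T, 0 ≤ ∫ s in (0 : ℝ)..t, inner ℝ (K s (c s)) (c s) := fun t ht =>
    intervalIntegral.integral_nonneg ht.1 fun s hs => hK0 s ⟨hs.1, hs.2.trans ht.2⟩ _
  simp only [mul_zero, Real.exp_zero, one_mul, intervalIntegral.integral_same, add_zero] at main
  constructor
  · intro t ht
    have h1 := main t ht
    have h2 : 0 ≤ 2 * αmin * Real.exp (-|D| * T) * ∫ s in (0 : ℝ)..t, inner ℝ (K s (c s)) (c s) :=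
      mul_nonneg (by positivity) (h0 t ht)
    have h3 : Real.exp (-|D| * T) ≤ Real.exp (-|D| * t) := by
      apply Real.exp_le_exp.2
      nlinarith [ht.2, abs_nonneg D]
    have h4 : Real.exp (-|D| * T) * inner ℝ (M t (c t)) (c t) ≤ inner ℝ (M 0 (c 0)) (c 0) :=
      (mul_le_mul_of_nonneg_right h3 (hM0 t _)).trans (by linarith)
    have h5 := mul_le_mul_of_nonneg_left h4 (Real.exp_pos (|D| * T)).le
    rwa [← mul_assoc, ← Real.exp_add, neg_mul, add_neg_cancel, Real.exp_zero, one_mul] at h5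
  · have h1 := main T (right_mem_Icc.2 hT)
    have h2 : 0 ≤ Real.exp (-|D| * T) * inner ℝ (M T (c T)) (c T) :=
      mul_nonneg (Real.exp_pos _).le (hM0 T _)
    rw [div_mul_eq_mul_div, le_div_iff₀ (by positivity)]
    have h5 := mul_le_mul_of_nonneg_left (show 2 * αmin * Real.exp (-|D| * T) *
      (∫ s in (0 : ℝ)..T, inner ℝ (K s (c s)) (c s)) ≤ _ by linarith) (Real.exp_pos (|D| * T)).le
    have e : Real.exp (|D| * T) * Real.exp (-|D| * T) = 1 := by
      rw [← Real.exp_add, neg_mul, add_neg_cancel, Real.exp_zero]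
    calc (∫ t in (0 : ℝ)..T, inner ℝ (K t (c t)) (c t)) * (2 * αmin)
        = (Real.exp (|D| * T) * Real.exp (-|D| * T)) * (2 * αmin *
          ∫ s in (0 : ℝ)..T, inner ℝ (K s (c s)) (c s)) := by rw [e]; ring
      _ ≤ _ := le_trans (le_of_eq (by ring)) h5

/-- Testing with c' and using symmetry, d/dt A(c,c) = A'(c,c) - 2M(c',c') - 2G(c,c'). Young's
inequality for the last term consumes only one of the two copies of M(c',c'). -/
theorem higher_energy_estimate {B : ℝ} (hT : 0 ≤ T)
    (hM : ContinuousOn M (Icc 0 T)) (hK : ContinuousOn K (Icc 0 T)) (hA : ContinuousOn A (Icc 0 T))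
    (hAs : ∀ t ∈ Icc 0 T, ∀ c d, inner ℝ (A t c) d = inner ℝ (A t d) c)
    (hA0 : ∀ t ∈ Icc 0 T, ∀ c, 0 ≤ inner ℝ (A t c) c)
    (hA' : ∀ t ∈ Ioo 0 T, ∃ A', HasDerivAt A A' t ∧ ∀ c, inner ℝ (A' c) c ≤ B * inner ℝ (K t c) c)
    (hG : ∀ t ∈ Icc 0 T, ∀ c d,
      2 * |inner ℝ (G t c) d| ≤ D ^ 2 * inner ℝ (M t c) c + inner ℝ (M t d) d)
    (hc : ∀ t ∈ Icc 0 T, HasDerivWithinAt c (c' t) (Icc 0 T) t) (hc' : ContinuousOn c' (Icc 0 T))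
    (heq : ∀ t ∈ Icc 0 T, M t (c' t) + G t (c t) + A t (c t) = 0) :
    ∫ t in (0 : ℝ)..T, inner ℝ (M t (c' t)) (c' t) ≤ inner ℝ (A 0 (c 0)) (c 0) +
      B * (∫ t in (0 : ℝ)..T, inner ℝ (K t (c t)) (c t)) +
      D ^ 2 * ∫ t in (0 : ℝ)..T, inner ℝ (M t (c t)) (c t) := by
  have hcc : ContinuousOn c (Icc 0 T) := fun t ht => (hc t ht).continuousWithinAt
  have hk := continuousOn_form hK hcc hcc
  have hm := continuousOn_form hM hcc hcc
  have hm' := continuousOn_form hM hc' hc'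
  choose! A' hAd hAB using hA'
  have hg : ContinuousOn (fun t => inner ℝ (M t (c' t)) (c' t) - B * inner ℝ (K t (c t)) (c t) -
      D ^ 2 * inner ℝ (M t (c t)) (c t)) (Icc 0 T) :=
    (hm'.sub (continuousOn_const.mul hk)).sub (continuousOn_const.mul hm)
  have main := le_apply_zero_of_deriv_nonpos (T := T) (t := T)
    (f := fun t => inner ℝ (A t (c t)) (c t) + ∫ s in (0 : ℝ)..t, (inner ℝ (M s (c' s)) (c' s) -
      B * inner ℝ (K s (c s)) (c s) - D ^ 2 * inner ℝ (M s (c s)) (c s)))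
    (f' := fun t => (inner ℝ (A t (c t)) (c' t) + inner ℝ (A' t (c t) + A t (c' t)) (c t)) +
      (inner ℝ (M t (c' t)) (c' t) - B * inner ℝ (K t (c t)) (c t) -
        D ^ 2 * inner ℝ (M t (c t)) (c t)))
    ((continuousOn_form hA hcc hcc).add (continuousOn_primitive_Icc hT hg))
    (fun t ht => by
      have hn : Icc 0 T ∈ 𝓝 t := Icc_mem_nhds ht.1 ht.2
      have ht' := Ioo_subset_Icc_self ht
      exact (((hAd t ht).clm_apply ((hc t ht').hasDerivAt hn)).inner ℝ
          ((hc t ht').hasDerivAt hn)).add (hasDerivAt_primitive hg ht))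
    (fun t ht => by
      have ht' := Ioo_subset_Icc_self ht
      have h1 : inner ℝ (A t (c t)) (c' t) =
          -inner ℝ (M t (c' t)) (c' t) - inner ℝ (G t (c t)) (c' t) := by
        have : A t (c t) = -M t (c' t) - G t (c t) := by
          rw [← sub_eq_zero, ← heq t ht']; abel
        rw [this, inner_sub_left, inner_neg_left]
      have h2 := hAB t ht (c t)
      have h3 := hG t ht' (c t) (c' t)
      have h4 := neg_le_abs (inner ℝ (G t (c t)) (c' t))
      rw [inner_add_left, hAs t ht' (c' t) (c t), h1]
      linarith) (right_mem_Icc.2 hT)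
  have hi : ∀ {f : ℝ → ℝ}, ContinuousOn f (Icc 0 T) → IntervalIntegrable f volume 0 T :=
    fun hf => ContinuousOn.intervalIntegrable (by rwa [uIcc_of_le hT])
  rw [intervalIntegral.integral_sub ((hi hm').sub ((hi hk).const_mul B)) ((hi hm).const_mul _),
    intervalIntegral.integral_sub (hi hm') ((hi hk).const_mul B),
    intervalIntegral.integral_const_mul, intervalIntegral.integral_const_mul,
    intervalIntegral.integral_same] at main
  have := hA0 T (right_mem_Icc.2 hT) (c T)
  linarith

end Energy

end ESFEM

end

noncomputable section

open MeasureTheory Set Filter Topology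

namespace ESFEM

/-! ### Random paths -/

section RandomPath

variable {Ω : Type*} [MeasurableSpace Ω] {T : ℝ}

theorem integral_Icc_eq_interval (hT : 0 ≤ T) {F : Type*} [NormedAddCommGroup F] [NormedSpace ℝ F]
    (f : ℝ → F) : ∫ t in Icc 0 T, f t = ∫ t in (0 : ℝ)..T, f t := by
  rw [intervalIntegral.integral_of_le hT, integral_Icc_eq_integral_Ioc]

theorem ae_prod_Icc (P : Measure Ω) :
    ∀ᵐ q ∂(P.prod (volume.restrict (Icc 0 T))), q.2 ∈ Icc 0 T := by
  have h := (Measure.quasiMeasurePreserving_snd (μ := P) (ν := volume.restrict (Icc 0 T))).ae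
    (ae_restrict_mem (measurableSet_Icc : MeasurableSet (Icc (0 : ℝ) T)))
  exact h

theorem measurable_clamp {F : Type*} [TopologicalSpace F] [TopologicalSpace.PseudoMetrizableSpace F]
    [MeasurableSpace F] [BorelSpace F] (hT : 0 ≤ T) {f : Ω → ℝ → F}
    (hc : ∀ ω, ContinuousOn (f ω) (Icc 0 T)) (hm : ∀ t ∈ Icc 0 T, Measurable fun ω => f ω t) :
    Measurable fun q : Ω × ℝ => f q.1 (projIcc 0 T hT q.2) := by
  have h : Measurable (Function.uncurry fun (t : ℝ) ω => f ω (projIcc 0 T hT t)) :=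
    measurable_uncurry_of_continuous_of_measurable
      (fun ω => (hc ω).comp_continuous (continuous_subtype_val.comp continuous_projIcc)
        fun t => (projIcc 0 T hT t).2) fun t => hm _ (projIcc 0 T hT t).2
  exact h.comp measurable_swap

theorem aemeasurable_prod {F : Type*} [TopologicalSpace F]
    [TopologicalSpace.PseudoMetrizableSpace F]
    [MeasurableSpace F] [BorelSpace F] (P : Measure Ω) (hT : 0 ≤ T) {f : Ω → ℝ → F}
    (hc : ∀ ω, ContinuousOn (f ω) (Icc 0 T)) (hm : ∀ t ∈ Icc 0 T, Measurable fun ω => f ω t) :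
    AEMeasurable (fun q : Ω × ℝ => f q.1 q.2) (P.prod (volume.restrict (Icc 0 T))) := by
  refine ⟨_, measurable_clamp hT hc hm, ?_⟩
  filter_upwards [ae_prod_Icc P] with q hq
  rw [projIcc_of_mem hT hq]

theorem measurable_integral_path {F : Type*} [NormedAddCommGroup F] [NormedSpace ℝ F]
    [FiniteDimensional ℝ F] [MeasurableSpace F] [BorelSpace F] (hT : 0 ≤ T) {f : Ω → ℝ → F}
    (hc : ∀ ω, ContinuousOn (f ω) (Icc 0 T)) (hm : ∀ t ∈ Icc 0 T, Measurable fun ω => f ω t)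
    {s : ℝ} (hs : s ∈ Icc 0 T) : Measurable fun ω => ∫ t in (0 : ℝ)..s, f ω t := by
  have : CompleteSpace F := FiniteDimensional.complete ℝ F
  have : SecondCountableTopology F := (secondCountable_of_proper : SecondCountableTopology F)
  have h := ((measurable_clamp hT hc hm).stronglyMeasurable.integral_prod_right'
    (ν := volume.restrict (Icc 0 s))).measurable
  convert h using 1
  funext ω
  rw [intervalIntegral.integral_of_le hs.1, ← integral_Icc_eq_integral_Ioc]
  refine setIntegral_congr_fun measurableSet_Icc fun t ht => ?_
  simp only [projIcc_of_mem hT ⟨ht.1, ht.2.trans hs.2⟩]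

theorem integrable_prod_of_paths {P : Measure Ω} [IsProbabilityMeasure P] (hT : 0 ≤ T)
    {f : Ω → ℝ → ℝ} (hc : ∀ ω, ContinuousOn (f ω) (Icc 0 T))
    (hm : ∀ t ∈ Icc 0 T, Measurable fun ω => f ω t) {g : Ω → ℝ} (hg : Integrable g P)
    (hfg : ∀ ω, ∫ t in (0 : ℝ)..T, |f ω t| ≤ g ω) :
    Integrable (fun q : Ω × ℝ => f q.1 q.2) (P.prod (volume.restrict (Icc 0 T))) := by
  have hae := (aemeasurable_prod P hT hc hm).aestronglyMeasurable
  rw [integrable_prod_iff hae]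
  refine ⟨ae_of_all _ fun ω => (hc ω).integrableOn_Icc, hg.mono hae.norm.integral_prod_right' ?_⟩
  refine ae_of_all _ fun ω => ?_
  simp only [Real.norm_eq_abs]
  rw [integral_Icc_eq_interval hT, abs_of_nonneg (intervalIntegral.integral_nonneg hT
    fun t _ => abs_nonneg _)]
  exact (hfg ω).trans (le_abs_self _)

/-- The expectation of paths of class `C^1` with integrable derivative is differentiable almost
everywhere. -/
theorem ae_hasDerivAt_integral {P : Measure Ω} [IsProbabilityMeasure P] (hT : 0 ≤ T)
    {f f' : Ω → ℝ → ℝ} (hd : ∀ ω, ∀ t ∈ Icc 0 T, HasDerivWithinAt (f ω) (f' ω t) (Icc 0 T) t)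
    (hc : ∀ ω, ContinuousOn (f' ω) (Icc 0 T)) (h0 : Integrable (fun ω => f ω 0) P)
    (hi : Integrable (fun q : Ω × ℝ => f' q.1 q.2) (P.prod (volume.restrict (Icc 0 T)))) :
    ∀ᵐ t ∂(volume.restrict (Icc 0 T)),
      HasDerivAt (fun s => ∫ ω, f ω s ∂P) (∫ ω, f' ω t ∂P) t := by
  set F' : ℝ → ℝ := fun t => ∫ ω, f' ω t ∂P
  have hF' : IntegrableOn F' (Icc 0 T) := hi.integral_prod_right
  have hF'i : IntervalIntegrable F' volume 0 T :=
    (intervalIntegrable_iff_integrableOn_Icc_of_le hT).2 hF'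
  -- By Fubini the expectation is a primitive of an integrable function of time, so Lebesgue's
  -- differentiation theorem gives the derivative almost everywhere.
  have key : ∀ s ∈ Icc 0 T, ∫ ω, f ω s ∂P = ∫ ω, f ω 0 ∂P + ∫ r in (0 : ℝ)..s, F' r := by
    intro s hs
    have hsub : Icc 0 s ⊆ Icc 0 T := Icc_subset_Icc_right hs.2
    have h1 : ∀ ω, f ω s = f ω 0 + ∫ r in (0 : ℝ)..s, f' ω r := fun ω =>
      apply_eq_add_integral (hd ω) (hc ω) hs
    have hi' : Integrable (fun q : Ω × ℝ => f' q.1 q.2) (P.prod (volume.restrict (Ioc 0 s))) :=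
      hi.mono_measure (Measure.prod_mono le_rfl (Measure.restrict_mono_set _
        (Ioc_subset_Icc_self.trans hsub)))
    simp_rw [h1]
    simp_rw [intervalIntegral.integral_of_le hs.1]
    rw [integral_add h0 hi'.integral_prod_left]
    congr 1
    exact integral_integral_swap hi'
  have h2 := hF'i.ae_hasDerivAt_integral
  rw [ae_restrict_iff' measurableSet_Icc]
  have hne : ∀ᵐ t : ℝ, t ≠ 0 ∧ t ≠ T := by
    have a1 : ∀ᵐ t : ℝ, t ≠ 0 := Measure.ae_ne _ _
    have a2 : ∀ᵐ t : ℝ, t ≠ T := Measure.ae_ne _ _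
    filter_upwards [a1, a2] with t h1 h2 using ⟨h1, h2⟩
  filter_upwards [h2, hne] with t ht hne htI
  have htO : t ∈ Ioo 0 T := ⟨lt_of_le_of_ne htI.1 (Ne.symm hne.1), lt_of_le_of_ne htI.2 hne.2⟩
  have h3 := (ht (by rwa [uIcc_of_le hT]) 0 (by simp [hT])).const_add
    (∫ ω, f ω 0 ∂P)
  refine h3.congr_of_eventuallyEq ?_
  filter_upwards [Icc_mem_nhds htO.1 htO.2] with s hs using key s hs

variable {E : Type*} [NormedAddCommGroup E] [InnerProductSpace ℝ E]

theorem sq_integral_norm_le (hT : 0 < T) {f : ℝ → E} (hf : ContinuousOn f (Icc 0 T)) :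
    (∫ t in (0 : ℝ)..T, ‖f t‖) ^ 2 ≤ T * ∫ t in (0 : ℝ)..T, ‖f t‖ ^ 2 := by
  have hi : ∀ {g : ℝ → ℝ}, ContinuousOn g (Icc 0 T) → IntervalIntegrable g volume 0 T :=
    fun hg => ContinuousOn.intervalIntegrable (by rwa [uIcc_of_le hT.le])
  have hi2 : IntervalIntegrable (fun t => ‖f t‖ ^ 2) volume 0 T := hi (hf.norm.pow 2)
  set I := ∫ t in (0 : ℝ)..T, ‖f t‖ with hI
  -- Cauchy–Schwarz by expanding the integral of (‖f‖ - I/T)², with I/T the mean of ‖f‖.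
  have h1 : 0 ≤ ∫ t in (0 : ℝ)..T, (‖f t‖ ^ 2 - 2 * (I / T) * ‖f t‖ + (I / T) ^ 2) :=
    intervalIntegral.integral_nonneg hT.le fun t _ => by nlinarith [sq_nonneg (‖f t‖ - I / T)]
  rw [intervalIntegral.integral_add (hi2.sub ((hi hf.norm).const_mul _)) (by simp),
    intervalIntegral.integral_sub hi2 ((hi hf.norm).const_mul _),
    intervalIntegral.integral_const_mul, intervalIntegral.integral_const, ← hI, sub_zero,
    smul_eq_mul] at h1
  have h2 := mul_nonneg hT.le h1
  have e : T * ((∫ t in (0 : ℝ)..T, ‖f t‖ ^ 2) - 2 * (I / T) * I + T * (I / T) ^ 2) =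
      T * (∫ t in (0 : ℝ)..T, ‖f t‖ ^ 2) - I ^ 2 := by
    field_simp; ring
  linarith

variable [FiniteDimensional ℝ E] [MeasurableSpace E] [BorelSpace E]

/-- Continuous random paths that are square integrable on `Ω × [0,T]`. -/
structure L2Path (P : Measure Ω) (T : ℝ) (f : Ω → ℝ → E) : Prop where
  cont : ∀ ω, ContinuousOn (f ω) (Icc 0 T)
  meas : ∀ t ∈ Icc 0 T, Measurable fun ω => f ω t
  sq : Integrable (fun q : Ω × ℝ => ‖f q.1 q.2‖ ^ 2) (P.prod (volume.restrict (Icc 0 T)))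

/-- Continuous random paths of operators that are uniformly bounded. -/
structure BddOp (T : ℝ) (A : Ω → ℝ → E →L[ℝ] E) : Prop where
  cont : ∀ ω, ContinuousOn (A ω) (Icc 0 T)
  meas : ∀ t ∈ Icc 0 T, Measurable fun ω => A ω t
  bdd : ∃ K, ∀ ω, ∀ t ∈ Icc 0 T, ‖A ω t‖ ≤ K

theorem BddOp.of_continuousOn {M : ℝ → E →L[ℝ] E} (hM : ContinuousOn M (Icc 0 T)) :
    BddOp T fun _ : Ω => M := by
  obtain ⟨K, hK⟩ := isCompact_Icc.exists_bound_of_continuousOn hM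
  exact ⟨fun _ => hM, fun t _ => measurable_const, K, fun _ => hK⟩

namespace L2Path

variable {P : Measure Ω} [IsProbabilityMeasure P] {f g : Ω → ℝ → E}

theorem aestronglyMeasurable (hT : 0 ≤ T) (hf : L2Path P T f) :
    AEStronglyMeasurable (fun q : Ω × ℝ => f q.1 q.2) (P.prod (volume.restrict (Icc 0 T))) := by
  have : SecondCountableTopology E :=
    have := FiniteDimensional.proper_real E
    secondCountable_of_proper
  exact (aemeasurable_prod P hT hf.cont hf.meas).aestronglyMeasurable

theorem add (hT : 0 ≤ T) (hf : L2Path P T f) (hg : L2Path P T g) :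
    L2Path P T fun ω t => f ω t + g ω t := by
  refine ⟨fun ω => (hf.cont ω).add (hg.cont ω), fun t ht => (hf.meas t ht).add (hg.meas t ht), ?_⟩
  refine ((hf.sq.add hg.sq).const_mul 2).mono'
    (((hf.aestronglyMeasurable hT).add (hg.aestronglyMeasurable hT)).norm.pow 2)
    (ae_of_all _ fun q => ?_)
  rw [Real.norm_of_nonneg (by positivity)]
  have h1 := norm_add_le (f q.1 q.2) (g q.1 q.2)
  have h2 := norm_nonneg (f q.1 q.2 + g q.1 q.2)
  simp only [Pi.add_apply]
  nlinarith [sq_nonneg (‖f q.1 q.2‖ - ‖g q.1 q.2‖), h1, h2]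

theorem congr (hf : L2Path P T f) (h : ∀ ω, ∀ t ∈ Icc 0 T, g ω t = f ω t) : L2Path P T g := by
  refine ⟨fun ω => (hf.cont ω).congr (h ω), fun t ht => by simpa only [h _ t ht] using hf.meas t ht,
    hf.sq.congr ?_⟩
  filter_upwards [ae_prod_Icc P] with q hq
  rw [h q.1 q.2 hq]

theorem const {φ : Ω → E} (hφ : Measurable φ) (hφ2 : Integrable (fun ω => ‖φ ω‖ ^ 2) P) :
    L2Path P T fun ω _ => φ ω :=
  ⟨fun _ => continuousOn_const, fun _ _ => hφ, hφ2.comp_fst _⟩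

theorem integrable_inner (hT : 0 ≤ T) (hf : L2Path P T f) (hg : L2Path P T g) :
    Integrable (fun q : Ω × ℝ => inner ℝ (f q.1 q.2) (g q.1 q.2))
      (P.prod (volume.restrict (Icc 0 T))) := by
  refine (hf.sq.add hg.sq).mono' ((hf.aestronglyMeasurable hT).inner (hg.aestronglyMeasurable hT))
    (ae_of_all _ fun q => ?_)
  refine (norm_inner_le_norm _ _).trans ?_
  simp only [Pi.add_apply]
  nlinarith [sq_nonneg (‖f q.1 q.2‖ - ‖g q.1 q.2‖), sq_nonneg ‖f q.1 q.2‖, sq_nonneg ‖g q.1 q.2‖]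

theorem ae_integrable_sq (hf : L2Path P T f) :
    ∀ᵐ t ∂(volume.restrict (Icc 0 T)), Integrable (fun ω => ‖f ω t‖ ^ 2) P :=
  hf.sq.prod_left_ae

end L2Path

theorem integrable_inner_of_sq {P : Measure Ω} {f g : Ω → E} (hf : Measurable f)
    (hg : AEStronglyMeasurable g P) (hf2 : Integrable (fun ω => ‖f ω‖ ^ 2) P)
    (hg2 : Integrable (fun ω => ‖g ω‖ ^ 2) P) : Integrable (fun ω => inner ℝ (f ω) (g ω)) P := by
  have : SecondCountableTopology E :=
    have := FiniteDimensional.proper_real E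
    secondCountable_of_proper
  refine (hf2.add hg2).mono' (hf.aestronglyMeasurable.inner hg) (ae_of_all _ fun ω => ?_)
  refine (norm_inner_le_norm _ _).trans ?_
  simp only [Pi.add_apply]
  nlinarith [sq_nonneg (‖f ω‖ - ‖g ω‖), sq_nonneg ‖f ω‖, sq_nonneg ‖g ω‖]

theorem BddOp.apply {P : Measure Ω} [IsProbabilityMeasure P] {A : Ω → ℝ → E →L[ℝ] E}
    {f : Ω → ℝ → E} (hT : 0 ≤ T) (hA : BddOp T A) (hf : L2Path P T f) :
    L2Path P T fun ω t => A ω t (f ω t) := by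
  have : SecondCountableTopology E :=
    have := FiniteDimensional.proper_real E
    secondCountable_of_proper
  obtain ⟨K, hK⟩ := hA.bdd
  have hc : ∀ ω, ContinuousOn (fun t => A ω t (f ω t)) (Icc 0 T) :=
    fun ω => (hA.cont ω).clm_apply (hf.cont ω)
  have hm : ∀ t ∈ Icc 0 T, Measurable fun ω => A ω t (f ω t) := fun t ht =>
    ContinuousLinearMap.measurable_apply₂.comp ((hA.meas t ht).prodMk (hf.meas t ht))
  refine ⟨hc, hm, (hf.sq.const_mul (K ^ 2)).mono'
    ((aemeasurable_prod P hT hc hm).aestronglyMeasurable.norm.pow 2) ?_⟩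
  filter_upwards [ae_prod_Icc P] with q hq
  rw [Real.norm_of_nonneg (by positivity), ← mul_pow]
  exact pow_le_pow_left₀ (norm_nonneg _) (((A q.1 q.2).le_opNorm _).trans
    (mul_le_mul_of_nonneg_right (hK q.1 q.2 hq) (norm_nonneg _))) 2

/-- A square integrable random path that is orthogonal to all random vectors, at almost every time,
vanishes. -/
theorem L2Path.eq_zero {P : Measure Ω} [IsProbabilityMeasure P] (hT : 0 < T) {R : Ω → ℝ → E}
    (hR : L2Path P T R)
    (h : ∀ φ : Ω → E, Measurable φ → Integrable (fun ω => ‖φ ω‖ ^ 2) P →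
      ∀ᵐ t ∂(volume.restrict (Icc 0 T)), ∫ ω, inner ℝ (R ω t) (φ ω) ∂P = 0) :
    ∀ᵐ ω ∂P, ∀ t ∈ Icc 0 T, R ω t = 0 := by
  have : SecondCountableTopology E :=
    have := FiniteDimensional.proper_real E
    secondCountable_of_proper
  have : CompleteSpace E := FiniteDimensional.complete ℝ E
  have hRi : ∀ ω, ∀ s ∈ Icc 0 T, ∀ r ∈ Icc 0 T, IntervalIntegrable (R ω) volume s r := by
    intro ω s hs r hr
    exact ContinuousOn.intervalIntegrable ((hR.cont ω).mono (uIcc_subset_Icc hs hr))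
  have h0T : (0 : ℝ) ∈ Icc 0 T := left_mem_Icc.2 hT.le
  -- The exceptional set of times depends on the test vector, so the vector must not depend on the
  -- time of testing. The choice φ = ∫₀ˢ R is fixed, and integrating the orthogonality over [0,s]
  -- yields E‖φ‖² = 0.
  have key : ∀ s ∈ Icc 0 T, ∀ᵐ ω ∂P, ∫ r in (0 : ℝ)..s, R ω r = 0 := by
    intro s hs
    set φ : Ω → E := fun ω => ∫ r in (0 : ℝ)..s, R ω r with hφ
    have hφm : Measurable φ := measurable_integral_path hT.le hR.cont hR.meas hs
    have hφ2 : Integrable (fun ω => ‖φ ω‖ ^ 2) P := by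
      have hg : Integrable (fun ω => T * ∫ t in Icc 0 T, ‖R ω t‖ ^ 2) P :=
        hR.sq.integral_prod_left.const_mul T
      refine hg.mono' (hφm.norm.pow_const 2).aestronglyMeasurable (ae_of_all _ fun ω => ?_)
      rw [Real.norm_of_nonneg (by positivity), integral_Icc_eq_interval hT.le]
      refine le_trans ?_ (sq_integral_norm_le hT (hR.cont ω))
      refine pow_le_pow_left₀ (norm_nonneg _)
        ((intervalIntegral.norm_integral_le_integral_norm hs.1).trans ?_) 2
      refine intervalIntegral.integral_mono_interval le_rfl hs.1 hs.2
        (ae_of_all _ fun _ => norm_nonneg _) (hRi ω 0 h0T T (right_mem_Icc.2 hT.le)).norm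
    have hz := h φ hφm hφ2
    have hi := (hR.integrable_inner hT.le (L2Path.const (T := T) hφm hφ2)).mono_measure
      (Measure.prod_mono (le_refl P) (Measure.restrict_mono_set volume
        (Ioc_subset_Icc_self.trans (Icc_subset_Icc_right hs.2) : Ioc 0 s ⊆ Icc 0 T)))
    have h1 : ∫ ω, ‖φ ω‖ ^ 2 ∂P = 0 := by
      have e : ∀ ω, ‖φ ω‖ ^ 2 = ∫ r in Ioc 0 s, inner ℝ (R ω r) (φ ω) := by
        intro ω
        rw [← real_inner_self_eq_norm_sq]
        conv_lhs => rw [hφ]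
        simp only []
        rw [intervalIntegral.integral_of_le hs.1, ← integral_inner
          ((intervalIntegrable_iff_integrableOn_Ioc_of_le hs.1).1 (hRi ω 0 h0T s hs))]
        simp only [hφ, intervalIntegral.integral_of_le hs.1]
        refine integral_congr_ae (ae_of_all _ fun r => real_inner_comm _ _)
      simp_rw [e]
      rw [integral_integral_swap hi]
      refine integral_eq_zero_of_ae ?_
      exact ae_mono (Measure.restrict_mono_set _
        (Ioc_subset_Icc_self.trans (Icc_subset_Icc_right hs.2))) hz
    rw [integral_eq_zero_iff_of_nonneg (fun ω => by positivity) hφ2] at h1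
    filter_upwards [h1] with ω hω
    simpa using hω
  -- Clamped rational times give one null set for countably many s; continuity of the primitive then
  -- covers all s, and differentiating it gives R = 0.
  have hall : ∀ᵐ ω ∂P, ∀ q : ℚ, ∫ r in (0 : ℝ)..(projIcc 0 T hT.le (q : ℝ) : ℝ), R ω r = 0 :=
    ae_all_iff.2 fun q => key _ (projIcc 0 T hT.le (q : ℝ)).2
  filter_upwards [hall] with ω hω
  have hcont : ContinuousOn (fun s => ∫ r in (0 : ℝ)..s, R ω r) (Icc 0 T) := by
    have := intervalIntegral.continuousOn_primitive_interval (f := R ω) (a := 0) (b := T)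
      (μ := volume)
    rw [uIcc_of_le hT.le] at this
    exact this (hR.cont ω).integrableOn_Icc
  have hz : ∀ s ∈ Icc 0 T, ∫ r in (0 : ℝ)..s, R ω r = 0 := by
    have h1 : (fun s : ℝ => ∫ r in (0 : ℝ)..(projIcc 0 T hT.le s : ℝ), R ω r) = fun _ => 0 := by
      refine Continuous.ext_on Rat.denseRange_cast (hcont.comp_continuous
        (continuous_subtype_val.comp continuous_projIcc) fun t => (projIcc 0 T hT.le t).2)
        continuous_const ?_
      rintro _ ⟨q, rfl⟩
      exact hω q
    intro s hs
    have := congrFun h1 s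
    simpa only [projIcc_of_mem hT.le hs] using this
  have hzero : ∀ t ∈ Ioo 0 T, R ω t = 0 := by
    intro t ht
    have h1 := intervalIntegral.integral_hasDerivAt_right
      (hRi ω 0 h0T t (Ioo_subset_Icc_self ht))
      (((hR.cont ω).mono Ioo_subset_Icc_self).stronglyMeasurableAtFilter isOpen_Ioo t ht)
      ((hR.cont ω).continuousAt (Icc_mem_nhds ht.1 ht.2))
    refine h1.unique ((hasDerivAt_const t (0 : E)).congr_of_eventuallyEq ?_)
    filter_upwards [Icc_mem_nhds ht.1 ht.2] with s hs using hz s hs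
  intro t ht
  have hcl : EqOn (R ω) (fun _ => 0) (closure (Ioo 0 T) ∩ Icc 0 T) := by
    refine EqOn.mono ?_ (EqOn.of_subset_closure (s := Ioo 0 T) (t := Icc 0 T) (f := R ω)
      (g := fun _ => 0) hzero (hR.cont ω) continuousOn_const Ioo_subset_Icc_self
      (closure_Ioo hT.ne).ge)
    exact inter_subset_right
  exact hcl ⟨by rw [closure_Ioo hT.ne]; exact ht, ht⟩

end RandomPath

end ESFEM

end

/-! ### Sobolev inequality in time, coercivity and measurable derivatives. -/

noncomputable section

open MeasureTheory Set Filter Topology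

namespace ESFEM

section Sobolev

variable {T : ℝ}

variable {E : Type*} [NormedAddCommGroup E] [InnerProductSpace ℝ E]

/-- For every s, ‖c t‖² exceeds ‖c s‖² by at most the integral of 2 |c · c'| ≤ ‖c‖² + ‖c'‖²;
averaging over s gives the constant 1/T + 1. -/
theorem sobolev_sq_le (hT : 0 < T) {c c' : ℝ → E}
    (hd : ∀ t ∈ Icc 0 T, HasDerivWithinAt c (c' t) (Icc 0 T) t) (hc' : ContinuousOn c' (Icc 0 T))
    {t : ℝ} (ht : t ∈ Icc 0 T) :
    ‖c t‖ ^ 2 ≤ (1 / T + 1) * ∫ s in (0 : ℝ)..T, (‖c s‖ ^ 2 + ‖c' s‖ ^ 2) := by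
  have hc : ContinuousOn c (Icc 0 T) := fun t ht => (hd t ht).continuousWithinAt
  have hi : ∀ {g : ℝ → ℝ}, ContinuousOn g (Icc 0 T) → ∀ s ∈ Icc 0 T, ∀ r ∈ Icc 0 T,
      IntervalIntegrable g volume s r := fun hg s hs r hr =>
    ContinuousOn.intervalIntegrable (hg.mono (uIcc_subset_Icc hs hr))
  have h0T : (0 : ℝ) ∈ Icc 0 T := left_mem_Icc.2 hT.le
  have hTT : T ∈ Icc 0 T := right_mem_Icc.2 hT.le
  have hw : ContinuousOn (fun s => ‖c s‖ ^ 2 + ‖c' s‖ ^ 2) (Icc 0 T) :=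
    (hc.norm.pow 2).add (hc'.norm.pow 2)
  have hn2 : ContinuousOn (fun s => ‖c s‖ ^ 2) (Icc 0 T) := hc.norm.pow 2
  set I := ∫ s in (0 : ℝ)..T, (‖c s‖ ^ 2 + ‖c' s‖ ^ 2)
  have hf' : ContinuousOn (fun s => 2 * inner ℝ (c s) (c' s)) (Icc 0 T) :=
    continuousOn_const.mul (hc.inner hc')
  have hf : ∀ s ∈ Icc 0 T, HasDerivWithinAt (fun s => ‖c s‖ ^ 2) (2 * inner ℝ (c s) (c' s))
      (Icc 0 T) s := fun s hs => (hd s hs).norm_sq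
  have key : ∀ s ∈ Icc 0 T, ‖c t‖ ^ 2 ≤ ‖c s‖ ^ 2 + I := by
    intro s hs
    have e1 := apply_eq_add_integral hf hf' hs
    have e2 := apply_eq_add_integral hf hf' ht
    have e3 := intervalIntegral.integral_interval_sub_left (hi hf' 0 h0T t ht) (hi hf' 0 h0T s hs)
    have h1 : ∫ r in s..t, 2 * inner ℝ (c r) (c' r) ≤ I := by
      refine (le_abs_self _).trans ?_
      refine (intervalIntegral.norm_integral_le_integral_norm_uIoc
        (f := fun r => 2 * inner ℝ (c r) (c' r))).trans ?_
      have hsub : uIoc s t ⊆ Icc 0 T := uIoc_subset_uIcc.trans (uIcc_subset_Icc hs ht)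
      simp only [I]
      rw [← integral_Icc_eq_interval hT.le]
      calc ∫ r in uIoc s t, ‖2 * inner ℝ (c r) (c' r)‖
          ≤ ∫ r in Icc 0 T, ‖2 * inner ℝ (c r) (c' r)‖ :=
            setIntegral_mono_set hf'.norm.integrableOn_Icc (ae_of_all _ fun _ => norm_nonneg _)
              hsub.eventuallyLE
        _ ≤ ∫ r in Icc 0 T, (‖c r‖ ^ 2 + ‖c' r‖ ^ 2) := by
            refine integral_mono hf'.norm.integrableOn_Icc hw.integrableOn_Icc fun r => ?_
            have := norm_inner_le_norm (𝕜 := ℝ) (c r) (c' r)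
            simp only [norm_mul, Real.norm_ofNat]
            nlinarith [sq_nonneg (‖c r‖ - ‖c' r‖)]
    linarith
  have h2 : ∫ _ in (0 : ℝ)..T, ‖c t‖ ^ 2 ≤ ∫ s in (0 : ℝ)..T, (‖c s‖ ^ 2 + I) :=
    intervalIntegral.integral_mono_on hT.le (by simp)
      (hi (hn2.add continuousOn_const) 0 h0T T hTT) key
  have h3 : ∫ s in (0 : ℝ)..T, ‖c s‖ ^ 2 ≤ I :=
    intervalIntegral.integral_mono_on hT.le (hi hn2 0 h0T T hTT) (hi hw 0 h0T T hTT)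
      fun s _ => by simp
  rw [intervalIntegral.integral_add (hi hn2 0 h0T T hTT) (by simp),
    intervalIntegral.integral_const, intervalIntegral.integral_const, sub_zero, smul_eq_mul,
    smul_eq_mul] at h2
  have h4 : (1 / T + 1) * I = (I + T * I) / T := by field_simp
  rw [h4, le_div_iff₀ hT]
  linarith

/-- A continuous positive function on the compact set [0,T] × unit sphere has a positive minimum;
homogeneity does the rest. -/
theorem exists_pos_le_form [FiniteDimensional ℝ E] {M : ℝ → E →L[ℝ] E}
    (hM : ContinuousOn M (Icc 0 T))
    (hpos : ∀ t ∈ Icc 0 T, ∀ c, c ≠ 0 → 0 < inner ℝ (M t c) c) :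
    ∃ l > 0, ∀ t ∈ Icc 0 T, ∀ c, l * ‖c‖ ^ 2 ≤ inner ℝ (M t c) c := by
  have := FiniteDimensional.proper_real E
  have hcomp : IsCompact (Icc 0 T ×ˢ Metric.sphere (0 : E) 1) :=
    isCompact_Icc.prod (isCompact_sphere 0 1)
  have hcont : ContinuousOn (fun q : ℝ × E => inner ℝ (M q.1 q.2) q.2)
      (Icc 0 T ×ˢ Metric.sphere (0 : E) 1) :=
    ((hM.comp continuousOn_fst fun q hq => hq.1).clm_apply continuousOn_snd).inner continuousOn_snd
  obtain ⟨l, hl, hlb⟩ : ∃ l > 0, ∀ q ∈ Icc 0 T ×ˢ Metric.sphere (0 : E) 1,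
      l ≤ inner ℝ (M q.1 q.2) q.2 := by
    rcases (Icc 0 T ×ˢ Metric.sphere (0 : E) 1).eq_empty_or_nonempty with h | h
    · exact ⟨1, one_pos, by simp [h]⟩
    · obtain ⟨q, hq, hmin⟩ := hcomp.exists_isMinOn h hcont
      refine ⟨_, hpos q.1 hq.1 q.2 ?_, fun r hr => hmin hr⟩
      exact ne_zero_of_mem_unit_sphere ⟨q.2, hq.2⟩
  refine ⟨l, hl, fun t ht c => ?_⟩
  rcases eq_or_ne c 0 with rfl | hc
  · simp
  · have hn : ‖c‖ ≠ 0 := norm_ne_zero_iff.2 hc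
    have h1 := hlb (t, ‖c‖⁻¹ • c) ⟨ht, by simp [norm_smul, hn]⟩
    simp only [map_smul, inner_smul_left, inner_smul_right, RCLike.conj_to_real] at h1
    have h2 := mul_le_mul_of_nonneg_right h1 (sq_nonneg ‖c‖)
    refine h2.trans_eq ?_
    field_simp

theorem measurable_deriv_path [FiniteDimensional ℝ E] [MeasurableSpace E] [BorelSpace E]
    {Ω : Type*} [MeasurableSpace Ω] (hT : 0 < T) {c c' : Ω → ℝ → E}
    (hd : ∀ ω, ∀ t ∈ Icc 0 T, HasDerivWithinAt (c ω) (c' ω t) (Icc 0 T) t)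
    (hm : ∀ t ∈ Icc 0 T, Measurable fun ω => c ω t) {t : ℝ} (ht : t ∈ Icc 0 T) :
    Measurable fun ω => c' ω t := by
  have := FiniteDimensional.proper_real E
  have : SecondCountableTopology E := secondCountable_of_proper
  obtain ⟨b, hb, hbt⟩ : ∃ b ∈ Icc 0 T, b ≠ t := by
    rcases eq_or_ne t 0 with rfl | h
    · exact ⟨T, right_mem_Icc.2 hT.le, hT.ne'⟩
    · exact ⟨0, left_mem_Icc.2 hT.le, h.symm⟩
  -- Points of [0,T] other than t that converge to t, moving towards an endpoint b ≠ t so that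
  -- endpoints are included; the derivative is a limit of measurable slopes.
  let τ : ℕ → ℝ := fun k => t + (1 / ((k : ℝ) + 1)) * (b - t)
  have hτ : ∀ k, τ k ∈ Icc 0 T := by
    intro k
    have h0 : (0 : ℝ) ≤ 1 / ((k : ℝ) + 1) := by positivity
    have h1 : 1 / ((k : ℝ) + 1) ≤ 1 := by
      rw [div_le_one (by positivity)]; linarith [(Nat.cast_nonneg k : (0 : ℝ) ≤ k)]
    have := (convex_Icc (0 : ℝ) T).add_smul_sub_mem ht hb ⟨h0, h1⟩
    simpa [τ] using this
  have hτne : ∀ k, τ k ≠ t := by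
    intro k h
    have h0 : 1 / ((k : ℝ) + 1) ≠ 0 := by positivity
    have h1 : 1 / ((k : ℝ) + 1) * (b - t) = 0 := by simpa [τ] using h
    rcases mul_eq_zero.1 h1 with h2 | h2
    · exact h0 h2
    · exact hbt (sub_eq_zero.1 h2)
  have hτt : Tendsto τ atTop (𝓝[Icc 0 T \ {t}] t) := by
    refine tendsto_nhdsWithin_iff.2 ⟨?_, Eventually.of_forall fun k => ⟨hτ k, hτne k⟩⟩
    have h := (tendsto_one_div_add_atTop_nhds_zero_nat (𝕜 := ℝ)).mul_const (b - t)
    simpa [τ] using h.const_add t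
  refine measurable_of_tendsto_metrizable (f := fun k ω => slope (c ω) t (τ k)) (fun k => ?_) ?_
  · simp only [slope_def_module]
    exact ((hm _ (hτ k)).sub (hm t ht)).const_smul _
  · rw [tendsto_pi_nhds]
    exact fun ω => (hasDerivWithinAt_iff_tendsto_slope.1 (hd ω t ht)).comp hτt

end Sobolev

end ESFEM

end

/-! ### The norm of C^1_{S_h} in nodal values, and measurability of nodal values. -/

noncomputable section

open MeasureTheory Set Filter Topology

namespace ESFEM

/-- The parallelogram identity with the nonnegative value at x - y dropped. -/
theorem form_add_le {E : Type*} [NormedAddCommGroup E] [InnerProductSpace ℝ E] {A : E →L[ℝ] E}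
    (hA : ∀ c, 0 ≤ inner ℝ (A c) c) (x y : E) :
    inner ℝ (A (x + y)) (x + y) ≤ 2 * inner ℝ (A x) x + 2 * inner ℝ (A y) y := by
  have h := hA (x - y)
  simp only [map_add, map_sub, inner_add_left, inner_add_right, inner_sub_left,
    inner_sub_right] at h ⊢
  linarith

namespace EvolvingMesh

variable {n : ℕ} {T : ℝ} {S : EvolvingSurface n T} (𝒯 : EvolvingMesh S)

/-- The operator of the form `∫ ∇u · ∇w`. -/
def dirF (t : ℝ) : 𝒯.Cf →L[ℝ] 𝒯.Cf := 𝒯.stiffF (fun _ => refVol n) t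

theorem dirF_nonneg {t : ℝ} (ht : t ∈ Icc 0 T) (c : 𝒯.Cf) : 0 ≤ inner ℝ (𝒯.dirF t c) c :=
  𝒯.stiffF_nonneg ht (fun _ => refVol_nonneg n) c

theorem continuousOn_dirF (hT : 0 < T) (hn : n = 1 ∨ n = 2) : ContinuousOn 𝒯.dirF (Icc 0 T) :=
  𝒯.continuousOn_stiffF hT hn (κ := fun _ _ => refVol n) fun _ => continuousOn_const

theorem continuousOn_massF (hn : n = 1 ∨ n = 2) : ContinuousOn 𝒯.massF (Icc 0 T) :=
  fun _ ht => (𝒯.hasDerivWithinAt_massF hn ht).continuousWithinAt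

/-- The integrand of the squared norm of `C^1_{S_h}`. -/
def normForm (t : ℝ) (c c' : 𝒯.Cf) : ℝ :=
  inner ℝ (𝒯.massF t c) c + inner ℝ (𝒯.dirF t c) c + inner ℝ (𝒯.massF t c') c'

theorem normForm_nonneg {t : ℝ} (ht : t ∈ Icc 0 T) (c c' : 𝒯.Cf) : 0 ≤ 𝒯.normForm t c c' :=
  add_nonneg (add_nonneg (𝒯.massF_nonneg t c) (𝒯.dirF_nonneg ht c)) (𝒯.massF_nonneg t c')

theorem normForm_add_le {t : ℝ} (ht : t ∈ Icc 0 T) (c c' d d' : 𝒯.Cf) :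
    𝒯.normForm t (c + d) (c' + d') ≤ 2 * 𝒯.normForm t c c' + 2 * 𝒯.normForm t d d' := by
  have h1 := form_add_le (𝒯.massF_nonneg t) c d
  have h2 := form_add_le (𝒯.massF_nonneg t) c' d'
  have h3 := form_add_le (𝒯.dirF_nonneg ht) c d
  simp only [normForm]
  linarith

theorem continuousOn_normForm (hT : 0 < T) (hn : n = 1 ∨ n = 2) {c c' : ℝ → 𝒯.Cf}
    (hc : ContinuousOn c (Icc 0 T)) (hc' : ContinuousOn c' (Icc 0 T)) :
    ContinuousOn (fun t => 𝒯.normForm t (c t) (c' t)) (Icc 0 T) :=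
  ((continuousOn_form (𝒯.continuousOn_massF hn) hc hc).add
    (continuousOn_form (𝒯.continuousOn_dirF hT hn) hc hc)).add
    (continuousOn_form (𝒯.continuousOn_massF hn) hc' hc')

theorem measurable_normForm {Ω : Type*} [MeasurableSpace Ω] (t : ℝ) {c c' : Ω → 𝒯.Cf}
    (hc : Measurable c) (hc' : Measurable c') : Measurable fun ω => 𝒯.normForm t (c ω) (c' ω) :=
  ((((𝒯.massF t).measurable.comp hc).inner hc).add (((𝒯.dirF t).measurable.comp hc).inner hc)).add
    (((𝒯.massF t).measurable.comp hc').inner hc')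

theorem exists_le_normForm (hn : n = 1 ∨ n = 2) :
    ∃ l > 0, ∀ t ∈ Icc 0 T, ∀ c c', l * (‖c‖ ^ 2 + ‖c'‖ ^ 2) ≤ 𝒯.normForm t c c' := by
  obtain ⟨l, hl, h⟩ := exists_pos_le_form (𝒯.continuousOn_massF hn)
    fun t ht c hc => 𝒯.massF_pos ht hc
  refine ⟨l, hl, fun t ht c c' => ?_⟩
  have h1 := h t ht c
  have h2 := h t ht c'
  have h3 := 𝒯.dirF_nonneg ht c
  simp only [normForm]
  linarith

theorem exists_normForm_le (hT : 0 < T) (hn : n = 1 ∨ n = 2) :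
    ∃ Λ > 0, ∀ t ∈ Icc 0 T, ∀ c c', 𝒯.normForm t c c' ≤ Λ * (‖c‖ ^ 2 + ‖c'‖ ^ 2) := by
  obtain ⟨K₁, hK₁⟩ := isCompact_Icc.exists_bound_of_continuousOn (𝒯.continuousOn_massF hn)
  obtain ⟨K₂, hK₂⟩ := isCompact_Icc.exists_bound_of_continuousOn (𝒯.continuousOn_dirF hT hn)
  have hform : ∀ (A : 𝒯.Cf →L[ℝ] 𝒯.Cf) (K : ℝ), ‖A‖ ≤ K → ∀ c, inner ℝ (A c) c ≤ K * ‖c‖ ^ 2 := by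
    intro A K hA c
    refine (real_inner_le_norm _ _).trans ?_
    rw [pow_two, ← mul_assoc]
    exact mul_le_mul_of_nonneg_right ((A.le_opNorm c).trans
      (mul_le_mul_of_nonneg_right hA (norm_nonneg _))) (norm_nonneg _)
  refine ⟨|K₁| + |K₂| + 1, by positivity, fun t ht c c' => ?_⟩
  have h1 := hform _ _ ((hK₁ t ht).trans (le_abs_self _)) c
  have h2 := hform _ _ ((hK₁ t ht).trans (le_abs_self _)) c'
  have h3 := hform _ _ ((hK₂ t ht).trans (le_abs_self _)) c
  simp only [normForm]
  nlinarith [sq_nonneg ‖c‖, mul_nonneg (abs_nonneg K₂) (sq_nonneg ‖c'‖), sq_nonneg ‖c'‖]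

variable {𝒯}

/-- The derivative of the path of nodal values. -/
def C1.coefDeriv (u : 𝒯.C1) (t : ℝ) : 𝒯.Cf := derivWithin u.coef (Icc 0 T) t

theorem C1.hasDerivWithinAt_coef (hT : 0 < T) (u : 𝒯.C1) {t : ℝ} (ht : t ∈ Icc 0 T) :
    HasDerivWithinAt u.coef (u.coefDeriv t) (Icc 0 T) t :=
  ((u.contDiffOn_coef hT).differentiableOn one_ne_zero t ht).hasDerivWithinAt

theorem C1.continuousOn_coef (hT : 0 < T) (u : 𝒯.C1) : ContinuousOn u.coef (Icc 0 T) :=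
  (u.contDiffOn_coef hT).continuousOn

theorem C1.continuousOn_coefDeriv (hT : 0 < T) (u : 𝒯.C1) :
    ContinuousOn u.coefDeriv (Icc 0 T) :=
  (u.contDiffOn_coef hT).continuousOn_derivWithin (uniqueDiffOn_Icc hT) le_rfl

theorem C1.eqOn_path (u : 𝒯.C1) {t : ℝ} (ht : t ∈ Icc 0 T) :
    EqOn (path u.1 t) (𝒯.interp t (u.coef t)) (𝒯.Γh t) := fun _ hx => u.path_eq ht hx

theorem C1.eqOn_matDeriv (hT : 0 < T) (u : 𝒯.C1) {t : ℝ} (ht : t ∈ Icc 0 T) :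
    EqOn (𝒯.matDeriv (path u.1) t) (𝒯.interp t (u.coefDeriv t)) (𝒯.Γh t) := fun _ hx =>
  𝒯.matDeriv_eq_interp hT (fun _ hs => u.eqOn_path hs) ht (u.hasDerivWithinAt_coef hT ht) hx

theorem c1sq_eq (hT : 0 < T) {f : ℝ → Amb n → ℝ} {c c' : ℝ → 𝒯.Cf}
    (hf : ∀ s ∈ Icc 0 T, EqOn (f s) (𝒯.interp s (c s)) (𝒯.Γh s))
    (hc : ∀ t ∈ Icc 0 T, HasDerivWithinAt c (c' t) (Icc 0 T) t) :
    𝒯.c1sq f = ∫ t in (0 : ℝ)..T, 𝒯.normForm t (c t) (c' t) := by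
  refine intervalIntegral.integral_congr fun t ht => ?_
  rw [uIcc_of_le hT.le] at ht
  simp only [normForm]
  rw [h1sq_eq ht (hf t ht), l2sq_eq ht fun x hx => 𝒯.matDeriv_eq_interp hT hf ht (hc t ht) hx]
  rfl

theorem c1sq_path (hT : 0 < T) (u : 𝒯.C1) :
    𝒯.c1sq (path u.1) = ∫ t in (0 : ℝ)..T, 𝒯.normForm t (u.coef t) (u.coefDeriv t) :=
  c1sq_eq hT (fun _ hs => u.eqOn_path hs) fun _ ht => u.hasDerivWithinAt_coef hT ht

theorem c1sq_sub (hT : 0 < T) (u w : 𝒯.C1) :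
    𝒯.c1sq (fun t x => path w.1 t x - path u.1 t x) = ∫ t in (0 : ℝ)..T,
      𝒯.normForm t (w.coef t - u.coef t) (w.coefDeriv t - u.coefDeriv t) := by
  refine c1sq_eq hT (c := fun t => w.coef t - u.coef t) (fun s hs x hx => ?_)
    fun t ht => (w.hasDerivWithinAt_coef hT ht).sub (u.hasDerivWithinAt_coef hT ht)
  simp only [w.path_eq hs hx, u.path_eq hs hx, ← interp_sub]
  rfl

variable (𝒯) in
-- Coercivity of the mass form reduces this to the Sobolev inequality in time. The constant may
-- depend on the mesh and is not used for stability.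
theorem exists_coef_sq_le (hT : 0 < T) (hn : n = 1 ∨ n = 2) :
    ∃ C > 0, ∀ c c' : ℝ → 𝒯.Cf, (∀ t ∈ Icc 0 T, HasDerivWithinAt c (c' t) (Icc 0 T) t) →
      ContinuousOn c' (Icc 0 T) →
      (∀ t ∈ Icc 0 T, ‖c t‖ ^ 2 ≤ C * ∫ t in (0 : ℝ)..T, 𝒯.normForm t (c t) (c' t)) ∧
      ∫ t in (0 : ℝ)..T, (‖c t‖ ^ 2 + ‖c' t‖ ^ 2) ≤
        C * ∫ t in (0 : ℝ)..T, 𝒯.normForm t (c t) (c' t) := by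
  obtain ⟨l, hl, h⟩ := 𝒯.exists_le_normForm hn
  refine ⟨(1 / T + 1) / l, by positivity, fun c c' hc hc' => ?_⟩
  have hcc : ContinuousOn c (Icc 0 T) := fun t ht => (hc t ht).continuousWithinAt
  have h1 : l * ∫ t in (0 : ℝ)..T, (‖c t‖ ^ 2 + ‖c' t‖ ^ 2) ≤
      ∫ t in (0 : ℝ)..T, 𝒯.normForm t (c t) (c' t) := by
    rw [← intervalIntegral.integral_const_mul]
    refine intervalIntegral.integral_mono_on hT.le ?_ ?_ fun t ht => h t ht _ _
    · apply ContinuousOn.intervalIntegrable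
      rw [uIcc_of_le hT.le]
      exact continuousOn_const.mul ((hcc.norm.pow 2).add (hc'.norm.pow 2))
    · apply ContinuousOn.intervalIntegrable
      rw [uIcc_of_le hT.le]
      exact 𝒯.continuousOn_normForm hT hn hcc hc'
  have h2 : 0 ≤ ∫ t in (0 : ℝ)..T, (‖c t‖ ^ 2 + ‖c' t‖ ^ 2) :=
    intervalIntegral.integral_nonneg hT.le fun t _ => by positivity
  have h3 : (1 / T + 1) * ∫ t in (0 : ℝ)..T, (‖c t‖ ^ 2 + ‖c' t‖ ^ 2) ≤
      (1 / T + 1) / l * ∫ t in (0 : ℝ)..T, 𝒯.normForm t (c t) (c' t) := by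
    rw [div_mul_eq_mul_div, le_div_iff₀ hl, mul_assoc]
    refine mul_le_mul_of_nonneg_left ?_ (by positivity)
    linarith
  refine ⟨fun t ht => (sobolev_sq_le hT hc hc' ht).trans h3, le_trans ?_ h3⟩
  exact le_mul_of_one_le_left h2 (by simp; positivity)

variable (𝒯) in
-- The norm is an integral over time, yet it controls the value at each time. Hence Borel measurable
-- random elements have measurable nodal values.
theorem continuous_coef (hT : 0 < T) (hn : n = 1 ∨ n = 2) {t : ℝ} (ht : t ∈ Icc 0 T) :
    @Continuous 𝒯.C1 𝒯.Cf 𝒯.c1Topology _ fun u => u.coef t := by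
  let := 𝒯.c1Topology
  obtain ⟨C, hC, h⟩ := 𝒯.exists_coef_sq_le hT hn
  refine continuous_def.2 fun O hO u hu => ?_
  obtain ⟨δ, hδ, hb⟩ := Metric.isOpen_iff.1 hO _ hu
  refine ⟨δ / √C, by positivity, fun w hw => hb ?_⟩
  rw [Metric.mem_ball, dist_eq_norm]
  have h1 := (h (fun t => w.coef t - u.coef t) (fun t => w.coefDeriv t - u.coefDeriv t)
    (fun t ht => (w.hasDerivWithinAt_coef hT ht).sub (u.hasDerivWithinAt_coef hT ht))
    ((w.continuousOn_coefDeriv hT).sub (u.continuousOn_coefDeriv hT))).1 t ht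
  rw [← c1sq_sub hT u w] at h1
  rw [Real.sqrt_lt' (by positivity), div_pow, Real.sq_sqrt hC.le, lt_div_iff₀ hC] at hw
  refine lt_of_pow_lt_pow_left₀ 2 hδ.le (h1.trans_lt ?_)
  linarith

section Random

variable {Ω : Type*} [MeasurableSpace Ω] {P : Measure Ω}

theorem measurable_coef (hT : 0 < T) (hn : n = 1 ∨ n = 2) {U : Ω → 𝒯.C1} (hU : 𝒯.MemWh P U) {t : ℝ}
    (ht : t ∈ Icc 0 T) : Measurable fun ω => (U ω).coef t := by
  let := 𝒯.c1Topology
  let : MeasurableSpace 𝒯.C1 := borel 𝒯.C1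
  have : BorelSpace 𝒯.C1 := ⟨rfl⟩
  exact (𝒯.continuous_coef hT hn ht).measurable.comp hU.1

theorem measurable_coefDeriv (hT : 0 < T) (hn : n = 1 ∨ n = 2) {U : Ω → 𝒯.C1} (hU : 𝒯.MemWh P U)
    {t : ℝ} (ht : t ∈ Icc 0 T) : Measurable fun ω => (U ω).coefDeriv t :=
  measurable_deriv_path hT (fun ω _ ht => (U ω).hasDerivWithinAt_coef hT ht)
    (fun _ ht => measurable_coef hT hn hU ht) ht

theorem integrable_coef_sq (hT : 0 < T) (hn : n = 1 ∨ n = 2) {U : Ω → 𝒯.C1} (hU : 𝒯.MemWh P U)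
    {t : ℝ} (ht : t ∈ Icc 0 T) : Integrable (fun ω => ‖(U ω).coef t‖ ^ 2) P := by
  obtain ⟨C, hC, h⟩ := 𝒯.exists_coef_sq_le hT hn
  refine (hU.2.const_mul C).mono'
    ((measurable_coef hT hn hU ht).norm.pow_const 2).aestronglyMeasurable (ae_of_all _ fun ω => ?_)
  rw [Real.norm_of_nonneg (by positivity), c1sq_path hT]
  exact (h _ _ (fun _ ht => (U ω).hasDerivWithinAt_coef hT ht)
    ((U ω).continuousOn_coefDeriv hT)).1 t ht

variable [IsProbabilityMeasure P]

theorem l2Path_of_le (hT : 0 < T) {c : Ω → ℝ → 𝒯.Cf} (hc : ∀ ω, ContinuousOn (c ω) (Icc 0 T))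
    (hm : ∀ t ∈ Icc 0 T, Measurable fun ω => c ω t) {g : Ω → ℝ} (hg : Integrable g P)
    (h : ∀ ω, ∫ t in (0 : ℝ)..T, ‖c ω t‖ ^ 2 ≤ g ω) : L2Path P T c := by
  refine ⟨hc, hm, integrable_prod_of_paths hT.le (fun ω => (hc ω).norm.pow 2)
    (fun t ht => (hm t ht).norm.pow_const 2) hg fun ω => ?_⟩
  simpa only [Pi.pow_apply, abs_pow, abs_norm] using h ω

theorem l2Path_coef_coefDeriv (hT : 0 < T) (hn : n = 1 ∨ n = 2) {U : Ω → 𝒯.C1}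
    (hU : 𝒯.MemWh P U) :
    L2Path P T (fun ω => (U ω).coef) ∧ L2Path P T (fun ω => (U ω).coefDeriv) := by
  obtain ⟨C, hC, h⟩ := 𝒯.exists_coef_sq_le hT hn
  have hg := hU.2.const_mul C
  have hi : ∀ {f : ℝ → ℝ}, ContinuousOn f (Icc 0 T) → IntervalIntegrable f volume 0 T :=
    fun hf => ContinuousOn.intervalIntegrable (by rwa [uIcc_of_le hT.le])
  have hcc := fun ω => (U ω).continuousOn_coef hT
  have hcd := fun ω => (U ω).continuousOn_coefDeriv hT
  have hb : ∀ ω, ∫ t in (0 : ℝ)..T, (‖(U ω).coef t‖ ^ 2 + ‖(U ω).coefDeriv t‖ ^ 2) ≤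
      C * 𝒯.c1sq (path (U ω).1) := by
    intro ω
    rw [c1sq_path hT]
    exact (h _ _ (fun _ ht => (U ω).hasDerivWithinAt_coef hT ht) (hcd ω)).2
  constructor
  · refine l2Path_of_le hT hcc (fun t ht => measurable_coef hT hn hU ht) hg
      fun ω => le_trans ?_ (hb ω)
    exact intervalIntegral.integral_mono_on hT.le (hi ((hcc ω).norm.pow 2))
      (hi (((hcc ω).norm.pow 2).add ((hcd ω).norm.pow 2))) fun t _ => by simp
  · refine l2Path_of_le hT hcd (fun t ht => measurable_coefDeriv hT hn hU ht) hg
      fun ω => le_trans ?_ (hb ω)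
    exact intervalIntegral.integral_mono_on hT.le (hi ((hcd ω).norm.pow 2))
      (hi (((hcc ω).norm.pow 2).add ((hcd ω).norm.pow 2))) fun t _ => by simp

end Random

end EvolvingMesh

end ESFEM

end

/-! ### Borel measurability of random elements of C^1_{S_h}. -/

noncomputable section

open MeasureTheory Set Filter Topology

namespace ESFEM

namespace EvolvingMesh

variable {n : ℕ} {T : ℝ} {S : EvolvingSurface n T} {𝒯 : EvolvingMesh S}

/-- The paths of nodal values and of their derivatives as continuous functions. -/
def C1.toPaths (hT : 0 < T) (u : 𝒯.C1) : C(Icc 0 T, 𝒯.Cf) × C(Icc 0 T, 𝒯.Cf) :=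
  (⟨_, (u.continuousOn_coef hT).domRestrict⟩, ⟨_, (u.continuousOn_coefDeriv hT).domRestrict⟩)

variable (𝒯) in
theorem exists_c1sq_sub_le (hT : 0 < T) (hn : n = 1 ∨ n = 2) : ∃ Λ > 0, ∀ u w : 𝒯.C1,
    𝒯.c1sq (fun t x => path w.1 t x - path u.1 t x) ≤
      Λ * dist (w.toPaths hT) (u.toPaths hT) ^ 2 := by
  obtain ⟨Λ, hΛ, h⟩ := 𝒯.exists_normForm_le hT hn
  refine ⟨T * (Λ * 2), by positivity, fun u w => ?_⟩
  set r := dist (w.toPaths hT) (u.toPaths hT)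
  rw [c1sq_sub hT]
  have hb : ∀ t ∈ Icc 0 T, 𝒯.normForm t (w.coef t - u.coef t) (w.coefDeriv t - u.coefDeriv t) ≤
      Λ * 2 * r ^ 2 := by
    intro t ht
    have h1 : ‖w.coef t - u.coef t‖ ≤ r := by
      rw [← dist_eq_norm]
      exact (ContinuousMap.dist_apply_le_dist (f := (w.toPaths hT).1) (g := (u.toPaths hT).1)
        ⟨t, ht⟩).trans (le_max_left _ _)
    have h2 : ‖w.coefDeriv t - u.coefDeriv t‖ ≤ r := by
      rw [← dist_eq_norm]
      exact (ContinuousMap.dist_apply_le_dist (f := (w.toPaths hT).2) (g := (u.toPaths hT).2)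
        ⟨t, ht⟩).trans (le_max_right _ _)
    refine (h t ht _ _).trans ?_
    have h3 := pow_le_pow_left₀ (norm_nonneg _) h1 2
    have h4 := pow_le_pow_left₀ (norm_nonneg _) h2 2
    rw [mul_assoc]
    exact mul_le_mul_of_nonneg_left (by linarith) hΛ.le
  have := intervalIntegral.integral_mono_on hT.le (μ := volume) (f := fun t =>
    𝒯.normForm t (w.coef t - u.coef t) (w.coefDeriv t - u.coefDeriv t))
    (g := fun _ => Λ * 2 * r ^ 2)
    (by
      apply ContinuousOn.intervalIntegrable
      rw [uIcc_of_le hT.le]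
      exact 𝒯.continuousOn_normForm hT hn ((w.continuousOn_coef hT).sub (u.continuousOn_coef hT))
        ((w.continuousOn_coefDeriv hT).sub (u.continuousOn_coefDeriv hT))) (by simp) hb
  refine this.trans_eq ?_
  rw [intervalIntegral.integral_const, smul_eq_mul]
  ring

/-- A triangle inequality for the squared distance, with factor 2; it suffices for the countable
covering of open sets by balls. -/
theorem c1sq_sub_le (hT : 0 < T) (hn : n = 1 ∨ n = 2) (u d w : 𝒯.C1) :
    𝒯.c1sq (fun t x => path w.1 t x - path u.1 t x) ≤
      2 * 𝒯.c1sq (fun t x => path w.1 t x - path d.1 t x) +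
      2 * 𝒯.c1sq (fun t x => path d.1 t x - path u.1 t x) := by
  simp only [c1sq_sub hT]
  have hi : ∀ u w : 𝒯.C1, IntervalIntegrable (fun t => 𝒯.normForm t (w.coef t - u.coef t)
      (w.coefDeriv t - u.coefDeriv t)) volume 0 T := by
    intro u w
    apply ContinuousOn.intervalIntegrable
    rw [uIcc_of_le hT.le]
    exact 𝒯.continuousOn_normForm hT hn ((w.continuousOn_coef hT).sub (u.continuousOn_coef hT))
      ((w.continuousOn_coefDeriv hT).sub (u.continuousOn_coefDeriv hT))
  rw [← intervalIntegral.integral_const_mul, ← intervalIntegral.integral_const_mul,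
    ← intervalIntegral.integral_add ((hi _ _).const_mul 2) ((hi _ _).const_mul 2)]
  refine intervalIntegral.integral_mono_on hT.le (hi _ _)
    (((hi _ _).const_mul 2).add ((hi _ _).const_mul 2)) fun t ht => ?_
  refine le_trans (le_of_eq ?_) (𝒯.normForm_add_le ht _ _ _ _)
  congr 1 <;> abel

variable {Ω : Type*} [MeasurableSpace Ω] {c c' : Ω → ℝ → 𝒯.Cf}

theorem contDiffOn_of_hasDerivWithinAt (hT : 0 < T) {c c' : ℝ → 𝒯.Cf}
    (hd : ∀ t ∈ Icc 0 T, HasDerivWithinAt c (c' t) (Icc 0 T) t) (hc' : ContinuousOn c' (Icc 0 T)) :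
    ContDiffOn ℝ 1 c (Icc 0 T) := by
  refine (contDiffOn_succ_iff_derivWithin (n := 0) (uniqueDiffOn_Icc hT)).2
    ⟨fun t ht => (hd t ht).differentiableWithinAt, by simp, ?_⟩
  refine contDiffOn_zero.2 (hc'.congr fun t ht => (hd t ht).derivWithin (uniqueDiffOn_Icc hT t ht))

/-- By separability every open set is a countable union of balls. The preimage of a ball is
measurable because the squared distance is a time integral of continuous paths that are measurable
in ω. -/
theorem measurable_c1 (hT : 0 < T) (hn : n = 1 ∨ n = 2) {U : Ω → 𝒯.C1}
    (hm : ∀ t ∈ Icc 0 T, Measurable fun ω => (U ω).coef t) :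
    Measurable[_, @borel 𝒯.C1 𝒯.c1Topology] U := by
  have hm' : ∀ t ∈ Icc 0 T, Measurable fun ω => (U ω).coefDeriv t := fun t ht =>
    measurable_deriv_path hT (fun ω _ ht => (U ω).hasDerivWithinAt_coef hT ht) hm ht
  have hball : ∀ (d : 𝒯.C1) (q : ℝ),
      MeasurableSet {ω | 𝒯.c1sq (fun t x => path (U ω).1 t x - path d.1 t x) < q} := by
    intro d q
    refine measurableSet_lt ?_ measurable_const
    simp only [c1sq_sub hT]
    refine measurable_integral_path hT.le (fun ω => 𝒯.continuousOn_normForm hT hn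
      (((U ω).continuousOn_coef hT).sub (d.continuousOn_coef hT))
      (((U ω).continuousOn_coefDeriv hT).sub (d.continuousOn_coefDeriv hT)))
      (fun t ht => 𝒯.measurable_normForm t ((hm t ht).sub_const _) ((hm' t ht).sub_const _))
      (right_mem_Icc.2 hT.le)
  obtain ⟨Λ, hΛ, hle⟩ := 𝒯.exists_c1sq_sub_le hT hn
  -- Separability is taken from the uniform topology on pairs of paths (c, c'), which is finer than
  -- that of the norm by `exists_c1sq_sub_le`.
  obtain ⟨Y, hYsub, hYc, hYd⟩ :=
    (TopologicalSpace.IsSeparable.of_separableSpace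
      (range fun u : 𝒯.C1 => u.toPaths hT)).exists_countable_dense_subset
  have : Nonempty 𝒯.C1 := ⟨𝒯.mkC1 hT 0 contDiffOn_const⟩
  choose! g hg using fun y (hy : y ∈ Y) => hYsub hy
  have hdense : ∀ u : 𝒯.C1, ∀ q > 0, ∃ y ∈ Y, dist (u.toPaths hT) ((g y).toPaths hT) ^ 2 < q := by
    intro u q hq
    obtain ⟨y, hy, hdist⟩ := Metric.mem_closure_iff.1 (hYd ⟨u, rfl⟩) (√q) (Real.sqrt_pos.2 hq)
    refine ⟨y, hy, ?_⟩
    rw [show (g y).toPaths hT = y from hg y hy]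
    exact (Real.lt_sqrt dist_nonneg).1 hdist
  let := 𝒯.c1Topology
  refine measurable_generateFrom ?_
  intro O hO
  have hset : U ⁻¹' O = ⋃ y ∈ Y, ⋃ q : ℚ,
      ⋃ _ : ∀ w : 𝒯.C1, 𝒯.c1sq (fun t x => path w.1 t x - path (g y).1 t x) < q → w ∈ O,
        {ω | 𝒯.c1sq (fun t x => path (U ω).1 t x - path (g y).1 t x) < q} := by
    ext ω
    simp only [mem_preimage, mem_iUnion, mem_ofPred_eq, exists_prop]
    constructor
    · intro hω
      obtain ⟨ε, hε, hball⟩ := hO (U ω) hω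
      -- With q < ε²/4, two squared distances below q add up to at most 4q < ε² in the
      -- quasi-triangle inequality.
      obtain ⟨q, hq0, hq⟩ := exists_rat_btwn (show (0 : ℝ) < ε ^ 2 / 4 by positivity)
      obtain ⟨y, hy, hyd⟩ := hdense (U ω) (q / Λ) (by positivity)
      have h1 : Λ * dist ((U ω).toPaths hT) ((g y).toPaths hT) ^ 2 < q := by
        rw [lt_div_iff₀ hΛ] at hyd
        linarith
      refine ⟨y, hy, q, fun w hw => hball w ?_, (hle _ _).trans_lt h1⟩
      rw [Real.sqrt_lt' hε]
      have h2 := hle (U ω) (g y)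
      rw [dist_comm] at h2
      have h3 := c1sq_sub_le hT hn (U ω) (g y) w
      linarith
    · rintro ⟨y, hy, q, h, hω⟩
      exact h _ hω
  rw [hset]
  exact .biUnion hYc fun y _ => .iUnion fun q => .iUnion fun _ => hball _ _

variable {P : Measure Ω} [IsProbabilityMeasure P]

theorem memWh_of_l2Path (hT : 0 < T) (hn : n = 1 ∨ n = 2) {U : Ω → 𝒯.C1}
    (h : L2Path P T fun ω => (U ω).coef) (h' : L2Path P T fun ω => (U ω).coefDeriv) :
    𝒯.MemWh P U := by
  refine ⟨measurable_c1 hT hn h.meas, ?_⟩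
  obtain ⟨Λ, hΛ, hle⟩ := 𝒯.exists_normForm_le hT hn
  have hi : Integrable (fun q : Ω × ℝ => 𝒯.normForm q.2 ((U q.1).coef q.2) ((U q.1).coefDeriv q.2))
      (P.prod (volume.restrict (Icc 0 T))) := by
    refine ((h.sq.add h'.sq).const_mul Λ).mono' (aemeasurable_prod P hT.le
      (f := fun ω t => 𝒯.normForm t ((U ω).coef t) ((U ω).coefDeriv t))
      (fun ω => 𝒯.continuousOn_normForm hT hn (h.cont ω) (h'.cont ω))
      fun t ht => 𝒯.measurable_normForm t (h.meas t ht) (h'.meas t ht)).aestronglyMeasurable ?_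
    filter_upwards [ae_prod_Icc P] with q hq
    rw [Real.norm_of_nonneg (𝒯.normForm_nonneg hq _ _)]
    exact hle _ hq _ _
  refine hi.integral_prod_left.congr (ae_of_all _ fun ω => ?_)
  simp only [c1sq_path hT, integral_Icc_eq_interval hT.le]

theorem coefDeriv_mkC1 (hT : 0 < T) {c c' : ℝ → 𝒯.Cf} (hc : ContDiffOn ℝ 1 c (Icc 0 T))
    (hd : ∀ t ∈ Icc 0 T, HasDerivWithinAt c (c' t) (Icc 0 T) t) {t : ℝ} (ht : t ∈ Icc 0 T) :
    (𝒯.mkC1 hT c hc).coefDeriv t = c' t := by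
  have h := ((hd t ht).congr (fun s hs => 𝒯.coef_mkC1 hT c hc hs) (𝒯.coef_mkC1 hT c hc ht))
  exact h.derivWithin (uniqueDiffOn_Icc hT t ht)

theorem memWh_mkC1 (hT : 0 < T) (hn : n = 1 ∨ n = 2)
    (hc : ∀ ω, ContDiffOn ℝ 1 (c ω) (Icc 0 T))
    (hd : ∀ ω, ∀ t ∈ Icc 0 T, HasDerivWithinAt (c ω) (c' ω t) (Icc 0 T) t)
    (h : L2Path P T c) (h' : L2Path P T c') : 𝒯.MemWh P fun ω => 𝒯.mkC1 hT (c ω) (hc ω) :=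
  memWh_of_l2Path hT hn (h.congr fun ω _ ht => 𝒯.coef_mkC1 hT _ (hc ω) ht)
    (h'.congr fun ω _ ht => coefDeriv_mkC1 hT (hc ω) (hd ω) ht)

end EvolvingMesh

end ESFEM

end

/-! ### The weak formulations expressed by the residual. -/

noncomputable section

open MeasureTheory Set Filter Topology

namespace ESFEM

theorem integrable_sq_clm_apply {E Ω : Type*} [NormedAddCommGroup E] [NormedSpace ℝ E]
    [MeasurableSpace Ω] {P : Measure Ω} {φ : Ω → E} (A : E →L[ℝ] E)
    (hφ : AEStronglyMeasurable φ P) (hφ2 : Integrable (fun ω => ‖φ ω‖ ^ 2) P) :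
    Integrable (fun ω => ‖A (φ ω)‖ ^ 2) P := by
  refine (hφ2.const_mul (‖A‖ ^ 2)).mono'
    ((A.continuous.comp_aestronglyMeasurable hφ).norm.pow 2) (ae_of_all _ fun ω => ?_)
  rw [Real.norm_of_nonneg (by positivity), ← mul_pow]
  exact pow_le_pow_left₀ (norm_nonneg _) (A.le_opNorm _) 2

/-- The derivative of the expectation of a time dependent form along two random paths, expressed by
the residual `M c' + G c + A c` of the first path. -/
theorem ae_hasDerivAt_integral_form {E Ω : Type*} [NormedAddCommGroup E] [InnerProductSpace ℝ E]
    [FiniteDimensional ℝ E] [MeasurableSpace E] [BorelSpace E] [MeasurableSpace Ω] {P : Measure Ω}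
    [IsProbabilityMeasure P] {T : ℝ} (hT : 0 < T) {M G : ℝ → E →L[ℝ] E}
    (hM : ∀ t ∈ Icc 0 T, HasDerivWithinAt M (G t) (Icc 0 T) t) (hG : ContinuousOn G (Icc 0 T))
    {A : Ω → ℝ → E →L[ℝ] E} (hA : BddOp T A) {c c' d d' : Ω → ℝ → E}
    (hcd : ∀ ω, ∀ t ∈ Icc 0 T, HasDerivWithinAt (c ω) (c' ω t) (Icc 0 T) t)
    (hdd : ∀ ω, ∀ t ∈ Icc 0 T, HasDerivWithinAt (d ω) (d' ω t) (Icc 0 T) t)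
    (hc : L2Path P T c) (hc' : L2Path P T c') (hd : L2Path P T d) (hd' : L2Path P T d')
    (h0 : Integrable (fun ω => inner ℝ (M 0 (c ω 0)) (d ω 0)) P) :
    ∀ᵐ t ∂(volume.restrict (Icc 0 T)), t ∈ Ioo 0 T ∧
      HasDerivAt (fun s => ∫ ω, inner ℝ (M s (c ω s)) (d ω s) ∂P)
        (∫ ω, inner ℝ (M t (c ω t)) (d' ω t) ∂P - ∫ ω, inner ℝ (A ω t (c ω t)) (d ω t) ∂P
          + ∫ ω, inner ℝ (M t (c' ω t) + G t (c ω t) + A ω t (c ω t)) (d ω t) ∂P) t := by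
  have hMo : BddOp T fun _ : Ω => M :=
    BddOp.of_continuousOn fun t ht => (hM t ht).continuousWithinAt
  have hGo : BddOp T fun _ : Ω => G := BddOp.of_continuousOn hG
  have hMc := hMo.apply hT.le hc
  have hMc' := hMo.apply hT.le hc'
  have hGc := hGo.apply hT.le hc
  have hGM := hGc.add hT.le hMc'
  have hAc := hA.apply hT.le hc
  have hR := (hMc'.add hT.le hGc).add hT.le hAc
  have key := ae_hasDerivAt_integral (P := P) hT.le
    (f := fun ω s => inner ℝ (M s (c ω s)) (d ω s))
    (f' := fun ω s => inner ℝ (M s (c ω s)) (d' ω s) +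
      inner ℝ (G s (c ω s) + M s (c' ω s)) (d ω s))
    (fun ω t ht => ((hM t ht).clm_apply (hcd ω t ht)).inner ℝ (hdd ω t ht))
    (fun ω => ((hMc.cont ω).inner (hd'.cont ω)).add ((hGM.cont ω).inner (hd.cont ω)))
    h0 ((hMc.integrable_inner hT.le hd').add (hGM.integrable_inner hT.le hd))
  have a1 : ∀ᵐ t ∂(volume.restrict (Icc 0 T)), t ≠ 0 := ae_restrict_of_ae (Measure.ae_ne _ _)
  have a2 : ∀ᵐ t ∂(volume.restrict (Icc 0 T)), t ≠ T := ae_restrict_of_ae (Measure.ae_ne _ _)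
  filter_upwards [key, a1, a2, ae_restrict_mem measurableSet_Icc,
    (hMc.integrable_inner hT.le hd').prod_left_ae, (hAc.integrable_inner hT.le hd).prod_left_ae,
    (hR.integrable_inner hT.le hd).prod_left_ae] with t hder h1 h2 h3 i1 i2 i3
  refine ⟨⟨lt_of_le_of_ne h3.1 (Ne.symm h1), lt_of_le_of_ne h3.2 h2⟩, ?_⟩
  have i12 : Integrable (fun ω => inner ℝ (M t (c ω t)) (d' ω t) -
      inner ℝ (A ω t (c ω t)) (d ω t)) P := i1.sub i2
  -- The product rule yields M(c,d') + (G c + M c') · d; adding and subtracting A c completes the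
  -- residual.
  convert hder using 1
  rw [← integral_sub i1 i2, ← integral_add i12 i3]
  refine integral_congr_ae (ae_of_all _ fun ω => ?_)
  simp only [inner_add_left]
  ring

namespace EvolvingMesh

variable {n : ℕ} {T : ℝ} {S : EvolvingSurface n T} {𝒯 : EvolvingMesh S}
  {Ω : Type*} [MeasurableSpace Ω] {P : Measure Ω} {α : Ω → ℝ → Amb n → ℝ}

/-! ### The random stiffness operator -/

/-- Linearity in the element weights separates the random scalars from the deterministic operators,
giving measurability and uniform bounds. -/
theorem stiffF_eq_sum (κ : Fin 𝒯.M → ℝ) (t : ℝ) :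
    𝒯.stiffF κ t = ∑ σ, κ σ • 𝒯.stiffF (Pi.single σ 1) t := by
  simp only [stiffF]
  refine Finset.sum_congr rfl fun σ _ => ?_
  rw [Finset.sum_eq_single σ (fun τ _ hτ => by
    rw [Pi.single_eq_of_ne hτ, mul_zero]; exact zero_smul ℝ (𝒯.stiffE τ t)) (by simp), smul_smul]
  simp [mul_comm]

theorem bddOp_stiffF (hT : 0 < T) (hn : n = 1 ∨ n = 2) {κ : Ω → Fin 𝒯.M → ℝ → ℝ} {C : ℝ}
    (hc : ∀ ω σ, ContinuousOn (κ ω σ) (Icc 0 T))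
    (hm : ∀ σ, ∀ t ∈ Icc 0 T, Measurable fun ω => κ ω σ t)
    (hb : ∀ ω σ, ∀ t ∈ Icc 0 T, |κ ω σ t| ≤ C) :
    BddOp T fun ω t => 𝒯.stiffF (fun σ => κ ω σ t) t := by
  have hK : ∀ σ : Fin 𝒯.M, ∃ K, ∀ t ∈ Icc 0 T, ‖𝒯.stiffF (Pi.single σ 1) t‖ ≤ K := fun σ =>
    isCompact_Icc.exists_bound_of_continuousOn
      (𝒯.continuousOn_stiffF hT hn (κ := fun τ _ => (Pi.single σ 1 : Fin 𝒯.M → ℝ) τ)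
        fun _ => continuousOn_const)
  choose K hK using hK
  refine ⟨fun ω => 𝒯.continuousOn_stiffF hT hn (hc ω), fun t ht => ?_, ∑ σ, C * K σ,
    fun ω t ht => ?_⟩
  · simp only [stiffF_eq_sum (𝒯 := 𝒯) (fun σ => κ _ σ t)]
    exact Finset.measurable_fun_sum _ fun σ _ => (hm σ t ht).smul_const _
  · rw [stiffF_eq_sum]
    refine (norm_sum_le _ _).trans (Finset.sum_le_sum fun σ _ => ?_)
    rw [norm_smul, Real.norm_eq_abs]
    exact mul_le_mul (hb ω σ t ht) (hK σ t ht) (norm_nonneg _) ((abs_nonneg _).trans (hb ω σ t ht))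

/-- `A` is a version of the stiffness operator of the coefficient `α`. -/
def IsStiffness (P : Measure Ω) (𝒯 : EvolvingMesh S) (α : Ω → ℝ → Amb n → ℝ)
    (A : Ω → ℝ → 𝒯.Cf →L[ℝ] 𝒯.Cf) : Prop :=
  ∀ᵐ ω ∂P, ∀ t ∈ Icc 0 T, A ω t = 𝒯.stiffF (fun σ => 𝒯.kap (S.invLift α ω) σ t) t

variable (𝒯) in
-- The coefficient is regular only almost surely, while the ODE is solved for every ω. On a
-- measurable null set the weights are replaced by zero, which leaves the ODE solvable because only
-- M must be inverted.
theorem exists_stiffness (hT : 0 < T) (hn : n = 1 ∨ n = 2) {αmin αmax : ℝ}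
    (h : S.DiffusionCoeff P αmin αmax α) :
    ∃ A : Ω → ℝ → 𝒯.Cf →L[ℝ] 𝒯.Cf, BddOp T A ∧ IsStiffness P 𝒯 α A := by
  classical
  obtain ⟨N, hsub, hN, hN0⟩ := exists_measurable_superset_of_null (ae_iff.1 h.ae_goodPath)
  have hgood : ∀ ω ∉ N, S.GoodPath αmin αmax (α ω) := fun ω hω => by
    by_contra hbad
    exact hω (hsub hbad)
  refine ⟨fun ω t => 𝒯.stiffF (fun σ => if ω ∈ N then 0 else 𝒯.kap (S.invLift α ω) σ t) t,
    bddOp_stiffF hT hn (C := max |αmin * refVol n| |αmax * refVol n|)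
      (κ := fun ω σ t => if ω ∈ N then 0 else 𝒯.kap (S.invLift α ω) σ t) ?_ ?_ ?_, ?_⟩
  · intro ω σ
    by_cases hω : ω ∈ N
    · simpa only [hω, if_true] using continuousOn_const
    · simp only [hω, if_false]
      exact continuousOn_kap (hgood ω hω) σ
  · exact fun σ t ht => Measurable.ite hN measurable_const (measurable_kap h.measurable ht σ)
  · intro ω σ t ht
    by_cases hω : ω ∈ N
    · simp only [hω, if_true, abs_zero]
      exact le_max_of_le_left (abs_nonneg _)
    · simp only [hω, if_false]
      have := kap_bounds (𝒯 := 𝒯) (hgood ω hω) ht σ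
      exact abs_le_max_abs_abs this.1 this.2
  · have : ∀ᵐ ω ∂P, ω ∉ N := measure_eq_zero_iff_ae_notMem.1 hN0
    filter_upwards [this] with ω hω t _
    simp [hω]

/-! ### The bilinear forms in nodal values -/

theorem mh_eq {t : ℝ} (ht : t ∈ Icc 0 T) {u φ : Ω → Amb n → ℝ} {c d : Ω → 𝒯.Cf}
    (hu : ∀ ω, EqOn (u ω) (𝒯.interp t (c ω)) (𝒯.Γh t))
    (hφ : ∀ ω, EqOn (φ ω) (𝒯.interp t (d ω)) (𝒯.Γh t)) :
    𝒯.mh P t u φ = ∫ ω, inner ℝ (𝒯.massF t (c ω)) (d ω) ∂P :=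
  integral_congr_ae (ae_of_all _ fun ω => surfInt_mul_eq ht (hu ω) (hφ ω))

theorem gh_eq {t : ℝ} (ht : t ∈ Icc 0 T) {u φ : Ω → Amb n → ℝ} {c d : Ω → 𝒯.Cf}
    (hu : ∀ ω, EqOn (u ω) (𝒯.interp t (c ω)) (𝒯.Γh t))
    (hφ : ∀ ω, EqOn (φ ω) (𝒯.interp t (d ω)) (𝒯.Γh t)) :
    𝒯.gh P t u φ = ∫ ω, inner ℝ (𝒯.divF t (c ω)) (d ω) ∂P :=
  integral_congr_ae (ae_of_all _ fun ω => surfInt_mul_div_eq ht (hu ω) (hφ ω))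

theorem ah_eq {A : Ω → ℝ → 𝒯.Cf →L[ℝ] 𝒯.Cf} (hA : IsStiffness P 𝒯 α A)
    {t : ℝ} (ht : t ∈ Icc 0 T) {u φ : Ω → Amb n → ℝ} {c d : Ω → 𝒯.Cf}
    (hu : ∀ ω, EqOn (u ω) (𝒯.interp t (c ω)) (𝒯.Γh t))
    (hφ : ∀ ω, EqOn (φ ω) (𝒯.interp t (d ω)) (𝒯.Γh t)) :
    𝒯.ah P α t u φ = ∫ ω, inner ℝ (A ω t (c ω)) (d ω) ∂P := by
  refine integral_congr_ae ?_
  filter_upwards [hA] with ω hω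
  rw [hω t ht]
  exact surfInt_stiff_eq ht (hu ω) (hφ ω) (S.invLift α ω t)

/-! ### The residual -/

/-- The residual of the system of ordinary differential equations for the nodal values. -/
def residual (A : Ω → ℝ → 𝒯.Cf →L[ℝ] 𝒯.Cf) (U : Ω → 𝒯.C1) (ω : Ω) (t : ℝ) : 𝒯.Cf :=
  𝒯.massF t ((U ω).coefDeriv t) + 𝒯.divF t ((U ω).coef t) + A ω t ((U ω).coef t)

variable [IsProbabilityMeasure P] {A : Ω → ℝ → 𝒯.Cf →L[ℝ] 𝒯.Cf} {U : Ω → 𝒯.C1}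

theorem l2Path_residual (hT : 0 < T) (hn : n = 1 ∨ n = 2) (hA : BddOp T A) (hU : 𝒯.MemWh P U) :
    L2Path P T (residual A U) := by
  obtain ⟨hc, hc'⟩ := l2Path_coef_coefDeriv hT hn hU
  exact (((BddOp.of_continuousOn (𝒯.continuousOn_massF hn)).apply hT.le hc').add hT.le
    ((BddOp.of_continuousOn (𝒯.continuousOn_divF hn)).apply hT.le hc)).add hT.le
    (hA.apply hT.le hc)

/-- The weak equation for φ at time t is thus equivalent to E[R · φ] = 0, R being the residual. -/
theorem ae_hasDerivAt_mh (hT : 0 < T) (hn : n = 1 ∨ n = 2) (hA : BddOp T A)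
    (hAα : IsStiffness P 𝒯 α A) (hU : 𝒯.MemWh P U) {φ : Ω → 𝒯.C1} (hφ : 𝒯.MemWh P φ) :
    ∀ᵐ t ∂(volume.restrict (Icc 0 T)),
      HasDerivAt (fun s => 𝒯.mh P s (fun ω => path (U ω).1 s) (fun ω => path (φ ω).1 s))
        (𝒯.mh P t (fun ω => path (U ω).1 t) (fun ω => 𝒯.matDeriv (path (φ ω).1) t)
          - 𝒯.ah P α t (fun ω => path (U ω).1 t) (fun ω => path (φ ω).1 t)
          + ∫ ω, inner ℝ (residual A U ω t) ((φ ω).coef t) ∂P) t := by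
  obtain ⟨hc, hc'⟩ := l2Path_coef_coefDeriv hT hn hU
  obtain ⟨hd, hd'⟩ := l2Path_coef_coefDeriv hT hn hφ
  have h0 : (0 : ℝ) ∈ Icc 0 T := left_mem_Icc.2 hT.le
  have hi := integrable_inner_of_sq ((𝒯.massF 0).measurable.comp (measurable_coef hT hn hU h0))
    (measurable_coef hT hn hφ h0).aestronglyMeasurable
    (integrable_sq_clm_apply _ (measurable_coef hT hn hU h0).aestronglyMeasurable
      (integrable_coef_sq hT hn hU h0)) (integrable_coef_sq hT hn hφ h0)
  have key := ae_hasDerivAt_integral_form hT (fun t ht => 𝒯.hasDerivWithinAt_massF hn ht)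
    (𝒯.continuousOn_divF hn) hA (fun ω t ht => (U ω).hasDerivWithinAt_coef hT ht)
    (fun ω t ht => (φ ω).hasDerivWithinAt_coef hT ht) hc hc' hd hd' hi
  filter_upwards [key] with t ⟨ht, hder⟩
  have ht' := Ioo_subset_Icc_self ht
  rw [mh_eq ht' (fun ω => (U ω).eqOn_path ht') (fun ω => (φ ω).eqOn_matDeriv hT ht'),
    ah_eq hAα ht' (fun ω => (U ω).eqOn_path ht') (fun ω => (φ ω).eqOn_path ht')]
  refine hder.congr_of_eventuallyEq ?_
  filter_upwards [Icc_mem_nhds ht.1 ht.2] with s hs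
  exact mh_eq hs (fun ω => (U ω).eqOn_path hs) (fun ω => (φ ω).eqOn_path hs)

/-- The exceptional times depend only on U: they are those at which M c', G c or A c fails to be
square integrable in ω. -/
theorem ae_forms_eq_residual (hT : 0 < T) (hn : n = 1 ∨ n = 2) (hA : BddOp T A)
    (hAα : IsStiffness P 𝒯 α A) (hU : 𝒯.MemWh P U) :
    ∀ᵐ t ∂(volume.restrict (Icc 0 T)), ∀ φ : Ω → 𝒯.Sh t, 𝒯.MemVh P t φ →
    𝒯.mh P t (fun ω => 𝒯.matDeriv (path (U ω).1) t) (fun ω => ext (φ ω))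
      + 𝒯.ah P α t (fun ω => path (U ω).1 t) (fun ω => ext (φ ω))
      + 𝒯.gh P t (fun ω => path (U ω).1 t) (fun ω => ext (φ ω)) =
      ∫ ω, inner ℝ (residual A U ω t) (𝒯.nodalL t (φ ω)) ∂P := by
  obtain ⟨hc, hc'⟩ := l2Path_coef_coefDeriv hT hn hU
  have hMc := (BddOp.of_continuousOn (Ω := Ω) (𝒯.continuousOn_massF hn)).apply hT.le hc'
  have hGc := (BddOp.of_continuousOn (Ω := Ω) (𝒯.continuousOn_divF hn)).apply hT.le hc
  have hAc := hA.apply hT.le hc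
  obtain ⟨l, hl, hlow⟩ := 𝒯.exists_le_normForm hn
  filter_upwards [hMc.ae_integrable_sq, hGc.ae_integrable_sq, hAc.ae_integrable_sq,
    ae_restrict_mem measurableSet_Icc] with t i1 i2 i3 ht φ hφ
  have hext : ∀ ω, EqOn (ext (φ ω)) (𝒯.interp t (𝒯.nodalL t (φ ω))) (𝒯.Γh t) := by
    intro ω x hx
    rw [nodalL_apply]
    exact ext_eq_interp ht _ hx
  have hφm : AEStronglyMeasurable (fun ω => 𝒯.nodalL t (φ ω)) P :=
    (𝒯.nodalL t).continuous.comp_aestronglyMeasurable hφ.1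
  have hφ2 : Integrable (fun ω => ‖𝒯.nodalL t (φ ω)‖ ^ 2) P := by
    refine (hφ.2.const_mul l⁻¹).mono' (hφm.norm.pow 2) (ae_of_all _ fun ω => ?_)
    rw [Real.norm_of_nonneg (by positivity), h1sq_eq ht (hext ω), inv_mul_eq_div, le_div_iff₀ hl]
    have := hlow t ht (𝒯.nodalL t (φ ω)) 0
    simp only [normForm, dirF, norm_zero, map_zero, inner_zero_left] at this
    linarith
  rw [mh_eq ht (fun ω => (U ω).eqOn_matDeriv hT ht) hext,
    ah_eq hAα ht (fun ω => (U ω).eqOn_path ht) hext, gh_eq ht (fun ω => (U ω).eqOn_path ht) hext]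
  have j1 := integrable_inner_of_sq (hMc.meas t ht) hφm i1 hφ2
  have j2 := integrable_inner_of_sq (hGc.meas t ht) hφm i2 hφ2
  have j3 := integrable_inner_of_sq (hAc.meas t ht) hφm i3 hφ2
  have j13 : Integrable (fun ω => inner ℝ (𝒯.massF t ((U ω).coefDeriv t)) (𝒯.nodalL t (φ ω)) +
      inner ℝ (A ω t ((U ω).coef t)) (𝒯.nodalL t (φ ω))) P := j1.add j3
  rw [← integral_add j1 j3, ← integral_add j13 j2]
  refine integral_congr_ae (ae_of_all _ fun ω => ?_)
  simp only [residual, inner_add_left]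
  ring

theorem isSolution_of_residual (hT : 0 < T) (hn : n = 1 ∨ n = 2) (hA : BddOp T A)
    (hAα : IsStiffness P 𝒯 α A) (hU : 𝒯.MemWh P U) {U₀ : Ω → 𝒯.Sh 0}
    (h0 : ∀ᵐ ω ∂P, (U ω).1 0 = U₀ ω) (hR : ∀ ω, ∀ t ∈ Icc 0 T, residual A U ω t = 0) :
    𝒯.IsSolution P α U₀ U ∧ 𝒯.IsSolution' P α U₀ U := by
  refine ⟨⟨h0, fun φ hφ => ?_⟩, h0, ?_⟩
  · filter_upwards [ae_hasDerivAt_mh hT hn hA hAα hU hφ, ae_restrict_mem measurableSet_Icc]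
      with t h ht
    simpa [hR _ t ht] using h
  · filter_upwards [ae_forms_eq_residual hT hn hA hAα hU, ae_restrict_mem measurableSet_Icc]
      with t h ht φ hφ
    rw [h φ hφ]
    simp [hR _ t ht]

/-- Either formulation can be tested with nodal values that are random but constant in time, which
is what `L2Path.eq_zero` needs. -/
theorem residual_eq_zero (hT : 0 < T) (hn : n = 1 ∨ n = 2) (hA : BddOp T A)
    (hAα : IsStiffness P 𝒯 α A) (hU : 𝒯.MemWh P U) {U₀ : Ω → 𝒯.Sh 0}
    (h : 𝒯.IsSolution P α U₀ U ∨ 𝒯.IsSolution' P α U₀ U) :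
    ∀ᵐ ω ∂P, ∀ t ∈ Icc 0 T, residual A U ω t = 0 := by
  refine (l2Path_residual hT hn hA hU).eq_zero hT fun φ hφm hφ2 => ?_
  rcases h with h | h
  · have hd : ∀ ω, ∀ t ∈ Icc 0 T, HasDerivWithinAt (fun _ => φ ω)
        ((fun _ _ => 0 : Ω → ℝ → 𝒯.Cf) ω t)
        (Icc 0 T) t := fun ω t _ => hasDerivWithinAt_const _ _ _
    -- Constant nodal values have zero material derivative and give an admissible test function in
    -- W_h.
    have hmem := memWh_mkC1 (P := P) hT hn (c := fun ω _ => φ ω) (c' := fun _ _ => 0)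
      (fun _ => contDiffOn_const) hd (L2Path.const hφm hφ2)
      (L2Path.const (φ := fun _ => 0) measurable_const (by simp))
    filter_upwards [ae_hasDerivAt_mh hT hn hA hAα hU hmem, h.2 _ hmem,
      ae_restrict_mem measurableSet_Icc] with t h1 h2 ht
    have h3 := h1.unique h2
    simp only [𝒯.coef_mkC1 hT _ _ ht] at h3
    linarith
  · filter_upwards [ae_forms_eq_residual hT hn hA hAα hU, h.2, ae_restrict_mem measurableSet_Icc]
      with t h1 h2 ht
    have hint : ∀ ω, EqOn (ext (𝒯.mkSh ht (φ ω))) (𝒯.interp t (φ ω)) (𝒯.Γh t) := fun ω x hx =>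
      𝒯.ext_mkSh ht (φ ω) hx
    have hmem : 𝒯.MemVh P t fun ω => 𝒯.mkSh ht (φ ω) := by
      refine ⟨(𝒯.mkShL ht).continuous.comp_aestronglyMeasurable hφm.aestronglyMeasurable, ?_⟩
      simp only [h1sq_eq ht (hint _)]
      exact (integrable_inner_of_sq ((𝒯.massF t).measurable.comp hφm) hφm.aestronglyMeasurable
        (integrable_sq_clm_apply _ hφm.aestronglyMeasurable hφ2) hφ2).add
        (integrable_inner_of_sq ((𝒯.dirF t).measurable.comp hφm) hφm.aestronglyMeasurable
        (integrable_sq_clm_apply _ hφm.aestronglyMeasurable hφ2) hφ2)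
    have h3 := h1 _ hmem
    rw [h2 _ hmem] at h3
    simpa [nodalL_apply, nodal_mkSh] using h3.symm

end EvolvingMesh

end ESFEM

end

/-! ### Pathwise stability, existence and uniqueness, expectations. -/

noncomputable section

open MeasureTheory Set Filter Topology

namespace ESFEM

/-- Fubini for the expectation of a time dependent quadratic form along a random path. -/
theorem L2Path.integral_form_swap {E Ω : Type*} [NormedAddCommGroup E] [InnerProductSpace ℝ E]
    [FiniteDimensional ℝ E] [MeasurableSpace E] [BorelSpace E] [MeasurableSpace Ω] {P : Measure Ω}
    [IsProbabilityMeasure P] {T : ℝ} (hT : 0 < T) {M : ℝ → E →L[ℝ] E}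
    (hM : ContinuousOn M (Icc 0 T)) {c : Ω → ℝ → E} (hc : L2Path P T c) :
    ∫ t in (0 : ℝ)..T, (∫ ω, inner ℝ (M t (c ω t)) (c ω t) ∂P) =
      ∫ ω, (∫ t in (0 : ℝ)..T, inner ℝ (M t (c ω t)) (c ω t)) ∂P ∧
    Integrable (fun ω => ∫ t in (0 : ℝ)..T, inner ℝ (M t (c ω t)) (c ω t)) P := by
  have hi := ((BddOp.of_continuousOn hM).apply hT.le hc).integrable_inner hT.le hc
  simp only [← integral_Icc_eq_interval hT.le]
  exact ⟨(integral_integral_swap hi).symm, hi.integral_prod_left⟩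

namespace EvolvingMesh

variable {n : ℕ} {T : ℝ} {S : EvolvingSurface n T} {𝒯 : EvolvingMesh S}

theorem abs_divE_le {D : ℝ} {t : ℝ} (ht : t ∈ Icc 0 T)
    (hD : ∀ σ, ∀ x ∈ 𝒯.E σ t, |𝒯.divVh σ t x| ≤ D) (σ : Fin 𝒯.M) : |𝒯.divE σ t| ≤ D := by
  have hx : 𝒯.X (𝒯.elem σ 0) t ∈ 𝒯.E σ t := subset_convexHull ℝ _ ⟨0, rfl⟩
  rw [← 𝒯.divVh_eq ht σ hx]
  exact hD σ _ hx

/-! ### Pathwise estimates -/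

section Pathwise

variable {αmin αmax D B : ℝ} {a : ℝ → Amb n → ℝ} {c c' : ℝ → 𝒯.Cf}

theorem le_inner_stiffF (h : S.GoodPath αmin αmax a) {t : ℝ} (ht : t ∈ Icc 0 T) (c : 𝒯.Cf) :
    αmin * inner ℝ (𝒯.dirF t c) c ≤
      inner ℝ (𝒯.stiffF (fun σ => 𝒯.kap (S.pathLift a) σ t) t c) c := by
  rw [dirF, ← stiffF_smul]
  exact 𝒯.stiffF_mono ht (fun σ => (kap_bounds h ht σ).1) c

theorem inner_stiffF_le (h : S.GoodPath αmin αmax a) {t : ℝ} (ht : t ∈ Icc 0 T) (c : 𝒯.Cf) :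
    inner ℝ (𝒯.stiffF (fun σ => 𝒯.kap (S.pathLift a) σ t) t c) c ≤
      αmax * inner ℝ (𝒯.dirF t c) c := by
  rw [dirF, ← stiffF_smul]
  exact 𝒯.stiffF_mono ht (fun σ => (kap_bounds h ht σ).2) c

/-- The square of the constant of the first stability estimate. -/
def stabSq (T αmin D : ℝ) : ℝ := Real.exp (|D| * T) * (T + 1 / (2 * αmin))

theorem stabSq_nonneg (hT : 0 < T) (hα : 0 < αmin) : 0 ≤ stabSq T αmin D := by
  unfold stabSq
  positivity

theorem pathwise_h1_estimate (hT : 0 < T) (hn : n = 1 ∨ n = 2) (hα : 0 < αmin)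
    (h : S.GoodPath αmin αmax a) (hD : ∀ t ∈ Icc 0 T, ∀ σ, |𝒯.divE σ t| ≤ D)
    (hc : ∀ t ∈ Icc 0 T, HasDerivWithinAt c (c' t) (Icc 0 T) t)
    (heq : ∀ t ∈ Icc 0 T, 𝒯.massF t (c' t) + 𝒯.divF t (c t) +
      𝒯.stiffF (fun σ => 𝒯.kap (S.pathLift a) σ t) t (c t) = 0) :
    ∫ t in (0 : ℝ)..T, (inner ℝ (𝒯.massF t (c t)) (c t) + inner ℝ (𝒯.dirF t (c t)) (c t)) ≤
      stabSq T αmin D * inner ℝ (𝒯.massF 0 (c 0)) (c 0) := by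
  have hcc : ContinuousOn c (Icc 0 T) := fun t ht => (hc t ht).continuousWithinAt
  have hi : ∀ {f : ℝ → ℝ}, ContinuousOn f (Icc 0 T) → IntervalIntegrable f volume 0 T :=
    fun hf => ContinuousOn.intervalIntegrable (by rwa [uIcc_of_le hT.le])
  have im := hi (continuousOn_form (𝒯.continuousOn_massF hn) hcc hcc)
  have ik := hi (continuousOn_form (𝒯.continuousOn_dirF hT hn) hcc hcc)
  obtain ⟨h1, h2⟩ := energy_estimate hT.le hα (fun t ht => 𝒯.hasDerivWithinAt_massF hn ht)
    𝒯.massF_symm 𝒯.massF_nonneg (𝒯.continuousOn_dirF hT hn) (fun t ht c => 𝒯.dirF_nonneg ht c)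
    (fun t ht c => le_inner_stiffF h ht c) (fun t ht c => 𝒯.abs_divF_le (hD t ht) c) hc heq
  rw [intervalIntegral.integral_add im ik]
  -- Integrating the bound on the mass over [0,T] produces the term T in `stabSq`; the Dirichlet
  -- part produces 1/(2 αmin).
  have h3 := intervalIntegral.integral_mono_on hT.le im (by simp) h1
  rw [intervalIntegral.integral_const, smul_eq_mul, sub_zero] at h3
  refine (add_le_add h3 h2).trans_eq ?_
  rw [stabSq]
  ring

theorem pathwise_matDeriv_estimate (hT : 0 < T) (hn : n = 1 ∨ n = 2) (hα : 0 < αmin)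
    (h : S.GoodPath αmin αmax a) (hD : ∀ t ∈ Icc 0 T, ∀ σ, |𝒯.divE σ t| ≤ D)
    (hB : ∀ t ∈ Icc 0 T, ∀ σ, ∀ x ∈ 𝒯.E σ t, ‖𝒯.Bh (S.pathLift a) σ t x‖ ≤ B)
    (hc : ∀ t ∈ Icc 0 T, HasDerivWithinAt c (c' t) (Icc 0 T) t) (hc' : ContinuousOn c' (Icc 0 T))
    (heq : ∀ t ∈ Icc 0 T, 𝒯.massF t (c' t) + 𝒯.divF t (c t) +
      𝒯.stiffF (fun σ => 𝒯.kap (S.pathLift a) σ t) t (c t) = 0) :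
    ∫ t in (0 : ℝ)..T, inner ℝ (𝒯.massF t (c' t)) (c' t) ≤
      ((|B| + D ^ 2) * stabSq T αmin D + |αmax|) *
        (inner ℝ (𝒯.massF 0 (c 0)) (c 0) + inner ℝ (𝒯.dirF 0 (c 0)) (c 0)) := by
  have hcc : ContinuousOn c (Icc 0 T) := fun t ht => (hc t ht).continuousWithinAt
  have hi : ∀ {f : ℝ → ℝ}, ContinuousOn f (Icc 0 T) → IntervalIntegrable f volume 0 T :=
    fun hf => ContinuousOn.intervalIntegrable (by rwa [uIcc_of_le hT.le])
  have im := hi (continuousOn_form (𝒯.continuousOn_massF hn) hcc hcc)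
  have ik := hi (continuousOn_form (𝒯.continuousOn_dirF hT hn) hcc hcc)
  have h0 : (0 : ℝ) ∈ Icc 0 T := left_mem_Icc.2 hT.le
  have hA0 : ∀ t ∈ Icc 0 T, ∀ c : 𝒯.Cf,
      0 ≤ inner ℝ (𝒯.stiffF (fun σ => 𝒯.kap (S.pathLift a) σ t) t c) c := fun t ht c =>
    (mul_nonneg hα.le (𝒯.dirF_nonneg ht c)).trans (le_inner_stiffF h ht c)
  have h1 := higher_energy_estimate hT.le (𝒯.continuousOn_massF hn) (𝒯.continuousOn_dirF hT hn)
    (𝒯.continuousOn_stiffF hT hn (κ := fun σ => 𝒯.kap (S.pathLift a) σ)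
      fun σ => continuousOn_kap h σ)
    (fun t ht => 𝒯.stiffF_symm ht _) hA0
    (fun t ht => exists_hasDerivAt_stiffF hT hn h hB hD ht)
    (fun t ht c d => 𝒯.two_mul_abs_divF_le (hD t ht) c d) hc hc' heq
  have h2 := pathwise_h1_estimate hT hn hα h hD hc heq
  rw [intervalIntegral.integral_add im ik] at h2
  have hm0 := 𝒯.massF_nonneg 0 (c 0)
  have hk0 := 𝒯.dirF_nonneg h0 (c 0)
  have hm : 0 ≤ ∫ t in (0 : ℝ)..T, inner ℝ (𝒯.massF t (c t)) (c t) :=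
    intervalIntegral.integral_nonneg hT.le fun t _ => 𝒯.massF_nonneg t _
  have hk : 0 ≤ ∫ t in (0 : ℝ)..T, inner ℝ (𝒯.dirF t (c t)) (c t) :=
    intervalIntegral.integral_nonneg hT.le fun t ht => 𝒯.dirF_nonneg ht _
  have ha := (inner_stiffF_le h h0 (c 0)).trans
    (mul_le_mul_of_nonneg_right (le_abs_self αmax) hk0)
  set m := ∫ t in (0 : ℝ)..T, inner ℝ (𝒯.massF t (c t)) (c t)
  set k := ∫ t in (0 : ℝ)..T, inner ℝ (𝒯.dirF t (c t)) (c t)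
  set m0 := inner ℝ (𝒯.massF 0 (c 0)) (c 0)
  set k0 := inner ℝ (𝒯.dirF 0 (c 0)) (c 0)
  have hX := stabSq_nonneg (D := D) hT hα
  have e1 : B * k + D ^ 2 * m ≤ (|B| + D ^ 2) * (m + k) := by
    have := mul_le_mul_of_nonneg_right (le_abs_self B) hk
    nlinarith [mul_nonneg (abs_nonneg B) hm, mul_nonneg (sq_nonneg D) hk]
  have e2 : (|B| + D ^ 2) * (m + k) ≤ (|B| + D ^ 2) * (stabSq T αmin D * m0) :=
    mul_le_mul_of_nonneg_left h2 (by positivity)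
  have e3 : 0 ≤ (|B| + D ^ 2) * stabSq T αmin D * k0 :=
    mul_nonneg (mul_nonneg (by positivity) hX) hk0
  have e4 : 0 ≤ |αmax| * m0 := mul_nonneg (abs_nonneg _) hm0
  refine h1.trans ?_
  linarith

end Pathwise

/-! ### Existence and uniqueness -/

variable {Ω : Type*} [MeasurableSpace Ω] {P : Measure Ω} {α : Ω → ℝ → Amb n → ℝ}
  [IsProbabilityMeasure P] {A : Ω → ℝ → 𝒯.Cf →L[ℝ] 𝒯.Cf}

theorem exists_solution (hT : 0 < T) (hn : n = 1 ∨ n = 2) (hA : BddOp T A) {U₀ : Ω → 𝒯.Sh 0}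
    (hU₀ : 𝒯.MemVh P 0 U₀) : ∃ U : Ω → 𝒯.C1, 𝒯.MemWh P U ∧ (∀ᵐ ω ∂P, (U ω).1 0 = U₀ ω) ∧
      ∀ ω, ∀ t ∈ Icc 0 T, residual A U ω t = 0 := by
  have h0 : (0 : ℝ) ∈ Icc 0 T := left_mem_Icc.2 hT.le
  -- The data are measurable only up to a null set; a strongly measurable version makes the initial
  -- nodal values measurable, at the cost of attaining the data almost surely.
  set V := hU₀.1.mk U₀
  have hVe : U₀ =ᵐ[P] V := hU₀.1.ae_eq_mk
  let c₀ : Ω → 𝒯.Cf := fun ω => 𝒯.nodalL 0 (V ω)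
  have hc₀s : StronglyMeasurable c₀ :=
    (𝒯.nodalL 0).continuous.comp_stronglyMeasurable hU₀.1.stronglyMeasurable_mk
  have hc₀ : Measurable c₀ := hc₀s.measurable
  obtain ⟨l, hl, hlow⟩ := 𝒯.exists_le_normForm hn
  have hc₀2 : Integrable (fun ω => ‖c₀ ω‖ ^ 2) P := by
    refine (hU₀.2.const_mul l⁻¹).mono' (hc₀.norm.pow_const 2).aestronglyMeasurable ?_
    filter_upwards [hVe] with ω hω
    have hext : EqOn (ext (U₀ ω)) (𝒯.interp 0 (c₀ ω)) (𝒯.Γh 0) := by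
      intro x hx
      simp only [c₀]
      rw [nodalL_apply, ← hω]
      exact ext_eq_interp h0 _ hx
    rw [Real.norm_of_nonneg (by positivity), h1sq_eq h0 hext, inv_mul_eq_div, le_div_iff₀ hl]
    have := hlow 0 h0 (c₀ ω) 0
    simp only [normForm, dirF, norm_zero, map_zero, inner_zero_left] at this
    linarith
  obtain ⟨K, hK⟩ := hA.bdd
  obtain ⟨c, c', C, hc0, hd, hc', heq, hcm, hcm', hb⟩ := exists_measurable_solution hT.le
    (𝒯.continuousOn_massF hn) (𝒯.continuousOn_divF hn) (fun t ht c hc => 𝒯.massF_pos ht hc)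
    hA.cont hA.meas hK hc₀
  have hdw : ∀ ω, ∀ t ∈ Icc 0 T, HasDerivWithinAt (c ω) (c' ω t) (Icc 0 T) t :=
    fun ω t _ => (hd ω t).hasDerivWithinAt
  have hcont : ∀ ω, Continuous (c ω) := fun ω =>
    continuous_iff_continuousAt.2 fun t => (hd ω t).continuousAt
  have hL2 : ∀ f : Ω → ℝ → 𝒯.Cf, (∀ ω, Continuous (f ω)) → (∀ t, Measurable fun ω => f ω t) →
      (∀ ω, ∀ t ∈ Icc 0 T, ‖f ω t‖ ≤ C * ‖c₀ ω‖) → L2Path P T f := by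
    intro f hf hfm hfb
    refine l2Path_of_le hT (fun ω => (hf ω).continuousOn) (fun t _ => hfm t)
      (hc₀2.const_mul (T * C ^ 2)) fun ω => ?_
    have := intervalIntegral.integral_mono_on (μ := volume) hT.le
      (((hf ω).norm.pow 2).intervalIntegrable 0 T)
      (intervalIntegrable_const (c := (C * ‖c₀ ω‖) ^ 2))
      fun t ht => pow_le_pow_left₀ (norm_nonneg _) (hfb ω t ht) 2
    refine this.trans_eq ?_
    rw [intervalIntegral.integral_const, smul_eq_mul]
    ring
  have hcd : ∀ ω, ContDiffOn ℝ 1 (c ω) (Icc 0 T) := fun ω =>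
    contDiffOn_of_hasDerivWithinAt hT (hdw ω) (hc' ω).continuousOn
  refine ⟨fun ω => 𝒯.mkC1 hT (c ω) (hcd ω), memWh_mkC1 hT hn hcd hdw
    (hL2 c hcont hcm fun ω t ht => (hb ω t ht).1) (hL2 c' hc' hcm' fun ω t ht => (hb ω t ht).2),
    ?_, ?_⟩
  · filter_upwards [hVe] with ω hω
    rw [𝒯.mkC1_apply hT _ _ h0, hc0, hω]
    simp only [c₀]
    rw [nodalL_apply]
    exact 𝒯.mkSh_nodal h0 _
  · intro ω t ht
    rw [residual, 𝒯.coef_mkC1 hT _ _ ht, coefDeriv_mkC1 hT _ (hdw ω) ht]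
    exact heq ω t ht

/-- The difference of two paths with zero residual solves the homogeneous linear equation with zero
initial value. -/
theorem solution_unique (hT : 0 < T) (hn : n = 1 ∨ n = 2) (hA : BddOp T A)
    {U U' : Ω → 𝒯.C1} {ω : Ω} (h0 : (U' ω).1 0 = (U ω).1 0)
    (hU : ∀ t ∈ Icc 0 T, residual A U ω t = 0) (hU' : ∀ t ∈ Icc 0 T, residual A U' ω t = 0) :
    ∀ t ∈ Icc 0 T, (U' ω).1 t = (U ω).1 t := by
  intro t ht
  refine C1.eq_of_coef_eq 𝒯 ht (sub_eq_zero.1 ?_)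
  refine eq_zero_of_linear_ode (c := fun t => (U' ω).coef t - (U ω).coef t)
    (c' := fun t => (U' ω).coefDeriv t - (U ω).coefDeriv t)
    (G := fun t => 𝒯.divF t + A ω t) (𝒯.continuousOn_massF hn)
    ((𝒯.continuousOn_divF hn).add (hA.cont ω)) (fun t ht c hc => 𝒯.massF_pos ht hc)
    (fun t ht => ((U' ω).hasDerivWithinAt_coef hT ht).sub ((U ω).hasDerivWithinAt_coef hT ht))
    (fun t ht => ?_) (by simp [C1.coef, h0]) t ht
  have h1 := hU t ht
  have h2 := hU' t ht
  simp only [residual] at h1 h2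
  simp only [map_sub, add_apply]
  rw [← sub_eq_zero.2 (h2.trans h1.symm)]
  abel

/-! ### Expectations of the norms -/

theorem integral_h1sq (hT : 0 < T) (hn : n = 1 ∨ n = 2) {U : Ω → 𝒯.C1} (hU : 𝒯.MemWh P U) :
    ∫ t in (0 : ℝ)..T, ∫ ω, 𝒯.h1sq t (path (U ω).1 t) ∂P =
      ∫ ω, (∫ t in (0 : ℝ)..T, (inner ℝ (𝒯.massF t ((U ω).coef t)) ((U ω).coef t) +
        inner ℝ (𝒯.dirF t ((U ω).coef t)) ((U ω).coef t))) ∂P ∧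
    Integrable (fun ω => ∫ t in (0 : ℝ)..T, (inner ℝ (𝒯.massF t ((U ω).coef t)) ((U ω).coef t) +
        inner ℝ (𝒯.dirF t ((U ω).coef t)) ((U ω).coef t))) P := by
  obtain ⟨h1, h2⟩ := (l2Path_coef_coefDeriv hT hn hU).1.integral_form_swap hT
    (M := fun t => 𝒯.massF t + 𝒯.dirF t)
    ((𝒯.continuousOn_massF hn).add (𝒯.continuousOn_dirF hT hn))
  simp only [add_apply, inner_add_left] at h1 h2
  refine ⟨?_, h2⟩
  rw [← h1]
  refine intervalIntegral.integral_congr fun t ht => ?_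
  rw [uIcc_of_le hT.le] at ht
  exact integral_congr_ae (ae_of_all _ fun ω => h1sq_eq ht ((U ω).eqOn_path ht))

theorem integral_l2sq_matDeriv (hT : 0 < T) (hn : n = 1 ∨ n = 2) {U : Ω → 𝒯.C1}
    (hU : 𝒯.MemWh P U) :
    ∫ t in (0 : ℝ)..T, ∫ ω, 𝒯.l2sq t (𝒯.matDeriv (path (U ω).1) t) ∂P =
      ∫ ω, (∫ t in (0 : ℝ)..T, inner ℝ (𝒯.massF t ((U ω).coefDeriv t)) ((U ω).coefDeriv t)) ∂P ∧
    Integrable (fun ω => ∫ t in (0 : ℝ)..T,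
      inner ℝ (𝒯.massF t ((U ω).coefDeriv t)) ((U ω).coefDeriv t)) P := by
  obtain ⟨h1, h2⟩ := (l2Path_coef_coefDeriv hT hn hU).2.integral_form_swap hT
    (𝒯.continuousOn_massF hn)
  refine ⟨?_, h2⟩
  rw [← h1]
  refine intervalIntegral.integral_congr fun t ht => ?_
  rw [uIcc_of_le hT.le] at ht
  exact integral_congr_ae (ae_of_all _ fun ω => l2sq_eq ht ((U ω).eqOn_matDeriv hT ht))

theorem h1sq_initial (hT : 0 < T) {U : Ω → 𝒯.C1} {U₀ : Ω → 𝒯.Sh 0} {ω : Ω}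
    (h : (U ω).1 0 = U₀ ω) : 𝒯.h1sq 0 (ext (U₀ ω)) =
      inner ℝ (𝒯.massF 0 ((U ω).coef 0)) ((U ω).coef 0) +
        inner ℝ (𝒯.dirF 0 ((U ω).coef 0)) ((U ω).coef 0) := by
  rw [← h]
  exact h1sq_eq (left_mem_Icc.2 hT.le) ((U ω).eqOn_path (left_mem_Icc.2 hT.le))

/-- The nodal values of `U` solve the system of ordinary differential equations pathwise. -/
def SolvesODE (P : Measure Ω) (α : Ω → ℝ → Amb n → ℝ) (U : Ω → 𝒯.C1) : Prop :=
  ∀ᵐ ω ∂P, ∀ t ∈ Icc 0 T, 𝒯.massF t ((U ω).coefDeriv t) + 𝒯.divF t ((U ω).coef t) +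
    𝒯.stiffF (fun σ => 𝒯.kap (S.pathLift (α ω)) σ t) t ((U ω).coef t) = 0

section Stability

variable {αmin αmax D B : ℝ} {U : Ω → 𝒯.C1} {U₀ : Ω → 𝒯.Sh 0}

theorem integral_h1sq_le (hT : 0 < T) (hn : n = 1 ∨ n = 2) (hαmin : 0 < αmin)
    (hα : S.DiffusionCoeff P αmin αmax α) (hU : 𝒯.MemWh P U) (hode : SolvesODE P α U)
    (hU₀ : 𝒯.MemVh P 0 U₀) (h0 : ∀ᵐ ω ∂P, (U ω).1 0 = U₀ ω)
    (hD : ∀ t ∈ Icc 0 T, ∀ σ, |𝒯.divE σ t| ≤ D) :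
    ∫ t in (0 : ℝ)..T, ∫ ω, 𝒯.h1sq t (path (U ω).1 t) ∂P ≤
      stabSq T αmin D * ∫ ω, 𝒯.h1sq 0 (ext (U₀ ω)) ∂P := by
  obtain ⟨e, i⟩ := integral_h1sq hT hn hU
  rw [e, ← integral_const_mul]
  refine integral_mono_ae i (hU₀.2.const_mul _) ?_
  filter_upwards [hα.ae_goodPath, hode, h0] with ω hg ho hi
  rw [h1sq_initial hT hi]
  refine (pathwise_h1_estimate hT hn hαmin hg hD
    (fun t ht => (U ω).hasDerivWithinAt_coef hT ht) ho).trans ?_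
  exact mul_le_mul_of_nonneg_left
    (le_add_of_nonneg_right (𝒯.dirF_nonneg (left_mem_Icc.2 hT.le) _)) (stabSq_nonneg hT hαmin)

theorem integral_l2sq_matDeriv_le (hT : 0 < T) (hn : n = 1 ∨ n = 2) (hαmin : 0 < αmin)
    (hα : S.DiffusionCoeff P αmin αmax α) (hU : 𝒯.MemWh P U) (hode : SolvesODE P α U)
    (hU₀ : 𝒯.MemVh P 0 U₀) (h0 : ∀ᵐ ω ∂P, (U ω).1 0 = U₀ ω)
    (hD : ∀ t ∈ Icc 0 T, ∀ σ, |𝒯.divE σ t| ≤ D)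
    (hB : ∀ᵐ ω ∂P, ∀ t ∈ Icc 0 T, ∀ σ, ∀ x ∈ 𝒯.E σ t, ‖𝒯.Bh (S.invLift α ω) σ t x‖ ≤ B) :
    ∫ t in (0 : ℝ)..T, ∫ ω, 𝒯.l2sq t (𝒯.matDeriv (path (U ω).1) t) ∂P ≤
      ((|B| + D ^ 2) * stabSq T αmin D + |αmax|) * ∫ ω, 𝒯.h1sq 0 (ext (U₀ ω)) ∂P := by
  obtain ⟨e, i⟩ := integral_l2sq_matDeriv hT hn hU
  rw [e, ← integral_const_mul]
  refine integral_mono_ae i (hU₀.2.const_mul _) ?_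
  filter_upwards [hα.ae_goodPath, hode, h0, hB] with ω hg ho hi hb
  rw [h1sq_initial hT hi]
  exact pathwise_matDeriv_estimate hT hn hαmin hg hD hb
    (fun t ht => (U ω).hasDerivWithinAt_coef hT ht) ((U ω).continuousOn_coefDeriv hT) ho

theorem normL2Vh_le (hT : 0 < T) (hn : n = 1 ∨ n = 2) (hαmin : 0 < αmin)
    (hα : S.DiffusionCoeff P αmin αmax α) (hU : 𝒯.MemWh P U) (hode : SolvesODE P α U)
    (hU₀ : 𝒯.MemVh P 0 U₀) (h0 : ∀ᵐ ω ∂P, (U ω).1 0 = U₀ ω)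
    (hD : ∀ t ∈ Icc 0 T, ∀ σ, |𝒯.divE σ t| ≤ D) :
    𝒯.normL2Vh P U ≤ √(stabSq T αmin D) * 𝒯.normVh P 0 U₀ := by
  rw [normL2Vh, normVh, ← Real.sqrt_mul (stabSq_nonneg hT hαmin)]
  exact Real.sqrt_le_sqrt (integral_h1sq_le hT hn hαmin hα hU hode hU₀ h0 hD)

theorem normWh_le (hT : 0 < T) (hn : n = 1 ∨ n = 2) (hαmin : 0 < αmin)
    (hα : S.DiffusionCoeff P αmin αmax α) (hU : 𝒯.MemWh P U) (hode : SolvesODE P α U)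
    (hU₀ : 𝒯.MemVh P 0 U₀) (h0 : ∀ᵐ ω ∂P, (U ω).1 0 = U₀ ω)
    (hD : ∀ t ∈ Icc 0 T, ∀ σ, |𝒯.divE σ t| ≤ D)
    (hB : ∀ᵐ ω ∂P, ∀ t ∈ Icc 0 T, ∀ σ, ∀ x ∈ 𝒯.E σ t, ‖𝒯.Bh (S.invLift α ω) σ t x‖ ≤ B) :
    𝒯.normWh P U ≤ √(stabSq T αmin D + ((|B| + D ^ 2) * stabSq T αmin D + |αmax|)) *
      𝒯.normVh P 0 U₀ := by
  have hX : 0 ≤ stabSq T αmin D := stabSq_nonneg hT hαmin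
  rw [normWh, normVh, ← Real.sqrt_mul (by positivity), add_mul]
  exact Real.sqrt_le_sqrt (add_le_add (integral_h1sq_le hT hn hαmin hα hU hode hU₀ h0 hD)
    (integral_l2sq_matDeriv_le hT hn hαmin hα hU hode hU₀ h0 hD hB))

end Stability

end EvolvingMesh

end ESFEM

end

theorem mainTheorem2 (T αmin D : ℝ) (hT : 0 < T) (hαmin : 0 < αmin) :
    -- `C₁` depends only on `T`, `αmin` and the bound `D` for `∇_{Γ_h} · V_h`
    ∃ C₁ : ℝ, ∀ αmax B : ℝ,
    -- `C₂` depends in addition only on `αmax` and the bound `B` for the tensor `B_h`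
    ∃ C₂ : ℝ,
    ∀ (n : ℕ) (_ : n = 1 ∨ n = 2) (S : ESFEM.EvolvingSurface n T) (𝒯 : ESFEM.EvolvingMesh S)
      (Ω : Type*) [MeasurableSpace Ω] (P : MeasureTheory.Measure Ω)
      [MeasureTheory.IsProbabilityMeasure P]
      (α : Ω → ℝ → ESFEM.Amb n → ℝ) (_ : S.DiffusionCoeff P αmin αmax α)
      (U₀ : Ω → 𝒯.Sh 0) (_ : 𝒯.MemVh P 0 U₀),
    ∃ U : Ω → 𝒯.C1,
      𝒯.MemWh P U ∧ 𝒯.IsSolution P α U₀ U ∧ 𝒯.IsSolution' P α U₀ U ∧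
      (∀ U' : Ω → 𝒯.C1, 𝒯.MemWh P U' →
        𝒯.IsSolution P α U₀ U' ∨ 𝒯.IsSolution' P α U₀ U' →
        ∀ᵐ ω ∂P, ∀ t ∈ Set.Icc 0 T, (U' ω).1 t = (U ω).1 t) ∧
      ((∀ t ∈ Set.Icc 0 T, ∀ σ, ∀ x ∈ 𝒯.E σ t, |𝒯.divVh σ t x| ≤ D) →
        𝒯.normL2Vh P U ≤ C₁ * 𝒯.normVh P 0 U₀ ∧
        ((∀ᵐ ω ∂P, ∀ t ∈ Set.Icc 0 T, ∀ σ, ∀ x ∈ 𝒯.E σ t,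
            ‖𝒯.Bh (S.invLift α ω) σ t x‖ ≤ B) →
          𝒯.normWh P U ≤ C₂ * 𝒯.normVh P 0 U₀)) := by
  -- C₁² bounds the H¹ part, and C₂² adds the bound for the material derivative. Both are fixed
  -- before the dimension, surface, mesh and probability space.
  refine ⟨√(ESFEM.EvolvingMesh.stabSq T αmin D), fun αmax B =>
    ⟨√(ESFEM.EvolvingMesh.stabSq T αmin D +
      ((|B| + D ^ 2) * ESFEM.EvolvingMesh.stabSq T αmin D + |αmax|)), ?_⟩⟩
  intro n hn S 𝒯 Ω _ P _ α hα U₀ hU₀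
  obtain ⟨A, hA, hAα⟩ := 𝒯.exists_stiffness hT hn hα
  obtain ⟨U, hU, h0, hR⟩ := ESFEM.EvolvingMesh.exists_solution hT hn hA hU₀
  obtain ⟨hs, hs'⟩ := ESFEM.EvolvingMesh.isSolution_of_residual hT hn hA hAα hU h0 hR
  -- The residual vanishes for every ω with the modified operator; almost surely this operator is
  -- the true stiffness, on which the estimates rely.
  have hode : ESFEM.EvolvingMesh.SolvesODE P α U := by
    filter_upwards [hAα] with ω hω t ht
    have h := hR ω t ht
    rw [ESFEM.EvolvingMesh.residual, hω t ht] at h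
    exact h
  refine ⟨U, hU, hs, hs', fun U' hU' hsol => ?_, fun hdiv => ?_⟩
  · have h0' : ∀ᵐ ω ∂P, (U' ω).1 0 = U₀ ω := hsol.elim (fun h => h.1) (fun h => h.1)
    filter_upwards [ESFEM.EvolvingMesh.residual_eq_zero hT hn hA hAα hU' hsol, h0, h0']
      with ω hω h1 h2
    exact ESFEM.EvolvingMesh.solution_unique hT hn hA (h2.trans h1.symm) (hR ω) hω
  · have hD : ∀ t ∈ Set.Icc 0 T, ∀ σ, |𝒯.divE σ t| ≤ D := fun t ht =>
      ESFEM.EvolvingMesh.abs_divE_le ht (hdiv t ht)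
    exact ⟨ESFEM.EvolvingMesh.normL2Vh_le hT hn hαmin hα hU hode hU₀ h0 hD,
      ESFEM.EvolvingMesh.normWh_le hT hn hαmin hα hU hode hU₀ h0 hD⟩
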